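/- **Setting.** For $i=1,2$ let $\Gamma_i$ be an infinite finitely generated virtually abelian group, $\Lambda_i\trianglelefteq\Gamma_i$ a normal subgroup of finite index with a fixed identification $\Lambda_i\cong\mathbb Z^{m_i}$, $m_i\ge 1$, let $F_i=\Lambda_i\backslash\Gamma_i$, and let $\Delta_i\ni \mathrm{id}$ be a set of representatives of $F_i$. Regard $\mathbb Z^{m_i}$ as a lattice in $\mathbb R^{m_i}$, where $\mathbb R^{m_i}$ carries a fixed scalar product (arbitrary, e.g. the standard one, or one invariant under $F_i$), and give $\mathbb R^{m_1}\times\mathbb R^{m_2}$ the product scalar product. *Transfer.* For $x\in\Delta_i$, $\gamma\in\Gamma_i$ write $x\gamma=\alpha_i(x,\gamma)x^\gamma$ with $\alpha_i(x,\gamma)\in\Lambda_i$, $x^\gamma\in\Delta_i$. The transfer is $\vartheta_i(\gamma)=\sum_{x\in\Delta_i}\alpha_i(x,\gamma)\in\mathbb Z^{m_i}$. Let $\mathrm{Ad}(f)$, $f\in F_i$, be the linear extension to $\mathbb R^{m_i}$ of the conjugation action of $f$ on $\Lambda_i$; the normalized transfer is $\underline\vartheta_i=\frac1{\#F_i}\sum_{f\in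 F_i}\mathrm{Ad}(f)$. *Covariance, drift and discrete Gaussian.* Let $\Gamma=\bigsqcup_{x\in\Delta}\Lambda x$ be one of $\Gamma_1,\Gamma_2$ or $\Gamma_1\times\Gamma_2$ (with $\Lambda_1\times\Lambda_2$, $\Delta_1\times\Delta_2$, $m=m_1+m_2$), let $\mu$ be a probability measure on $\Gamma$ with support $S$, and let $\Phi(vx)=v$ for $v\in\Lambda=\mathbb Z^m$, $x\in\Delta$. The quotient diagram has vertex set $\Delta$ and edges $e=(x,s)$, $s\in S\cup S^{-1}$, from $oe=x$ to $te=x^s$, with reversed edge $\bar e=(x^s,s^{-1})$. Put $c(e)=\mu(s)/\#\Delta$ and $\Phi_e=\Phi(xs)-\Phi(x)$. A $1$-form is a real function $\omega$ on edges with $\omega(\bar e)=-\omega(e)$. A $1$-form $u$ with $\sum_e u(e)^2c(e)<\infty$ is harmonic if $-\#\Delta\sum_{e:\,oe=x}c(e)u(e)+\sum_e c(e)u(e)=0$ for every $x\in\Delta$. A harmonic part of a $1$-form $\omega$ is a harmonic $u$ such that $\omega(e)=u(e)+f(te)-f(oe)$ for some $f:\Delta\to\mathbb R$. For $v\in\mathbb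 R^m$ let $\widehat v(e)=\langle v,\Phi_e\rangle$. When each $\widehat v$ has a unique harmonic part, $\Sigma_\mu$ denotes the operator with $$\langle v_1,\Sigma_\mu v_2\rangle=\sum_e u_1(e)u_2(e)c(e)-\Big(\sum_e u_1(e)c(e)\Big)\Big(\sum_e u_2(e)c(e)\Big),$$ where $u_i$ is the harmonic part of $\widehat v_i$. Put $\zeta_c=\sum_e c(e)\Phi_e$. For positive definite $\Sigma$ let $\xi_\Sigma(v)=(2\pi)^{-m/2}(\det\Sigma)^{-1/2}\exp(-\frac12\langle v,\Sigma^{-1}v\rangle)$ and $$\mathcal N_{n,\Sigma,\zeta}(\gamma)=\frac1{\#\Delta}\,\frac{\xi_{n\Sigma}(\Phi(\gamma)-n\zeta)}{\sum_{w\in\mathbb Z^m}\xi_{n\Sigma}(w)}\qquad(\gamma\in\Gamma).$$ **Theorem (Structure Theorem).** Let $\nu$ be a probability measure on $\Gamma_1\times\Gamma_2$ with marginals $\mu^{(1)},\mu^{(2)}$, whose support generates $\Gamma_1\times\Gamma_2$ as a semigroup, which is aperiodic (the greatest common divisor of the lengths $n\ge1$ of the words $s_1\cdots s_n=\mathrm{id}$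 with letters in the support of $\nu$ is $1$) and which has finite second moment ($\sum_\gamma|\gamma|^2\nu(\gamma)<\infty$ for a word metric $|\cdot|$ of a finite generating set). Let $\nu_n$ be the $n$-th convolution power of $\nu$. Then, for $\nu$, $\mu^{(1)}$ and $\mu^{(2)}$, every $\widehat v$ has a unique harmonic part and the covariance operators $\Sigma_\nu$, $\Sigma_{\mu^{(1)}}$, $\Sigma_{\mu^{(2)}}$ exist; $\Sigma_\nu$ is symmetric and positive definite; the series $\zeta_c$ of $\nu$ converges absolutely; and $$\|\nu_n-\mathcal N_{n,\Sigma_\nu,\zeta_c}\|_{\mathrm{TV}}=\tfrac12\sum_{\gamma\in\Gamma_1\times\Gamma_2}|\nu_n(\gamma)-\mathcal N_{n,\Sigma_\nu,\zeta_c}(\gamma)|\longrightarrow0\qquad(n\to\infty).$$ Moreover $\zeta_c\in\mathrm{im}(\underline\vartheta_1)\oplus\mathrm{im}(\underline\vartheta_2)$, and in every basis adapted to the decomposition $\mathbb R^{m_1}\times\mathbb R^{m_2}=\mathrm{im}(\underline\vartheta_1)\oplus\mathrm{im}(\underline\vartheta_1)^\perp\oplus\mathrm{im}(\underline\vartheta_2)\oplus\mathrm{im}(\underline\vartheta_2)^\perp$,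 $$\Sigma_\nu=\left(\begin{array}{c|c}\Sigma_{\mu^{(1)}}&\begin{matrix}\ast&0\\0&0\end{matrix}\\\hline\begin{matrix}\ast&0\\0&0\end{matrix}&\Sigma_{\mu^{(2)}}\end{array}\right).$$ Here $\underline\vartheta_i$ coincides with $\vartheta_i/\#F_i$ on $\Lambda_i$, its image is the linear span of $\vartheta_i(\Gamma_i)$, and if the scalar product of $\mathbb R^{m_i}$ is invariant under $\mathrm{Ad}(F_i)$, then $\underline\vartheta_i$ is the orthogonal projection onto this span. -/

import Mathlib

open Filter Topology
open scoped ENNReal RealInnerProductSpace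

noncomputable section

namespace VirtAb

/-! ### Random walks on a group -/

section Walk

variable {G : Type*} [Group G]

/-- The `n`-th convolution power of `μ`, i.e. the law of `s₁ s₂ ⋯ sₙ` for independent
`sᵢ` of law `μ`. -/
def convPow (μ : PMF G) : ℕ → PMF G
  | 0 => PMF.pure 1
  | n + 1 => (convPow μ n).bind fun g => μ.map fun s => g * s

/-- The support of `μ` generates the group as a semigroup. -/
def IsNondegenerate (μ : PMF G) : Prop :=
  Subsemigroup.closure μ.support = ⊤

/-- The greatest common divisor of the lengths of the nontrivial directed loops at the identity,
with edges labelled by the support of `μ`, equals `1`. -/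
def IsAperiodic (μ : PMF G) : Prop :=
  ∀ d : ℕ, (∀ l : List G, l ≠ [] → (∀ s ∈ l, s ∈ μ.support) → l.prod = 1 → d ∣ l.length) → d = 1

/-- The word length with respect to `S ∪ S⁻¹`. -/
def wordLength (S : Finset G) (g : G) : ℕ :=
  sInf {n | ∃ l : List G, l.length = n ∧ (∀ s ∈ l, s ∈ S ∨ s⁻¹ ∈ S) ∧ l.prod = g}

/-- Finite second moment with respect to a word metric (equivalently, any word metric, as
they are all bi-Lipschitz equivalent). -/
def HasFiniteSecondMoment (μ : PMF G) : Prop :=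
  ∃ S : Finset G, Subgroup.closure (S : Set G) = ⊤ ∧
    ∑' g, (wordLength S g : ℝ≥0∞) ^ 2 * μ g < ⊤

/-- The total variation distance, as half of the `ℓ¹`-distance, with values in `[0, ∞]`. -/
def tvDist (f g : G → ℝ) : ℝ≥0∞ :=
  (∑' x, ENNReal.ofReal |f x - g x|) / 2

end Walk

/-! ### Weighted diagrams and harmonic `1`-forms -/

/-- A weighted diagram with finite vertex set `V` and edge set `E` (closed under reversal),
together with a stationary distribution `stat` of the associated Markov chain. -/
structure WeightedDiagram (V E : Type*) [Fintype V] where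
  o : E → V
  t : E → V
  rev : E → E
  o_rev : ∀ e, o (rev e) = t e
  t_rev : ∀ e, t (rev e) = o e
  rev_rev : ∀ e, rev (rev e) = e
  p : E → ℝ
  p_nonneg : ∀ e, 0 ≤ p e
  hasSum_p : ∀ x, HasSum (fun e : {e // o e = x} => p e) 1
  stat : V → ℝ
  stat_nonneg : ∀ x, 0 ≤ stat x
  sum_stat : ∑ x, stat x = 1
  stationary : ∀ x, HasSum (fun e : {e // t e = x} => stat (o e) * p e) (stat x)

namespace WeightedDiagram

variable {V E : Type*} [Fintype V] (G : WeightedDiagram V E)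

/-- The conductance of an edge. -/
def c (e : E) : ℝ := G.stat (G.o e) * G.p e

/-- `1`-forms. -/
def IsOneForm (ω : E → ℝ) : Prop := ∀ e, ω (G.rev e) = -ω e

/-- Square integrable `1`-forms. -/
def IsL2OneForm (ω : E → ℝ) : Prop :=
  G.IsOneForm ω ∧ Summable fun e => ω e ^ 2 * G.c e

/-- The differential of a function on the vertices. -/
def d (f : V → ℝ) (e : E) : ℝ := f (G.t e) - f (G.o e)

/-- The operator `d*`. -/
def dstar (ω : E → ℝ) (x : V) : ℝ :=
  -(1 / G.stat x) * ∑' e : {e // G.o e = x}, G.c e * ω e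

/-- `χ_c(ω) = ∑ ω(e) c(e)`. -/
def chi (ω : E → ℝ) : ℝ := ∑' e, ω e * G.c e

/-- The space `H¹` of harmonic `1`-forms. -/
def IsHarmonic (u : E → ℝ) : Prop :=
  G.IsL2OneForm u ∧ ∀ x, G.dstar u x + G.chi u = 0

/-- `u` is the harmonic part of `ω`: `u ∈ H¹` and `ω = u + df` for some `f`. -/
def IsHarmonicPart (ω u : E → ℝ) : Prop :=
  G.IsHarmonic u ∧ ∃ f : V → ℝ, ω = u + G.d f

end WeightedDiagram

/-! ### Gaussian densities on a Euclidean space -/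

section Gaussian

variable {E : Type*} [NormedAddCommGroup E] [InnerProductSpace ℝ E]

/-- The density `ξ_Σ` of the centred Gaussian with covariance `Sig`. -/
def gaussDensity (Sig : E →ₗ[ℝ] E) (v : E) : ℝ :=
  1 / ((2 * Real.pi) ^ ((Module.finrank ℝ E : ℝ) / 2) * √(LinearMap.det Sig)) *
    Real.exp (-(1 / 2) * ⟪v, Ring.inverse Sig v⟫)

/-- `Sig` is self-adjoint, positive definite and non-degenerate. -/
def IsPosDef (Sig : E →ₗ[ℝ] E) : Prop :=
  Sig.IsSymmetric ∧ ∀ v, v ≠ 0 → 0 < ⟪v, Sig v⟫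

/-- A basis is adapted to the orthogonal decomposition `E = U ⊕ Uᗮ`. -/
def IsAdapted {ι ι' : Type*} (b : Module.Basis (ι ⊕ ι') ℝ E) (U : Submodule ℝ E) : Prop :=
  (∀ i, b (Sum.inl i) ∈ U) ∧ ∀ i, b (Sum.inr i) ∈ Uᗮ

end Gaussian

/-! ### Virtually abelian groups -/

/-- The data attached to a virtually abelian group `Γ`: a normal subgroup `Λ` of finite index,
a set `Δ ∋ 1` of representatives of `Λ \ Γ`, an identification of `Λ` with `ℤ^κ`, and a
basis of the Euclidean space `E`. Through the basis, `E` is `ℝ^κ` equipped with some scalar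
product (the standard one if the basis is orthonormal). -/
structure LatticeFrame (Γ : Type*) [Group Γ] (κ : Type*) [Fintype κ] [DecidableEq κ]
    (E : Type*) [NormedAddCommGroup E] [InnerProductSpace ℝ E] where
  Λ : Subgroup Γ
  normal : Λ.Normal
  finiteIndex : Λ.FiniteIndex
  Δ : Set Γ
  compl : Subgroup.IsComplement (Λ : Set Γ) Δ
  one_mem : (1 : Γ) ∈ Δ
  coord : Additive Λ ≃+ (κ → ℤ)
  basis : Module.Basis κ ℝ E

namespace LatticeFrame

variable {Γ : Type*} [Group Γ] {κ : Type*} [Fintype κ] [DecidableEq κ]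
  {E : Type*} [NormedAddCommGroup E] [InnerProductSpace ℝ E] (D : LatticeFrame Γ κ E)

instance : Fintype D.Δ :=
  haveI := D.finiteIndex
  D.compl.finite_right.fintype

/-- The inclusion `ℤ^κ ⊂ ℝ^κ = E`. -/
def ofInt (z : κ → ℤ) : E := ∑ j, (z j : ℝ) • D.basis j

/-- The inclusion `Λ = ℤ^κ ⊂ ℝ^κ = E`. -/
def emb (l : D.Λ) : E := D.ofInt (D.coord (Additive.ofMul l))

/-- The `Λ`-component of `γ = v x` with `v ∈ Λ` and `x ∈ Δ`. -/
def lat (γ : Γ) : D.Λ := (D.compl.equiv γ).1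

/-- The `Δ`-component of `γ = v x` with `v ∈ Λ` and `x ∈ Δ`. -/
def rep (γ : Γ) : D.Δ := (D.compl.equiv γ).2

/-- The equivariant map `Φ : Γ → ℤ^κ ⊂ E`, `v x ↦ v`. -/
def Phi (γ : Γ) : E := D.emb (D.lat γ)

/-- The right action `x ↦ x^γ` of `Γ` on `Δ`. -/
def act (x : D.Δ) (γ : Γ) : D.Δ := D.rep (x * γ)

/-- The cocycle: `x γ = α(x, γ) x^γ`. -/
def cocycle (x : D.Δ) (γ : Γ) : D.Λ := D.lat (x * γ)

/-- The transfer `ϑ : Γ → Λ = ℤ^κ`. -/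
def transfer (γ : Γ) : κ → ℤ := ∑ x : D.Δ, D.coord (Additive.ofMul (D.cocycle x γ))

/-- The linear operator `Ad(γ)` of `E` which extends the conjugation `λ ↦ γ λ γ⁻¹` of `Λ`. -/
def Ad (γ : Γ) : E →ₗ[ℝ] E :=
  D.basis.constr ℝ fun j =>
    D.emb ⟨γ * (D.coord.symm (Pi.single j 1)).toMul * γ⁻¹,
      D.normal.conj_mem _ (D.coord.symm (Pi.single j 1)).toMul.2 γ⟩

/-- The normalized transfer `(1 / #F) ∑_{f ∈ F} Ad(f)` with `F = Λ \ Γ`. -/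
def normTransfer : E →ₗ[ℝ] E :=
  ((D.Λ.index : ℝ)⁻¹) • ∑ x : D.Δ, D.Ad x

theorem lat_mul_rep (γ : Γ) : (D.lat γ : Γ) * D.rep γ = γ :=
  D.compl.equiv_fst_mul_equiv_snd γ

theorem rep_mul (l : D.Λ) (γ : Γ) : D.rep (l * γ) = D.rep γ := by
  have h := D.compl.equiv_mul_left l γ
  unfold rep
  rw [h]

theorem rep_coe (x : D.Δ) : D.rep x = x := by
  exact D.compl.equiv_snd_eq_self_of_mem_of_one_mem D.Λ.one_mem x.2

theorem act_act (x : D.Δ) (γ γ' : Γ) : D.act (D.act x γ) γ' = D.act x (γ * γ') := by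
  have h : (x : Γ) * (γ * γ') = D.lat (x * γ) * (D.rep (x * γ) * γ') := by
    rw [← mul_assoc, ← mul_assoc, D.lat_mul_rep]
  unfold act
  rw [h, D.rep_mul]

theorem act_one (x : D.Δ) : D.act x 1 = x := by
  unfold act
  rw [mul_one, D.rep_coe]

/-- The labels `S ∪ S⁻¹`, where `S` is the support of `μ`. -/
abbrev Label (μ : PMF Γ) : Type _ := {s : Γ // s ∈ μ.support ∨ s⁻¹ ∈ μ.support}

theorem hasSum_label (μ : PMF Γ) : HasSum (fun s : Label μ => (μ s).toReal) 1 := by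
  have h1 : HasSum (fun s : Γ => (μ s).toReal) 1 := by
    have := ENNReal.hasSum_toReal (f := fun s => μ s) (by rw [μ.tsum_coe]; simp)
    rwa [← ENNReal.tsum_toReal_eq (fun s => μ.apply_ne_top s), μ.tsum_coe,
      ENNReal.toReal_one] at this
  refine (hasSum_subtype_iff_of_support_subset (s := {s | s ∈ μ.support ∨ s⁻¹ ∈ μ.support})
    ?_).2 h1
  intro s hs
  left
  rw [PMF.mem_support_iff]
  intro h
  simp [h] at hs

theorem card_ne_zero : (Fintype.card D.Δ : ℝ) ≠ 0 := by
  have : Nonempty D.Δ := ⟨⟨1, D.one_mem⟩⟩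
  exact_mod_cast Fintype.card_ne_zero

/-- The quotient diagram `Λ \ Cay(Γ, S)`, weighted by `μ`. An edge `(x, s)` goes from `x` to
`x^s`, and has weight `μ(s)`; the stationary distribution is uniform. -/
def diagram (μ : PMF Γ) : WeightedDiagram D.Δ (D.Δ × Label μ) where
  o e := e.1
  t e := D.act e.1 e.2
  rev e := (D.act e.1 e.2, ⟨(e.2 : Γ)⁻¹, by simpa using e.2.2.symm⟩)
  o_rev _ := rfl
  t_rev e := by simp [act_act, act_one]
  rev_rev e := by
    ext
    · simp [act_act, act_one]
    · simp
  p e := (μ e.2).toReal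
  p_nonneg _ := ENNReal.toReal_nonneg
  hasSum_p x := by
    let φ : Label μ ≃ {e : D.Δ × Label μ // e.1 = x} :=
      { toFun := fun s => ⟨(x, s), rfl⟩
        invFun := fun e => e.1.2
        left_inv := fun _ => rfl
        right_inv := by rintro ⟨⟨y, s⟩, rfl⟩; rfl }
    exact (Equiv.hasSum_iff φ).1 (hasSum_label μ)
  stat _ := 1 / Fintype.card D.Δ
  stat_nonneg _ := by positivity
  sum_stat := by
    rw [Finset.sum_const, Finset.card_univ, nsmul_eq_mul]
    exact mul_one_div_cancel D.card_ne_zero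
  stationary x := by
    let φ : Label μ ≃ {e : D.Δ × Label μ // D.act e.1 e.2 = x} :=
      { toFun := fun s => ⟨(D.act x (s : Γ)⁻¹, s), by simp [act_act, act_one]⟩
        invFun := fun e => e.1.2
        left_inv := fun _ => rfl
        right_inv := by rintro ⟨⟨y, s⟩, rfl⟩; simp [act_act, act_one] }
    refine (Equiv.hasSum_iff φ).1 ?_
    simpa [φ, Function.comp_def] using
      (hasSum_label μ).mul_left (1 / (Fintype.card D.Δ : ℝ))

/-- `Φ_e = Φ(γ s) - Φ(γ)` for the edge `e = ([γ], s)`. -/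
def edgeVec {μ : PMF Γ} (e : D.Δ × Label μ) : E := D.Phi (e.1 * e.2) - D.Phi e.1

/-- The `1`-form `v̂(e) = ⟨v, Φ_e⟩`. -/
def hat (μ : PMF Γ) (v : E) (e : D.Δ × Label μ) : ℝ := ⟪v, D.edgeVec e⟫

/-- The drift `ζ_c = ∑ c(e) Φ_e`. -/
def drift (μ : PMF Γ) : E := ∑' e, (D.diagram μ).c e • D.edgeVec e

/-- `Sig` is the covariance operator `Σ_μ`: every `v̂` has a unique harmonic part, and
`⟨v₁, Σ_μ v₂⟩ = ∑ u₁(e) u₂(e) c(e) - (∑ u₁(e) c(e)) (∑ u₂(e) c(e))`, where `uᵢ` is the harmonic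
part of `v̂ᵢ`. -/
def IsCovariance (μ : PMF Γ) (Sig : E →ₗ[ℝ] E) : Prop :=
  (∀ v : E, ∃! u, (D.diagram μ).IsHarmonicPart (D.hat μ v) u) ∧
  ∀ (v₁ v₂ : E) (u₁ u₂ : D.Δ × Label μ → ℝ),
    (D.diagram μ).IsHarmonicPart (D.hat μ v₁) u₁ →
    (D.diagram μ).IsHarmonicPart (D.hat μ v₂) u₂ →
    ⟪v₁, Sig v₂⟫ = ∑' e, u₁ e * u₂ e * (D.diagram μ).c e
      - (∑' e, u₁ e * (D.diagram μ).c e) * ∑' e, u₂ e * (D.diagram μ).c e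

/-- The distribution `N_{n, Σ, ζ}` on `Γ`: for `γ = v x`, the uniform weight of `x`, times
`ξ_{nΣ}(Φ(γ) - nζ)`, normalized by the sum of `ξ_{nΣ}` over the lattice `Λ = ℤ^κ`. -/
def gaussian (n : ℕ) (Sig : E →ₗ[ℝ] E) (ζ : E) (γ : Γ) : ℝ :=
  (1 / Fintype.card D.Δ) * (1 / ∑' l : D.Λ, gaussDensity ((n : ℝ) • Sig) (D.emb l)) *
    gaussDensity ((n : ℝ) • Sig) (D.Phi γ - (n : ℝ) • ζ)

end LatticeFrame

/-- The basis of `E₁ ⊕ E₂` (orthogonal direct sum) obtained from bases of the factors. -/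
def prodBasis {ι₁ ι₂ E₁ E₂ : Type*}
    [NormedAddCommGroup E₁] [InnerProductSpace ℝ E₁]
    [NormedAddCommGroup E₂] [InnerProductSpace ℝ E₂]
    (b₁ : Module.Basis ι₁ ℝ E₁) (b₂ : Module.Basis ι₂ ℝ E₂) :
    Module.Basis (ι₁ ⊕ ι₂) ℝ (WithLp 2 (E₁ × E₂)) :=
  (b₁.prod b₂).map (WithLp.linearEquiv 2 ℝ (E₁ × E₂)).symm

namespace LatticeFrame

variable {Γ₁ Γ₂ : Type*} [Group Γ₁] [Group Γ₂] {κ₁ κ₂ : Type*}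
  [Fintype κ₁] [DecidableEq κ₁] [Fintype κ₂] [DecidableEq κ₂] {E₁ E₂ : Type*}
  [NormedAddCommGroup E₁] [InnerProductSpace ℝ E₁]
  [NormedAddCommGroup E₂] [InnerProductSpace ℝ E₂]

/-- The product data on `Γ₁ × Γ₂`, with `Λ₁ × Λ₂ = ℤ^κ₁ × ℤ^κ₂` and `Δ₁ × Δ₂`. -/
def prod (D₁ : LatticeFrame Γ₁ κ₁ E₁) (D₂ : LatticeFrame Γ₂ κ₂ E₂) :
    LatticeFrame (Γ₁ × Γ₂) (κ₁ ⊕ κ₂) (WithLp 2 (E₁ × E₂)) where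
  Λ := D₁.Λ.prod D₂.Λ
  normal :=
    haveI := D₁.normal
    haveI := D₂.normal
    Subgroup.prod_normal _ _
  finiteIndex := by
    refine ⟨?_⟩
    rw [Subgroup.index_prod]
    exact mul_ne_zero D₁.finiteIndex.index_ne_zero D₂.finiteIndex.index_ne_zero
  Δ := D₁.Δ ×ˢ D₂.Δ
  compl := by
    constructor
    · rintro ⟨⟨⟨a, b⟩, ha⟩, ⟨⟨c, d⟩, hc⟩⟩ ⟨⟨⟨a', b'⟩, ha'⟩, ⟨⟨c', d'⟩, hc'⟩⟩ h
      have h1 := D₁.compl.1 (a₁ := (⟨a, ha.1⟩, ⟨c, hc.1⟩)) (a₂ := (⟨a', ha'.1⟩, ⟨c', hc'.1⟩))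
        (congrArg Prod.fst h)
      have h2 := D₂.compl.1 (a₁ := (⟨b, ha.2⟩, ⟨d, hc.2⟩)) (a₂ := (⟨b', ha'.2⟩, ⟨d', hc'.2⟩))
        (congrArg Prod.snd h)
      simp only [Prod.mk.injEq, Subtype.mk.injEq] at h1 h2 ⊢
      tauto
    · rintro ⟨g, h⟩
      obtain ⟨⟨⟨a, ha⟩, ⟨c, hc⟩⟩, h1⟩ := D₁.compl.2 g
      obtain ⟨⟨⟨b, hb⟩, ⟨d, hd⟩⟩, h2⟩ := D₂.compl.2 h
      exact ⟨(⟨(a, b), ha, hb⟩, ⟨(c, d), hc, hd⟩), Prod.ext h1 h2⟩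
  one_mem := ⟨D₁.one_mem, D₂.one_mem⟩
  coord :=
    { toFun := fun l => Sum.elim
        (D₁.coord (Additive.ofMul ⟨l.toMul.1.1, l.toMul.2.1⟩))
        (D₂.coord (Additive.ofMul ⟨l.toMul.1.2, l.toMul.2.2⟩))
      invFun := fun z => Additive.ofMul
        ⟨((D₁.coord.symm (z ∘ Sum.inl)).toMul, (D₂.coord.symm (z ∘ Sum.inr)).toMul),
          (D₁.coord.symm (z ∘ Sum.inl)).toMul.2, (D₂.coord.symm (z ∘ Sum.inr)).toMul.2⟩
      left_inv := fun l => by simp [Sum.elim_comp_inl, Sum.elim_comp_inr]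
      right_inv := fun z => by simp
      map_add' := fun l l' => by
        have h1 := D₁.coord.map_add (Additive.ofMul ⟨l.toMul.1.1, l.toMul.2.1⟩)
          (Additive.ofMul ⟨l'.toMul.1.1, l'.toMul.2.1⟩)
        have h2 := D₂.coord.map_add (Additive.ofMul ⟨l.toMul.1.2, l.toMul.2.2⟩)
          (Additive.ofMul ⟨l'.toMul.1.2, l'.toMul.2.2⟩)
        funext i
        rcases i with i | i
        · exact congrFun h1 i
        · exact congrFun h2 i }
  basis := prodBasis D₁.basis D₂.basis

end LatticeFrame

end VirtAb

end

noncomputable section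

namespace VirtAb

/-! ### The cocycle, the adjoint action and the transfer. -/

namespace LatticeFrame

variable {Γ : Type*} [Group Γ] {κ : Type*} [Fintype κ] [DecidableEq κ]
  {E : Type*} [NormedAddCommGroup E] [InnerProductSpace ℝ E] (D : LatticeFrame Γ κ E)

/-! Writing `γ = v x` turns the walk on `Γ` into a finite Markov chain on `Δ` together with an
additive functional in `ℤ^κ`: by the cocycle identity `vec_mul`, the lattice part of `s₁ ⋯ sₙ` is
the sum of the vectors `vec xᵢ₋₁ sᵢ` along the chain. Each group element permutes `Δ`, so the
uniform law is stationary.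

Covariance. Solving a Poisson equation on `Δ` (`exists_poisson`) subtracts a coboundary from `v̂` so
that the remaining increments have the same mean at every vertex; this is the harmonic part. Once
centred, they are martingale differences, and `Σ` is their averaged variance. If it vanished at `v`,
the harmonic part would be deterministic: `n ⟨v, ζ⟩` on words of length `n`. Since the identity is
itself a word of positive length, the drift term is zero, and then `v` is orthogonal to the lattice
(`eq_zero_of_cov_self`).

Block form. The harmonic part of a marginal pulls back to a harmonic part on the product, whence the
diagonal blocks (`inner_covariance`). In an off-diagonal entry the average over `Δ₁ × Δ₂`, for a
fixed increment, factors into two averages. In each of them the coboundary disappears because the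
increment permutes `Δᵢ`, and only the pairing with the transfer is left. So everything orthogonal to
the transfers drops out (`inner_covariance_eq_zero`); the drift is treated in the same way.

Gaussian limit. Characteristic functions of `νₙ` on the fibres of `Γ → Δ` are entries of powers of
twisted operators on `ℂ^Δ` (`scaledTwist_pow_single`). At frequency `v / √n` an explicit function is
an eigenvector up to `o(1/n)` with eigenvalue `1 - σ/(2n)`. As the operators are contractions, the
errors add up to `o(1)` over `n` steps; the part orthogonal to constants dies by mixing
(`tendsto_scaledTwist`). On the whole growing frequency cube, a high convolution power charges both
`1` and the generators of `Λ`, and the resulting interference gives a Gaussian bound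
(`exists_norm_scaledTwist_pow_le`). Dominated convergence in the Fourier inversion formula then
yields a pointwise local limit theorem (`tendsto_mul_cell`), and Scheffé's lemma, applied to step
functions on `ℝ^κ`, turns it into convergence in total variation. -/

theorem lat_mul (l : D.Λ) (γ : Γ) : D.lat (l * γ) = l * D.lat γ := by
  have h := D.compl.equiv_mul_left l γ
  unfold lat
  rw [h]

theorem lat_coe_rep (x : D.Δ) : D.lat x = 1 := by
  have h := D.lat_mul_rep x
  rw [D.rep_coe] at h
  exact Subtype.ext (by simpa using h)

theorem lat_mul_coe (l : D.Λ) (x : D.Δ) : D.lat (l * x) = l := by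
  rw [lat_mul, lat_coe_rep, mul_one]

theorem rep_mul_coe (l : D.Λ) (x : D.Δ) : D.rep (l * x) = x := by
  rw [rep_mul, rep_coe]

theorem cocycle_mul_act (x : D.Δ) (γ : Γ) : (D.cocycle x γ : Γ) * D.act x γ = x * γ :=
  D.lat_mul_rep _

theorem cocycle_mul (x : D.Δ) (γ γ' : Γ) :
    D.cocycle x (γ * γ') = D.cocycle x γ * D.cocycle (D.act x γ) γ' := by
  have h : (x : Γ) * (γ * γ') = D.cocycle x γ * (D.act x γ * γ') := by
    rw [← mul_assoc, ← mul_assoc, cocycle_mul_act]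
  unfold cocycle
  rw [h, lat_mul]
  rfl

theorem act_eq_of_mul_eq {x y : D.Δ} {γ : Γ} {l : D.Λ} (h : (x : Γ) * γ = l * y) :
    D.act x γ = y := by
  unfold act
  rw [h, rep_mul_coe]

theorem cocycle_eq_of_mul_eq {x y : D.Δ} {γ : Γ} {l : D.Λ} (h : (x : Γ) * γ = l * y) :
    D.cocycle x γ = l := by
  unfold cocycle
  rw [h, lat_mul_coe]

theorem act_inv_mul (x y : D.Δ) : D.act x ((x : Γ)⁻¹ * y) = y :=
  D.act_eq_of_mul_eq (l := 1) (by simp)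

/-- Conjugation of an element of `Λ`. -/
def conj (γ : Γ) (l : D.Λ) : D.Λ := ⟨γ * l * γ⁻¹, D.normal.conj_mem _ l.2 γ⟩

/-- By normality `x l = (x l x⁻¹) x`, so `Λ` acts trivially on its cosets. -/
theorem act_coe (x : D.Δ) (l : D.Λ) : D.act x l = x :=
  D.act_eq_of_mul_eq (l := D.conj x l) (by simp [conj])

theorem cocycle_coe (x : D.Δ) (l : D.Λ) : D.cocycle x l = D.conj x l :=
  D.cocycle_eq_of_mul_eq (y := x) (by simp [conj])

theorem act_bijective (γ : Γ) : Function.Bijective fun x => D.act x γ := by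
  refine Function.bijective_iff_has_inverse.2 ⟨fun x => D.act x γ⁻¹, fun x => ?_, fun x => ?_⟩
  · simp [act_act, act_one]
  · simp [act_act, act_one]

/-- Group elements permute `Δ`. This one fact makes the uniform law stationary, the transfer
additive, and coboundaries of zero average. -/
theorem sum_act {M : Type*} [AddCommMonoid M] (f : D.Δ → M) (γ : Γ) :
    ∑ x, f (D.act x γ) = ∑ x, f x :=
  (D.act_bijective γ).sum_comp f

theorem ofInt_add (z w : κ → ℤ) : D.ofInt (z + w) = D.ofInt z + D.ofInt w := by
  simp [ofInt, add_smul, Finset.sum_add_distrib]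

/-- The inclusion `ℤ^κ ⊂ E` as an additive homomorphism. -/
def ofIntHom : (κ → ℤ) →+ E := AddMonoidHom.mk' D.ofInt D.ofInt_add

theorem ofIntHom_apply (z : κ → ℤ) : D.ofIntHom z = D.ofInt z := rfl

theorem ofInt_sum {ι : Type*} (s : Finset ι) (z : ι → κ → ℤ) :
    D.ofInt (∑ i ∈ s, z i) = ∑ i ∈ s, D.ofInt (z i) :=
  map_sum D.ofIntHom z s

theorem ofInt_single (j : κ) : D.ofInt (Pi.single j 1) = D.basis j := by
  unfold ofInt
  rw [Finset.sum_eq_single j]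
  · simp
  · intro i _ h
    simp [Pi.single_eq_of_ne h]
  · simp

theorem emb_mul (l l' : D.Λ) : D.emb (l * l') = D.emb l + D.emb l' := by
  simp [emb, ofInt_add]

theorem emb_one : D.emb 1 = 0 := by
  simpa using D.emb_mul 1 1

/-- The element `e_j` of `Λ = ℤ^κ`. -/
def gen (j : κ) : D.Λ := (D.coord.symm (Pi.single j 1)).toMul

theorem coord_gen (j : κ) : D.coord (Additive.ofMul (D.gen j)) = Pi.single j 1 := by
  simp [gen]

theorem emb_gen (j : κ) : D.emb (D.gen j) = D.basis j := by
  rw [emb, coord_gen, ofInt_single]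

theorem mul_comm_lat (l l' : D.Λ) : l * l' = l' * l := by
  have : Additive.ofMul l + Additive.ofMul l' = Additive.ofMul l' + Additive.ofMul l := by
    apply D.coord.injective
    rw [map_add, map_add, add_comm]
  exact this

theorem conj_mul (γ : Γ) (l l' : D.Λ) : D.conj γ (l * l') = D.conj γ l * D.conj γ l' :=
  Subtype.ext (by simp [conj])

theorem conj_conj (γ γ' : Γ) (l : D.Λ) : D.conj γ (D.conj γ' l) = D.conj (γ * γ') l :=
  Subtype.ext (by simp [conj, mul_assoc])

theorem conj_coe (l l' : D.Λ) : D.conj l l' = l' := by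
  apply Subtype.ext
  have h := congrArg Subtype.val (D.mul_comm_lat l l')
  simp only [Subgroup.coe_mul] at h
  simp [conj, h]

theorem Ad_basis (γ : Γ) (j : κ) : D.Ad γ (D.basis j) = D.emb (D.conj γ (D.gen j)) := by
  simp [Ad, conj, gen]

/-- `Ad` is defined through its values on a basis; both sides are additive in `ℤ^κ` and agree on the
standard generators. -/
theorem Ad_emb (γ : Γ) (l : D.Λ) : D.Ad γ (D.emb l) = D.emb (D.conj γ l) := by
  let a : (κ → ℤ) →+ E := (D.Ad γ).toAddMonoidHom.comp D.ofIntHom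
  let b : (κ → ℤ) →+ E := AddMonoidHom.mk'
    (fun z => D.emb (D.conj γ (D.coord.symm z).toMul)) (fun z w => by
      simp only [map_add, toMul_add, conj_mul, emb_mul])
  have hab : a = b := by
    refine AddMonoidHom.functions_ext' (M := fun _ : κ => ℤ) _ _ _ fun j => ?_
    ext
    change D.Ad γ (D.ofInt (Pi.single j 1)) = D.emb (D.conj γ (D.gen j))
    rw [ofInt_single, Ad_basis]
  have h := DFunLike.congr_fun hab (D.coord (Additive.ofMul l))
  simpa [a, b, ofIntHom_apply, emb] using h

theorem Ad_Ad (γ γ' : Γ) (v : E) : D.Ad γ (D.Ad γ' v) = D.Ad (γ * γ') v := by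
  have : D.Ad γ ∘ₗ D.Ad γ' = D.Ad (γ * γ') := by
    refine D.basis.ext fun j => ?_
    rw [LinearMap.comp_apply, ← emb_gen, Ad_emb, Ad_emb, Ad_emb, conj_conj]
  exact LinearMap.congr_fun this v

theorem Ad_coe (l : D.Λ) (v : E) : D.Ad l v = v := by
  have : D.Ad l = LinearMap.id := by
    refine D.basis.ext fun j => ?_
    rw [← emb_gen, Ad_emb, conj_coe, LinearMap.id_apply]
  rw [this, LinearMap.id_apply]

/-- `Λ` is abelian, so it acts trivially by conjugation on itself and `Ad` factors through the
finite quotient. -/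
theorem Ad_rep (γ : Γ) (v : E) : D.Ad (D.rep γ) v = D.Ad γ v := by
  conv_rhs => rw [← D.lat_mul_rep γ, ← Ad_Ad, Ad_coe]

theorem card_Δ : Fintype.card D.Δ = D.Λ.index := by
  have := D.finiteIndex
  rw [← D.compl.card_right, Nat.card_eq_fintype_card]

theorem transfer_mul (γ γ' : Γ) : D.transfer (γ * γ') = D.transfer γ + D.transfer γ' := by
  unfold transfer
  rw [← D.sum_act (fun x => D.coord (Additive.ofMul (D.cocycle x γ'))) γ, ← Finset.sum_add_distrib]
  refine Finset.sum_congr rfl fun x _ => ?_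
  rw [cocycle_mul, ofMul_mul, map_add]

theorem transfer_one : D.transfer 1 = 0 := by
  simpa using D.transfer_mul 1 1

theorem transfer_pow (γ : Γ) (n : ℕ) : D.transfer (γ ^ n) = n • D.transfer γ := by
  induction n with
  | zero => simp [transfer_one]
  | succ n ih => rw [pow_succ, transfer_mul, ih, succ_nsmul]

theorem ofInt_transfer (γ : Γ) :
    D.ofInt (D.transfer γ) = ∑ x, D.emb (D.cocycle x γ) := by
  rw [transfer, ofInt_sum]
  rfl

theorem normTransfer_emb (l : D.Λ) :
    D.normTransfer (D.emb l) = (D.Λ.index : ℝ)⁻¹ • D.ofInt (D.transfer l) := by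
  rw [ofInt_transfer, normTransfer, LinearMap.smul_apply, LinearMap.sum_apply]
  simp only [Ad_emb, cocycle_coe]

theorem index_ne_zero : (D.Λ.index : ℝ) ≠ 0 :=
  Nat.cast_ne_zero.2 D.finiteIndex.index_ne_zero

/-- One inclusion is read off on the basis. For the other, a transfer `ϑ(γ)` is the image of `γ ^
index ∈ Λ`: additivity produces a factor `index`, which cancels the normalization. -/
theorem range_normTransfer :
    LinearMap.range D.normTransfer =
      Submodule.span ℝ (Set.range fun γ => D.ofInt (D.transfer γ)) := by
  apply le_antisymm
  · rw [LinearMap.range_eq_map, ← D.basis.span_eq, Submodule.map_span, Submodule.span_le]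
    rintro _ ⟨_, ⟨j, rfl⟩, rfl⟩
    rw [← emb_gen, normTransfer_emb]
    exact Submodule.smul_mem _ _ (Submodule.subset_span ⟨_, rfl⟩)
  · rw [Submodule.span_le]
    rintro _ ⟨γ, rfl⟩
    have := D.normal
    have hmem : γ ^ D.Λ.index ∈ D.Λ := D.Λ.pow_index_mem γ
    have h := D.normTransfer_emb ⟨_, hmem⟩
    rw [transfer_pow, ← ofIntHom_apply, map_nsmul, ← Nat.cast_smul_eq_nsmul ℝ, smul_smul,
      inv_mul_cancel₀ D.index_ne_zero, one_smul] at h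
    exact ⟨_, h⟩

/-- `Δ` represents the cosets `Λ x`, which left multiplication permutes only because `Λ` is normal:
a relation between `γ x` and `γ y` modulo `Λ` is conjugated by `γ⁻¹` to one between `x` and `y`. -/
theorem rep_mul_left_injective (γ : Γ) : Function.Injective fun x : D.Δ => D.rep (γ * x) := by
  intro x y h
  have hx := D.lat_mul_rep (γ * x)
  have hy := D.lat_mul_rep (γ * y)
  dsimp only at h
  rw [← h] at hy
  set l := D.lat (γ * x)
  set l' := D.lat (γ * y)
  have e : (x : Γ) = D.conj γ⁻¹ (l * l'⁻¹) * y := by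
    have h1 : (x : Γ) = γ⁻¹ * (l * D.rep (γ * x)) := by rw [hx]; group
    have h2 : (D.rep (γ * x) : Γ) = (l' : Γ)⁻¹ * (γ * y) := by rw [← hy]; group
    rw [h1, h2]
    simp [conj, mul_assoc]
  have h3 := congrArg D.rep e
  rwa [rep_coe, rep_mul_coe] at h3

theorem Ad_normTransfer (γ : Γ) (v : E) : D.Ad γ (D.normTransfer v) = D.normTransfer v := by
  simp only [normTransfer, LinearMap.smul_apply, LinearMap.sum_apply, map_smul, map_sum, Ad_Ad]
  congr 1
  simp only [← D.Ad_rep (γ * _)]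
  exact (Finite.injective_iff_bijective.1 (D.rep_mul_left_injective γ)).sum_comp
    fun x : D.Δ => D.Ad x v

/-- Vectors in the range are fixed by the isometries `Ad x`, so averaging `v` does not change its
inner product with them; hence `v` minus its average is orthogonal to the range. -/
theorem normTransfer_eq_starProjection [FiniteDimensional ℝ E]
    (hinv : ∀ γ v w, inner ℝ (D.Ad γ v) (D.Ad γ w) = inner ℝ v w) (v : E) :
    D.normTransfer v =
      (Submodule.span ℝ (Set.range fun γ => D.ofInt (D.transfer γ))).starProjection v := by
  symm
  rw [← range_normTransfer]
  refine Submodule.eq_starProjection_of_mem_of_inner_eq_zero ⟨v, rfl⟩ ?_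
  rintro _ ⟨w, rfl⟩
  have h : ∀ x : D.Δ, ⟪D.Ad x v, D.normTransfer w⟫ = ⟪v, D.normTransfer w⟫ := fun x => by
    conv_lhs => rw [← D.Ad_normTransfer x w]
    exact hinv _ _ _
  have h2 : ⟪D.normTransfer v, D.normTransfer w⟫ = ⟪v, D.normTransfer w⟫ := by
    conv_lhs => enter [2]; rw [normTransfer]
    simp only [LinearMap.smul_apply, LinearMap.sum_apply, inner_smul_left, sum_inner, h]
    simp only [Finset.sum_const, Finset.card_univ, card_Δ, nsmul_eq_mul]
    simp [← mul_assoc, inv_mul_cancel₀ D.index_ne_zero]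
  rw [inner_sub_left, h2, sub_self]

theorem Phi_mul (x : D.Δ) (γ : Γ) : D.Phi (x * γ) = D.emb (D.cocycle x γ) := rfl

theorem Phi_coe (x : D.Δ) : D.Phi x = 0 := by
  rw [Phi, lat_coe_rep, emb_one]

theorem edgeVec_eq {μ : PMF Γ} (e : D.Δ × Label μ) :
    D.edgeVec e = D.emb (D.cocycle e.1 e.2) := by
  rw [edgeVec, Phi_coe, sub_zero, Phi_mul]

end LatticeFrame

/-! ### Expectations -/

section Expectation

variable {G H : Type*} {F : Type*} [NormedAddCommGroup F] [NormedSpace ℝ F]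

/-- The expectation of `g` with respect to the discrete law `μ`. -/
def ev (μ : PMF G) (g : G → F) : F := ∑' s, (μ s).toReal • g s

theorem hasSum_toReal (μ : PMF G) : HasSum (fun s => (μ s).toReal) 1 := by
  have := ENNReal.hasSum_toReal (f := fun s => μ s) (by rw [μ.tsum_coe]; simp)
  rwa [← ENNReal.tsum_toReal_eq (fun s => μ.apply_ne_top s), μ.tsum_coe,
    ENNReal.toReal_one] at this

theorem ev_const (μ : PMF G) (a : F) : ev μ (fun _ => a) = a := by
  rw [ev, (hasSum_toReal μ).summable.tsum_smul_const, (hasSum_toReal μ).tsum_eq, one_smul]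

theorem norm_ev_le (μ : PMF G) {g : G → F} {C : ℝ} (h : ∀ s, ‖g s‖ ≤ C) : ‖ev μ g‖ ≤ C := by
  have h1 := (hasSum_toReal μ).mul_right C
  rw [one_mul] at h1
  refine tsum_of_norm_bounded h1 fun s => ?_
  rw [norm_smul, Real.norm_of_nonneg ENNReal.toReal_nonneg]
  exact mul_le_mul_of_nonneg_left (h s) ENNReal.toReal_nonneg

theorem ev_pure (a : G) (g : G → F) : ev (PMF.pure a) g = g a := by
  unfold ev
  rw [tsum_eq_single a]
  · simp
  · intro b hb
    simp [PMF.pure_apply, hb]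

variable [CompleteSpace F]

theorem summable_of_norm_le (μ : PMF G) {g : G → F} {C : ℝ} (h : ∀ s, ‖g s‖ ≤ C) :
    Summable fun s => (μ s).toReal • g s := by
  refine Summable.of_norm_bounded ((hasSum_toReal μ).summable.mul_right C) fun s => ?_
  rw [norm_smul, Real.norm_of_nonneg ENNReal.toReal_nonneg]
  exact mul_le_mul_of_nonneg_left (h s) ENNReal.toReal_nonneg

theorem hasSum_map (p : PMF G) (f : G → H) {g : H → F}
    (h : Summable fun a => (p a).toReal • g (f a)) :
    HasSum (fun b => (p.map f b).toReal • g b) (ev p fun a => g (f a)) := by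
  refine (h.hasSum.tsum_fiberwise f).congr_fun ?_
  intro b
  have h1 : (p.map f b).toReal = ∑' a : f ⁻¹' {b}, (p a).toReal := by
    rw [← PMF.toOuterMeasure_apply_singleton, PMF.toOuterMeasure_map_apply,
      PMF.toOuterMeasure_apply, tsum_subtype (f ⁻¹' {b}) fun a => (p a).toReal,
      ENNReal.tsum_toReal_eq]
    · refine tsum_congr fun a => ?_
      by_cases ha : a ∈ f ⁻¹' {b}
      · simp [Set.indicator_of_mem ha]
      · simp [Set.indicator_of_notMem ha]
    · intro a
      by_cases ha : a ∈ f ⁻¹' {b}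
      · simp [Set.indicator_of_mem ha, p.apply_ne_top]
      · simp [Set.indicator_of_notMem ha]
  have h2 : Summable fun a : f ⁻¹' {b} => (p a).toReal := (hasSum_toReal p).summable.subtype _
  rw [h1, ← h2.tsum_smul_const]
  refine tsum_congr fun a => ?_
  have : f a = b := a.2
  simp [this]

theorem ev_map (p : PMF G) (f : G → H) {g : H → F}
    (h : Summable fun a => (p a).toReal • g (f a)) :
    ev (p.map f) g = ev p fun a => g (f a) :=
  (hasSum_map p f h).tsum_eq

/-- Fubini for a double series dominated by `C` times the joint law. -/
theorem ev_bind (p : PMF G) (f : G → PMF H) {g : H → F} {C : ℝ} (h : ∀ b, ‖g b‖ ≤ C) :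
    ev (p.bind f) g = ev p fun a => ev (f a) g := by
  have h0 : Summable (Function.uncurry fun a b => ((p a).toReal * (f a b).toReal) • g b) := by
    have h1 : Summable fun x : G × H => (p x.1).toReal * (f x.1 x.2).toReal := by
      have hn : 0 ≤ fun x : G × H => (p x.1).toReal * (f x.1 x.2).toReal := fun x =>
        mul_nonneg ENNReal.toReal_nonneg ENNReal.toReal_nonneg
      rw [summable_prod_of_nonneg hn]
      refine ⟨fun a => Summable.mul_left (p a).toReal (hasSum_toReal (f a)).summable, ?_⟩
      have h2 : ∀ a, ∑' b, (p a).toReal * (f a b).toReal = (p a).toReal := fun a => by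
        rw [tsum_mul_left, (hasSum_toReal (f a)).tsum_eq, mul_one]
      simp only [h2]
      exact (hasSum_toReal p).summable
    refine Summable.of_norm_bounded (h1.mul_right C) fun x => ?_
    have hp : 0 ≤ (p x.1).toReal * (f x.1 x.2).toReal :=
      mul_nonneg ENNReal.toReal_nonneg ENNReal.toReal_nonneg
    simp only [Function.uncurry, norm_smul, Real.norm_of_nonneg hp]
    exact mul_le_mul_of_nonneg_left (h _) hp
  have h2 : ∀ b, ((p.bind f) b).toReal • g b
      = ∑' a, ((p a).toReal * (f a b).toReal) • g b := by
    intro b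
    have hne : ∀ a, p a * f a b ≠ ⊤ := fun a =>
      ENNReal.mul_ne_top (p.apply_ne_top a) ((f a).apply_ne_top b)
    rw [PMF.bind_apply, ENNReal.tsum_toReal_eq hne]
    simp only [ENNReal.toReal_mul]
    have := ENNReal.summable_toReal (f := fun a => p a * f a b)
      (by rw [← PMF.bind_apply]; exact PMF.apply_ne_top _ _)
    simp only [ENNReal.toReal_mul] at this
    exact (this.tsum_smul_const _).symm
  unfold ev
  rw [tsum_congr h2, h0.tsum_comm]
  refine tsum_congr fun a => ?_
  simp only [mul_smul]
  rw [(summable_of_norm_le (f a) h).tsum_const_smul]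

theorem ev_convPow_succ {G : Type*} [Group G] (μ : PMF G) (n : ℕ) {g : G → F} {C : ℝ}
    (h : ∀ b, ‖g b‖ ≤ C) :
    ev (convPow μ (n + 1)) g = ev (convPow μ n) fun γ => ev μ fun s => g (γ * s) := by
  rw [convPow, ev_bind _ _ h]
  congr 1
  funext γ
  exact ev_map _ _ (summable_of_norm_le μ fun s => h _)

end Expectation

/-! ### Supports of convolution powers -/

section Support

variable {G : Type*} [Group G] (μ : PMF G)

theorem one_mem_support_convPow_zero : (1 : G) ∈ (convPow μ 0).support := by
  simp [convPow]

theorem mul_mem_support_succ {n : ℕ} {γ s : G} (h : γ ∈ (convPow μ n).support)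
    (hs : s ∈ μ.support) : γ * s ∈ (convPow μ (n + 1)).support := by
  rw [convPow, PMF.mem_support_bind_iff]
  exact ⟨γ, h, (PMF.mem_support_map_iff _ _ _).2 ⟨s, hs, rfl⟩⟩

theorem mul_prod_mem_support {n : ℕ} {γ : G} (h : γ ∈ (convPow μ n).support) (l : List G)
    (hl : ∀ s ∈ l, s ∈ μ.support) : γ * l.prod ∈ (convPow μ (n + l.length)).support := by
  induction l generalizing n γ with
  | nil => simpa using h
  | cons s l ih =>
    rw [List.prod_cons, ← mul_assoc, List.length_cons, add_comm l.length, ← add_assoc]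
    exact ih (mul_mem_support_succ μ h (hl s (by simp))) fun t ht => hl t (by simp [ht])

theorem mul_mem_support_add {n k : ℕ} {γ γ' : G} (h : γ ∈ (convPow μ n).support)
    (h' : γ' ∈ (convPow μ k).support) : γ * γ' ∈ (convPow μ (n + k)).support := by
  induction k generalizing γ' with
  | zero =>
    simp only [convPow, PMF.support_pure, Set.mem_singleton_iff] at h'
    simpa [h'] using h
  | succ k ih =>
    rw [convPow, PMF.mem_support_bind_iff] at h'
    obtain ⟨a, ha, hb⟩ := h'
    obtain ⟨s, hs, rfl⟩ := (PMF.mem_support_map_iff _ _ _).1 hb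
    rw [← mul_assoc, ← add_assoc]
    exact mul_mem_support_succ μ (ih ha) hs

variable {μ}

theorem IsNondegenerate.exists_mem_support (h : IsNondegenerate μ) (γ : G) :
    ∃ k, γ ∈ (convPow μ k).support := by
  have hγ : γ ∈ Subsemigroup.closure μ.support := by rw [h]; trivial
  induction hγ using Subsemigroup.closure_induction with
  | mem s hs =>
    refine ⟨0 + 1, ?_⟩
    simpa using mul_mem_support_succ μ (one_mem_support_convPow_zero μ) hs
  | mul a b _ _ ha hb =>
    obtain ⟨k, hk⟩ := ha
    obtain ⟨k', hk'⟩ := hb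
    exact ⟨_, mul_mem_support_add μ hk hk'⟩

/-- The possible return times form an additive submonoid of `ℕ` of greatest common divisor `1`, and
such a submonoid contains all large integers. -/
theorem IsAperiodic.eventually_one_mem (h : IsAperiodic μ) :
    ∃ n₀, ∀ n ≥ n₀, (1 : G) ∈ (convPow μ n).support := by
  let A : AddSubmonoid ℕ :=
    { carrier := {n | (1 : G) ∈ (convPow μ n).support}
      zero_mem' := one_mem_support_convPow_zero μ
      add_mem' := fun {a b} ha hb => by simpa using mul_mem_support_add μ ha hb }
  have hd : Nat.setGcd (A : Set ℕ) = 1 := by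
    refine h _ fun l _ hs hl => Nat.setGcd_dvd_of_mem ?_
    have := mul_prod_mem_support μ (one_mem_support_convPow_zero μ) l hs
    simpa [A, hl] using this
  obtain ⟨n₀, hn⟩ := Nat.exists_mem_closure_of_ge (A : Set ℕ)
  refine ⟨n₀, fun n hn' => ?_⟩
  have := hn n hn' (by simp [hd])
  rw [AddSubmonoid.closure_eq] at this
  exact this

/-- Every finite set is charged by all high convolution powers. -/
theorem exists_forall_mem_support (h : IsNondegenerate μ) (h' : IsAperiodic μ) (K : Finset G) :
    ∃ n₀, ∀ n ≥ n₀, ∀ γ ∈ K, γ ∈ (convPow μ n).support := by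
  obtain ⟨n₁, h₁⟩ := h'.eventually_one_mem
  choose k hk using h.exists_mem_support
  -- Reach `γ` in `n` steps by a loop at `1` of length `n - k γ ≥ n₁` followed by a word of length
  -- `k γ`.
  refine ⟨n₁ + ∑ γ ∈ K, k γ, fun n hn γ hγ => ?_⟩
  have h2 : k γ ≤ ∑ γ ∈ K, k γ := Finset.single_le_sum (fun _ _ => Nat.zero_le _) hγ
  have := mul_mem_support_add μ (h₁ (n - k γ) (by omega)) (hk γ)
  rw [one_mul] at this
  convert this using 3
  omega

end Support

/-! ### Moments -/

namespace LatticeFrame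

variable {Γ : Type*} [Group Γ] {κ : Type*} [Fintype κ] [DecidableEq κ]
  {E : Type*} [NormedAddCommGroup E] [InnerProductSpace ℝ E] (D : LatticeFrame Γ κ E)

/-- The cocycle with values in `E`. -/
def vec (x : D.Δ) (γ : Γ) : E := D.emb (D.cocycle x γ)

theorem vec_mul (x : D.Δ) (γ γ' : Γ) :
    D.vec x (γ * γ') = D.vec x γ + D.vec (D.act x γ) γ' := by
  rw [vec, cocycle_mul, emb_mul]
  rfl

theorem vec_one (x : D.Δ) : D.vec x 1 = 0 := by
  have := D.vec_mul x 1 1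
  rw [act_one, mul_one] at this
  simpa using this

theorem vec_inv (x : D.Δ) (γ : Γ) : D.vec (D.act x γ) γ⁻¹ = -D.vec x γ := by
  have h := D.vec_mul x γ γ⁻¹
  rw [mul_inv_cancel, vec_one] at h
  exact (neg_eq_of_add_eq_zero_right h.symm).symm

theorem vec_coe (x : D.Δ) (l : D.Λ) : D.vec x l = D.emb (D.conj x l) := by
  rw [vec, cocycle_coe]

/-- The cocycle identity splits a word into letters, each contributing at most the maximum over the
finitely many pairs of a vertex and a letter; a sum over these pairs serves as `C`. -/
theorem exists_norm_vec_le (S : Finset Γ) (hS : Subgroup.closure (S : Set Γ) = ⊤) :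
    ∃ C, 0 ≤ C ∧ ∀ x γ, ‖D.vec x γ‖ ≤ C * wordLength S γ := by
  classical
  let C : ℝ := ∑ x, ∑ s ∈ S, (‖D.vec x s‖ + ‖D.vec x s⁻¹‖)
  have hC : ∀ x, ∀ s ∈ S, ‖D.vec x s‖ + ‖D.vec x s⁻¹‖ ≤ C := fun x s hs =>
    (Finset.single_le_sum (f := fun s => ‖D.vec x s‖ + ‖D.vec x s⁻¹‖)
      (fun _ _ => by positivity) hs).trans
    (Finset.single_le_sum (f := fun x => ∑ s ∈ S, (‖D.vec x s‖ + ‖D.vec x s⁻¹‖))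
      (fun _ _ => by positivity) (Finset.mem_univ x))
  have hC' : ∀ x s, (s ∈ S ∨ s⁻¹ ∈ S) → ‖D.vec x s‖ ≤ C := by
    rintro x s (hs | hs)
    · linarith [hC x s hs, norm_nonneg (D.vec x s⁻¹)]
    · have := hC x _ hs
      rw [inv_inv] at this
      linarith [norm_nonneg (D.vec x s⁻¹)]
  have hl : ∀ l : List Γ, (∀ s ∈ l, s ∈ S ∨ s⁻¹ ∈ S) → ∀ x, ‖D.vec x l.prod‖ ≤ C * l.length := by
    intro l
    induction l with
    | nil => intro _ x; simp [vec_one]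
    | cons s l ih =>
      intro h x
      rw [List.prod_cons, vec_mul, List.length_cons]
      push_cast
      have h1 := hC' x s (h s (by simp))
      have h2 := ih (fun t ht => h t (by simp [ht])) (D.act x s)
      linarith [norm_add_le (D.vec x s) (D.vec (D.act x s) l.prod)]
  refine ⟨C, by positivity, fun x γ => ?_⟩
  -- The infimum defining the word length would be `0` on the empty set; as `S` generates, it is
  -- attained by an actual word.
  have hne : {n | ∃ l : List Γ, l.length = n ∧ (∀ s ∈ l, s ∈ S ∨ s⁻¹ ∈ S) ∧
      l.prod = γ}.Nonempty := by
    have hγ : γ ∈ Subgroup.closure (S : Set Γ) := by rw [hS]; trivial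
    rw [← Subgroup.mem_toSubmonoid, Subgroup.closure_toSubmonoid] at hγ
    obtain ⟨l, h1, h2⟩ := Submonoid.exists_list_of_mem_closure hγ
    exact ⟨_, l, rfl, by simpa using h1, h2⟩
  obtain ⟨l, h1, h2, h3⟩ := Nat.sInf_mem hne
  have := hl l h2 x
  rw [h3, h1] at this
  exact this

/-- The increments of the walk are square integrable. -/
def HasMoment (μ : PMF Γ) : Prop := ∀ x, Summable fun s => (μ s).toReal * ‖D.vec x s‖ ^ 2

theorem hasMoment {μ : PMF Γ} (h : HasFiniteSecondMoment μ) : D.HasMoment μ := by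
  obtain ⟨S, hS, hsum⟩ := h
  obtain ⟨C, hC0, hC⟩ := D.exists_norm_vec_le S hS
  intro x
  have h1 := (ENNReal.summable_toReal hsum.ne).mul_right (C ^ 2)
  refine Summable.of_nonneg_of_le (fun s => by positivity) (fun s => ?_) h1
  have h2 : ‖D.vec x s‖ ^ 2 ≤ (C * wordLength S s) ^ 2 :=
    pow_le_pow_left₀ (norm_nonneg _) (hC x s) 2
  rw [ENNReal.toReal_mul, ENNReal.toReal_pow, ENNReal.toReal_natCast]
  calc (μ s).toReal * ‖D.vec x s‖ ^ 2 ≤ (μ s).toReal * (C * wordLength S s) ^ 2 := by gcongr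
    _ = _ := by ring

end LatticeFrame

/-! ### Square integrable functions -/

section SquareIntegrable

variable {G : Type*} (μ : PMF G)

/-- Square integrability of a real function with respect to a discrete law. -/
def SqInt (g : G → ℝ) : Prop := Summable fun s => (μ s).toReal * g s ^ 2

variable {μ}

theorem SqInt.of_bounded {g : G → ℝ} {C : ℝ} (h : ∀ s, |g s| ≤ C) : SqInt μ g :=
  summable_of_norm_le μ (g := fun s => g s ^ 2) (C := C ^ 2) fun s => by
    rw [norm_pow]
    exact pow_le_pow_left₀ (norm_nonneg _) (h s) 2

theorem SqInt.sub {g h : G → ℝ} (hg : SqInt μ g) (hh : SqInt μ h) :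
    SqInt μ fun s => g s - h s := by
  refine Summable.of_nonneg_of_le (fun s => mul_nonneg ENNReal.toReal_nonneg (sq_nonneg _))
    (fun s => ?_) ((hg.mul_left 2).add (hh.mul_left 2))
  have h0 : 0 ≤ (μ s).toReal := ENNReal.toReal_nonneg
  nlinarith [mul_nonneg h0 (sq_nonneg (g s + h s))]

theorem SqInt.summable_mul {g h : G → ℝ} (hg : SqInt μ g) (hh : SqInt μ h) :
    Summable fun s => (μ s).toReal • (g s * h s) := by
  refine Summable.of_norm_bounded (hg.add hh) fun s => ?_
  have h0 : 0 ≤ (μ s).toReal := ENNReal.toReal_nonneg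
  rw [norm_smul, Real.norm_of_nonneg h0, ← mul_add]
  refine mul_le_mul_of_nonneg_left ?_ h0
  rw [Real.norm_eq_abs, abs_le]
  constructor <;> nlinarith [sq_nonneg (g s + h s), sq_nonneg (g s - h s)]

theorem SqInt.summable {g : G → ℝ} (hg : SqInt μ g) :
    Summable fun s => (μ s).toReal • g s := by
  simpa using hg.summable_mul (h := fun _ => 1) (SqInt.of_bounded (C := 1) (by simp))

theorem ev_add {F : Type*} [NormedAddCommGroup F] [NormedSpace ℝ F] {g h : G → F}
    (hg : Summable fun s => (μ s).toReal • g s) (hh : Summable fun s => (μ s).toReal • h s) :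
    ev μ (fun s => g s + h s) = ev μ g + ev μ h := by
  unfold ev
  rw [← hg.tsum_add hh]
  simp only [smul_add]

theorem ev_sub {F : Type*} [NormedAddCommGroup F] [NormedSpace ℝ F] {g h : G → F}
    (hg : Summable fun s => (μ s).toReal • g s) (hh : Summable fun s => (μ s).toReal • h s) :
    ev μ (fun s => g s - h s) = ev μ g - ev μ h := by
  unfold ev
  rw [← hg.tsum_sub hh]
  simp only [smul_sub]

theorem ev_mul_left {𝕜 : Type*} [RCLike 𝕜] (a : 𝕜) (g : G → 𝕜) :
    ev μ (fun s => a * g s) = a * ev μ g := by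
  unfold ev
  rw [← tsum_mul_left]
  simp only [mul_smul_comm]

theorem ev_sq_eq_zero {g : G → ℝ} (hg : SqInt μ g) (h : ev μ (fun s => g s ^ 2) = 0) {s : G}
    (hs : s ∈ μ.support) : g s = 0 := by
  have h1 := (hasSum_zero_iff_of_nonneg (f := fun s => (μ s).toReal * g s ^ 2)
    fun s => mul_nonneg ENNReal.toReal_nonneg (sq_nonneg _)).1 (by
      rw [← h]; exact hg.hasSum)
  have h2 := congrFun h1 s
  have h3 : (μ s).toReal ≠ 0 := ENNReal.toReal_ne_zero.2 ⟨hs, μ.apply_ne_top s⟩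
  simpa [h3] using h2

end SquareIntegrable

/-! ### Averages over `Δ`, the quotient chain and its Poisson equation. -/

namespace LatticeFrame

variable {Γ : Type*} [Group Γ] {κ : Type*} [Fintype κ] [DecidableEq κ]
  {E : Type*} [NormedAddCommGroup E] [InnerProductSpace ℝ E] (D : LatticeFrame Γ κ E)

/-- The average over `Δ`. -/
def avg {F : Type*} [AddCommGroup F] [Module ℝ F] (f : D.Δ → F) : F :=
  (1 / Fintype.card D.Δ : ℝ) • ∑ x, f x

theorem avg_const {F : Type*} [AddCommGroup F] [Module ℝ F] (a : F) :
    D.avg (fun _ => a) = a := by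
  rw [avg, Finset.sum_const, Finset.card_univ, ← Nat.cast_smul_eq_nsmul ℝ, smul_smul,
    one_div_mul_cancel D.card_ne_zero, one_smul]

theorem avg_add {F : Type*} [AddCommGroup F] [Module ℝ F] (f g : D.Δ → F) :
    D.avg (fun x => f x + g x) = D.avg f + D.avg g := by
  simp [avg, Finset.sum_add_distrib]

theorem avg_sub {F : Type*} [AddCommGroup F] [Module ℝ F] (f g : D.Δ → F) :
    D.avg (fun x => f x - g x) = D.avg f - D.avg g := by
  simp [avg, Finset.sum_sub_distrib, smul_sub]

theorem avg_act {F : Type*} [AddCommGroup F] [Module ℝ F] (f : D.Δ → F) (γ : Γ) :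
    D.avg (fun x => f (D.act x γ)) = D.avg f := by
  rw [avg, sum_act, avg]

theorem avg_nonneg {f : D.Δ → ℝ} (hf : ∀ x, 0 ≤ f x) : 0 ≤ D.avg f :=
  smul_nonneg (by positivity) (Finset.sum_nonneg fun x _ => hf x)

theorem eq_zero_of_avg_eq_zero {f : D.Δ → ℝ} (hf : ∀ x, 0 ≤ f x) (h : D.avg f = 0) (x : D.Δ) :
    f x = 0 := by
  rw [avg, smul_eq_mul, mul_eq_zero, Finset.sum_eq_zero_iff_of_nonneg fun x _ => hf x] at h
  rcases h with h | h
  · exact absurd h (one_div_ne_zero D.card_ne_zero)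
  · exact h x (Finset.mem_univ x)

variable {D} (μ : PMF Γ)

theorem sqInt_comp (f : D.Δ → ℝ) (g : Γ → D.Δ) : SqInt μ fun s => f (g s) :=
  SqInt.of_bounded (C := ∑ y, |f y|) fun s =>
    Finset.single_le_sum (f := fun y => |f y|) (fun _ _ => abs_nonneg _) (Finset.mem_univ (g s))

theorem avg_ev {F : Type*} [NormedAddCommGroup F] [NormedSpace ℝ F] (g : D.Δ → Γ → F)
    (h : ∀ x, Summable fun s => (μ s).toReal • g x s) :
    D.avg (fun x => ev μ (g x)) = ev μ fun s => D.avg fun x => g x s := by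
  unfold avg ev
  rw [← Summable.tsum_finsetSum fun x _ => h x, ← tsum_const_smul'']
  refine tsum_congr fun s => ?_
  simp only [Finset.smul_sum, smul_comm (μ s).toReal]

variable (D)

/-- The Markov operator of the walk on `Δ`. -/
def markov : (D.Δ → ℝ) →ₗ[ℝ] D.Δ → ℝ where
  toFun f x := ev μ fun s => f (D.act x s)
  map_add' f g := by
    funext x
    exact ev_add (sqInt_comp μ f _).summable (sqInt_comp μ g _).summable
  map_smul' a f := by
    funext x
    exact ev_mul_left a _

theorem markov_apply (f : D.Δ → ℝ) (x : D.Δ) :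
    D.markov μ f x = ev μ fun s => f (D.act x s) := rfl

theorem avg_markov (f : D.Δ → ℝ) : D.avg (D.markov μ f) = D.avg f := by
  have h := avg_ev (D := D) μ (fun x s => f (D.act x s)) fun x => (sqInt_comp μ f _).summable
  simp only [avg_act, ev_const] at h
  exact h

variable {μ}

/-- Maximum principle: the set where `f` is maximal is preserved by the support of `μ`, hence by the
semigroup it generates, which is all of `Γ` and acts transitively on `Δ`. -/
theorem markov_eq_self (hμ : IsNondegenerate μ) {f : D.Δ → ℝ} (hf : D.markov μ f = f)
    (x y : D.Δ) : f x = f y := by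
  have : Nonempty D.Δ := ⟨x⟩
  obtain ⟨m, hm⟩ := Finite.exists_max f
  have key : ∀ γ : Γ, ∀ z, f z = f m → f (D.act z γ) = f m := by
    intro γ
    have hγ : γ ∈ Subsemigroup.closure μ.support := by rw [hμ]; trivial
    induction hγ using Subsemigroup.closure_induction with
    | mem s hs =>
      intro z hz
      have h1 : HasSum (fun s => (μ s).toReal • (f m - f (D.act z s))) 0 := by
        have h2 := ((hasSum_toReal μ).mul_right (f m)).sub
          (sqInt_comp μ f fun s => D.act z s).summable.hasSum
        have h3 : ∑' s, (μ s).toReal • f (D.act z s) = f m := by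
          rw [← hz]; exact congrFun hf z
        rw [h3, one_mul, sub_self] at h2
        simpa only [smul_eq_mul, mul_sub] using h2
      rw [hasSum_zero_iff_of_nonneg fun s =>
        smul_nonneg ENNReal.toReal_nonneg (sub_nonneg.2 (hm _))] at h1
      have h4 := congrFun h1 s
      have h5 : (μ s).toReal ≠ 0 := ENNReal.toReal_ne_zero.2 ⟨hs, μ.apply_ne_top s⟩
      simp only [smul_eq_mul, Pi.zero_apply, mul_eq_zero, h5, false_or] at h4
      linarith
    | mul a b _ _ ha hb =>
      intro z hz
      rw [← act_act]
      exact hb _ (ha z hz)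
  have h2 : ∀ z, f z = f m := fun z => by
    have := key ((m : Γ)⁻¹ * z) m rfl
    rwa [act_inv_mul] at this
  rw [h2 x, h2 y]

/-- The Poisson equation of the walk on `Δ` has a linear solution operator. -/
theorem exists_poisson (hμ : IsNondegenerate μ) :
    ∃ L : (D.Δ → ℝ) →ₗ[ℝ] D.Δ → ℝ, ∀ b x, L b x - D.markov μ (L b) x = b x - D.avg b := by
  let M : (D.Δ → ℝ) →ₗ[ℝ] D.Δ → ℝ :=
    { toFun := fun f _ => D.avg f
      map_add' := fun f g => by funext x; exact D.avg_add f g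
      map_smul' := fun a f => by
        funext x
        simp [avg, Finset.mul_sum, mul_left_comm] }
  -- Adding the projection `M` to the constants removes the kernel of `1 - P`, so `A` is invertible
  -- in finite dimension. As `A` preserves averages, `A⁻¹ b` has the average of `b`, which is the
  -- term subtracted in the Poisson equation.
  let A : (D.Δ → ℝ) →ₗ[ℝ] D.Δ → ℝ := LinearMap.id - D.markov μ + M
  have hA : ∀ f x, A f x = f x - D.markov μ f x + D.avg f := fun f x => rfl
  have havg : ∀ f, D.avg (A f) = D.avg f := fun f => by
    have : A f = fun x => (f x - D.markov μ f x) + D.avg f := funext fun x => hA f x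
    rw [this, avg_add, avg_sub, avg_const, avg_markov]
    ring
  have hinj : Function.Injective A := by
    rw [← LinearMap.ker_eq_bot, LinearMap.ker_eq_bot']
    intro f hf
    have h1 : D.avg f = 0 := by
      rw [← havg, hf]; exact D.avg_const 0
    have h2 : D.markov μ f = f := by
      funext x
      have := congrFun hf x
      rw [hA, h1] at this
      simp only [Pi.zero_apply] at this
      linarith
    funext x
    have h3 : f = fun _ => f x := funext fun y => D.markov_eq_self hμ h2 y x
    rw [h3, avg_const] at h1
    exact h1
  let e := LinearEquiv.ofInjectiveEndo A hinj
  refine ⟨e.symm, fun b x => ?_⟩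
  have h1 : A (e.symm b) = b := e.apply_symm_apply b
  have h2 := congrFun h1 x
  rw [hA] at h2
  have h3 := havg (e.symm b)
  rw [h1] at h3
  rw [h3]
  change e.symm b x - D.markov μ (e.symm b) x = _
  linarith

/-! ### Harmonic parts -/

/-- The `1`-form `v̂ - df`, as a function on `Δ × Γ`. -/
def form (v : E) (f : D.Δ → ℝ) (x : D.Δ) (s : Γ) : ℝ :=
  ⟪v, D.vec x s⟫ - (f (D.act x s) - f x)

variable {D}

theorem HasMoment.sqInt_inner (hm : D.HasMoment μ) (v : E) (x : D.Δ) :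
    SqInt μ fun s => ⟪v, D.vec x s⟫ := by
  refine Summable.of_nonneg_of_le (fun s => mul_nonneg ENNReal.toReal_nonneg (sq_nonneg _))
    (fun s => ?_) ((hm x).mul_right (‖v‖ ^ 2))
  rw [mul_assoc, ← mul_pow, mul_comm ‖_‖, ← sq_abs]
  exact mul_le_mul_of_nonneg_left (pow_le_pow_left₀ (abs_nonneg _) (abs_real_inner_le_norm _ _) 2)
    ENNReal.toReal_nonneg

theorem HasMoment.sqInt_form (hm : D.HasMoment μ) (v : E) (f : D.Δ → ℝ) (x : D.Δ) :
    SqInt μ (D.form v f x) :=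
  (hm.sqInt_inner v x).sub ((sqInt_comp μ f _).sub (sqInt_comp μ (fun _ => f x) fun _ => x))

theorem HasMoment.summable_vec [FiniteDimensional ℝ E] (hm : D.HasMoment μ) (x : D.Δ) :
    Summable fun s => (μ s).toReal • D.vec x s := by
  have := FiniteDimensional.complete ℝ E
  refine Summable.of_norm_bounded ((hasSum_toReal μ).summable.add (hm x)) fun s => ?_
  have h0 : 0 ≤ (μ s).toReal := ENNReal.toReal_nonneg
  rw [norm_smul, Real.norm_of_nonneg h0]
  nlinarith [mul_nonneg h0 (sq_nonneg (‖D.vec x s‖ - 1)), mul_nonneg h0 (sq_nonneg (‖D.vec x s‖))]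

variable (D μ)

theorem hasSum_label_iff {F : Type*} [NormedAddCommGroup F] [NormedSpace ℝ F] {g : Γ → F} {a : F} :
    HasSum (fun s : Label μ => (μ s).toReal • g s) a ↔ HasSum (fun s => (μ s).toReal • g s) a := by
  refine hasSum_subtype_iff_of_support_subset (s := {s | s ∈ μ.support ∨ s⁻¹ ∈ μ.support})
    (f := fun s => (μ s).toReal • g s) ?_
  intro s hs
  left
  rw [PMF.mem_support_iff]
  intro h
  simp [h] at hs

/-- Turns sums over edges into averages of expectations: labels outside the support have weight
zero, so the sum over labels is a sum over `Γ`. -/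
theorem hasSum_edges {F : Type*} [NormedAddCommGroup F] [NormedSpace ℝ F] (g : D.Δ → Γ → F)
    (h : ∀ x, Summable fun s => (μ s).toReal • g x s) :
    HasSum (fun e : D.Δ × Label μ => (D.diagram μ).c e • g e.1 e.2)
      (D.avg fun x => ev μ (g x)) := by
  classical
  have h1 : ∀ x : D.Δ, HasSum (fun e : D.Δ × Label μ =>
      if e.1 = x then (D.diagram μ).c e • g e.1 e.2 else 0)
      ((1 / Fintype.card D.Δ : ℝ) • ev μ (g x)) := by
    intro x
    have hinj : Function.Injective fun s : Label μ => (x, s) := fun s t hst => by simpa using hst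
    refine (hinj.hasSum_iff ?_).1 ?_
    · rintro ⟨y, s⟩ hy
      rw [if_neg]
      rintro rfl
      exact hy ⟨s, rfl⟩
    · have := ((hasSum_label_iff μ).2 (h x).hasSum).const_smul (1 / Fintype.card D.Δ : ℝ)
      simpa [Function.comp_def, WeightedDiagram.c, diagram, smul_smul, ev] using this
  have h2 := hasSum_sum fun x (_ : x ∈ Finset.univ) => h1 x
  simpa [avg, Finset.smul_sum] using h2

theorem tsum_edges (g : D.Δ → Γ → ℝ) (h : ∀ x, Summable fun s => (μ s).toReal • g x s) :
    ∑' e : D.Δ × Label μ, g e.1 e.2 * (D.diagram μ).c e = D.avg fun x => ev μ (g x) := by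
  rw [← (D.hasSum_edges μ g h).tsum_eq]
  simp only [smul_eq_mul, mul_comm]

theorem dstar_eq (g : D.Δ → Γ → ℝ) (x : D.Δ) :
    (D.diagram μ).dstar (fun e => g e.1 e.2) x = -ev μ (g x) := by
  let φ : Label μ ≃ {e : D.Δ × Label μ // e.1 = x} :=
    { toFun := fun s => ⟨(x, s), rfl⟩
      invFun := fun e => e.1.2
      left_inv := fun _ => rfl
      right_inv := by rintro ⟨⟨y, s⟩, rfl⟩; rfl }
  have h1 : ∑' e : {e : D.Δ × Label μ // e.1 = x}, (D.diagram μ).c e * g e.1.1 e.1.2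
      = (1 / Fintype.card D.Δ : ℝ) * ev μ (g x) := by
    rw [← φ.tsum_eq, ev, ← tsum_mul_left]
    have h2 := tsum_subtype_eq_of_support_subset
      (s := {s : Γ | s ∈ μ.support ∨ s⁻¹ ∈ μ.support})
      (f := fun s => (1 / Fintype.card D.Δ : ℝ) * ((μ s).toReal * g x s)) (by
        intro s hs
        left
        rw [PMF.mem_support_iff]
        intro h
        simp [h] at hs)
    rw [show (fun s => (1 / Fintype.card D.Δ : ℝ) * (μ s).toReal • g x s) =
      fun s => (1 / Fintype.card D.Δ : ℝ) * ((μ s).toReal * g x s) from rfl, ← h2]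
    refine tsum_congr fun s => ?_
    simp [φ, WeightedDiagram.c, diagram, mul_assoc]
  unfold WeightedDiagram.dstar
  rw [show (D.diagram μ).stat x = 1 / Fintype.card D.Δ from rfl]
  change -(1 / (1 / (Fintype.card D.Δ : ℝ))) *
    (∑' e : {e : D.Δ × Label μ // e.1 = x}, (D.diagram μ).c e * g e.1.1 e.1.2) = _
  rw [h1]
  rw [one_div_one_div, ← mul_assoc, neg_mul, mul_one_div_cancel D.card_ne_zero, neg_one_mul]

variable {μ}

theorem isOneForm_form (v : E) (f : D.Δ → ℝ) :
    (D.diagram μ).IsOneForm fun e => D.form v f e.1 e.2 := by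
  rintro ⟨x, s⟩
  change D.form v f (D.act x s) (s : Γ)⁻¹ = _
  simp only [form, vec_inv, act_act, act_one, mul_inv_cancel, inner_neg_right]
  ring

theorem form_eq_hat (v : E) (f : D.Δ → ℝ) :
    D.hat μ v = (fun e => D.form v f e.1 e.2) + (D.diagram μ).d f := by
  funext e
  simp only [hat, edgeVec_eq, Pi.add_apply, form, vec, WeightedDiagram.d, diagram]
  ring

variable {D}

/-- A differential has zero mean under the stationary law, so subtracting `df` does not affect the
total mean. -/
theorem HasMoment.avg_ev_form (hm : D.HasMoment μ) (v : E) (f : D.Δ → ℝ) :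
    D.avg (fun x => ev μ (D.form v f x)) = D.avg fun x => ev μ fun s => ⟪v, D.vec x s⟫ := by
  have h : ∀ x, ev μ (D.form v f x) =
      ev μ (fun s => ⟪v, D.vec x s⟫) - (D.markov μ f x - f x) := fun x => by
    unfold form
    rw [ev_sub (hm.sqInt_inner v x).summable
      ((sqInt_comp μ f _).sub (sqInt_comp μ (fun _ => f x) fun _ => x)).summable,
      ev_sub (sqInt_comp μ f _).summable (sqInt_comp μ (fun _ => f x) fun _ => x).summable,
      ev_const, markov_apply]
  simp only [h]
  rw [avg_sub, avg_sub, avg_markov, sub_self, sub_zero]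

/-- `dstar` is minus the mean outflow at a vertex and `chi` is its average over `Δ`; harmonicity
thus says that the outflow is the same at all vertices. -/
theorem HasMoment.isHarmonic_form_iff (hm : D.HasMoment μ) (v : E) (f : D.Δ → ℝ) :
    (D.diagram μ).IsHarmonic (fun e => D.form v f e.1 e.2) ↔
      ∀ x, ev μ (D.form v f x) = D.avg fun x => ev μ fun s => ⟪v, D.vec x s⟫ := by
  have hchi : (D.diagram μ).chi (fun e => D.form v f e.1 e.2) =
      D.avg fun x => ev μ fun s => ⟪v, D.vec x s⟫ := by
    rw [← hm.avg_ev_form v f, ← D.tsum_edges μ _ fun x => (hm.sqInt_form v f x).summable]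
    rfl
  have hL2 : (D.diagram μ).IsL2OneForm fun e => D.form v f e.1 e.2 := by
    refine ⟨D.isOneForm_form v f, ?_⟩
    have := (D.hasSum_edges μ (fun x s => D.form v f x s ^ 2)
      fun x => hm.sqInt_form v f x).summable
    simpa only [smul_eq_mul, mul_comm] using this
  unfold WeightedDiagram.IsHarmonic
  simp only [hL2, true_and, hchi, dstar_eq]
  refine forall_congr' fun x => ?_
  constructor <;> intro h <;> linarith

theorem HasMoment.isHarmonicPart (hm : D.HasMoment μ) {v : E} {f : D.Δ → ℝ}
    (h : ∀ x, ev μ (D.form v f x) = D.avg fun x => ev μ fun s => ⟪v, D.vec x s⟫) :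
    (D.diagram μ).IsHarmonicPart (D.hat μ v) fun e => D.form v f e.1 e.2 :=
  ⟨(hm.isHarmonic_form_iff v f).2 h, f, D.form_eq_hat v f⟩

theorem ev_form_eq (hm : D.HasMoment μ) (v : E) (f : D.Δ → ℝ) (x : D.Δ) :
    ev μ (D.form v f x) = ev μ (fun s => ⟪v, D.vec x s⟫) - (D.markov μ f x - f x) := by
  unfold form
  rw [ev_sub (hm.sqInt_inner v x).summable
    ((sqInt_comp μ f _).sub (sqInt_comp μ (fun _ => f x) fun _ => x)).summable,
    ev_sub (sqInt_comp μ f _).summable (sqInt_comp μ (fun _ => f x) fun _ => x).summable,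
    ev_const, markov_apply]

/-- The difference of two potentials is invariant under the Markov operator, hence constant, and has
zero differential. -/
theorem HasMoment.isHarmonicPart_unique (hm : D.HasMoment μ) (hμ : IsNondegenerate μ) {v : E}
    {u u' : D.Δ × Label μ → ℝ} (h : (D.diagram μ).IsHarmonicPart (D.hat μ v) u)
    (h' : (D.diagram μ).IsHarmonicPart (D.hat μ v) u') : u = u' := by
  obtain ⟨hu, f, hf⟩ := h
  obtain ⟨hu', f', hf'⟩ := h'
  have e1 : u = fun e => D.form v f e.1 e.2 := add_right_cancel (hf.symm.trans (D.form_eq_hat v f))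
  have e2 : u' = fun e => D.form v f' e.1 e.2 :=
    add_right_cancel (hf'.symm.trans (D.form_eq_hat v f'))
  rw [e1, hm.isHarmonic_form_iff] at hu
  rw [e2, hm.isHarmonic_form_iff] at hu'
  have h1 : D.markov μ (f - f') = f - f' := by
    funext x
    have a1 := hu x
    have a2 := hu' x
    rw [ev_form_eq hm] at a1 a2
    rw [map_sub, Pi.sub_apply, Pi.sub_apply]
    linarith
  have h2 := D.markov_eq_self hμ h1
  rw [e1, e2]
  funext e
  have := h2 e.1 (D.act e.1 e.2)
  simp only [Pi.sub_apply] at this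
  unfold form
  linarith

theorem drift_hasSum [FiniteDimensional ℝ E] (hm : D.HasMoment μ) :
    HasSum (fun e => (D.diagram μ).c e • D.edgeVec e) (D.avg fun x => ev μ (D.vec x)) := by
  have := D.hasSum_edges μ D.vec hm.summable_vec
  simpa only [edgeVec_eq, vec] using this

theorem drift_eq [FiniteDimensional ℝ E] (hm : D.HasMoment μ) :
    D.drift μ = D.avg fun x => ev μ (D.vec x) :=
  (drift_hasSum hm).tsum_eq

theorem ev_inner [FiniteDimensional ℝ E] (hm : D.HasMoment μ) (v : E) (x : D.Δ) :
    ev μ (fun s => ⟪v, D.vec x s⟫) = ⟪v, ev μ (D.vec x)⟫ := by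
  have := ((innerSL ℝ v).hasSum (hm.summable_vec x).hasSum).tsum_eq
  simpa [inner_smul_right, ev] using this

theorem inner_drift [FiniteDimensional ℝ E] (hm : D.HasMoment μ) (v : E) :
    ⟪v, D.drift μ⟫ = D.avg fun x => ev μ fun s => ⟪v, D.vec x s⟫ := by
  simp only [drift_eq hm, ev_inner hm, avg, inner_smul_right, inner_sum, smul_eq_mul]

/-! ### The covariance -/

variable (D)

/-- The functions `f v` are the potentials for which `v̂ - d(f v)` is the harmonic part of `v̂`. -/
def IsPotential (μ : PMF Γ) (f : E →ₗ[ℝ] D.Δ → ℝ) : Prop :=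
  ∀ v x, ev μ (D.form v (f v) x) = ⟪v, D.drift μ⟫

/-- The centred harmonic part of `v̂`. -/
def cform (μ : PMF Γ) (f : E →ₗ[ℝ] D.Δ → ℝ) (x : D.Δ) (s : Γ) (v : E) : ℝ :=
  D.form v (f v) x s - ⟪v, D.drift μ⟫

variable {D}

theorem HasMoment.exists_potential [FiniteDimensional ℝ E] (hm : D.HasMoment μ) (hμ : IsNondegenerate μ) :
    ∃ f, D.IsPotential μ f := by
  obtain ⟨L, hL⟩ := D.exists_poisson hμ
  let b : E →ₗ[ℝ] D.Δ → ℝ := LinearMap.pi fun x => (innerSL ℝ (ev μ (D.vec x))).toLinearMap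
  have hb : ∀ v x, b v x = ev μ fun s => ⟪v, D.vec x s⟫ := fun v x => by
    rw [ev_inner hm, real_inner_comm]; rfl
  -- The form subtracts `P f - f`, which for `f = -L b` equals `b - avg b`; only the average of `b`
  -- is left.
  refine ⟨-(L ∘ₗ b), fun v x => ?_⟩
  have h := hL (b v) x
  rw [ev_form_eq hm, inner_drift hm, LinearMap.neg_apply, map_neg, ← hb]
  simp only [← hb, LinearMap.comp_apply, Pi.neg_apply]
  have : (D.avg fun x => b v x) = D.avg (b v) := rfl
  rw [this]
  linarith

theorem sqInt_cform (hm : D.HasMoment μ) (f : E →ₗ[ℝ] D.Δ → ℝ) (x : D.Δ) (v : E) :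
    SqInt μ fun s => D.cform μ f x s v :=
  (hm.sqInt_form v (f v) x).sub (sqInt_comp μ (fun _ => ⟪v, D.drift μ⟫) fun _ => x)

theorem ev_cform (hm : D.HasMoment μ) {f : E →ₗ[ℝ] D.Δ → ℝ} (hf : D.IsPotential μ f) (x : D.Δ)
    (v : E) : ev μ (fun s => D.cform μ f x s v) = 0 := by
  unfold cform
  rw [ev_sub (hm.sqInt_form v (f v) x).summable
    (sqInt_comp μ (fun _ => ⟪v, D.drift μ⟫) fun _ => x).summable, ev_const, sub_eq_zero]
  exact hf v x

theorem cform_add (f : E →ₗ[ℝ] D.Δ → ℝ) (x : D.Δ) (s : Γ) (v w : E) :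
    D.cform μ f x s (v + w) = D.cform μ f x s v + D.cform μ f x s w := by
  simp only [cform, form, inner_add_left, map_add, Pi.add_apply]
  ring

theorem cform_smul (f : E →ₗ[ℝ] D.Δ → ℝ) (x : D.Δ) (s : Γ) (a : ℝ) (v : E) :
    D.cform μ f x s (a • v) = a * D.cform μ f x s v := by
  simp only [cform, form, inner_smul_left, map_smul, Pi.smul_apply, smul_eq_mul]
  simp only [conj_trivial]
  ring

variable (D μ) in
/-- The covariance form. -/
def cov (f : E →ₗ[ℝ] D.Δ → ℝ) (v w : E) : ℝ :=
  D.avg fun x => ev μ fun s => D.cform μ f x s v * D.cform μ f x s w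

theorem cov_comm (f : E →ₗ[ℝ] D.Δ → ℝ) (v w : E) : D.cov μ f v w = D.cov μ f w v := by
  simp only [cov, mul_comm]

theorem cov_add (hm : D.HasMoment μ) (f : E →ₗ[ℝ] D.Δ → ℝ) (v w w' : E) :
    D.cov μ f v (w + w') = D.cov μ f v w + D.cov μ f v w' := by
  unfold cov
  rw [← avg_add]
  congr 1
  funext x
  rw [← ev_add ((sqInt_cform hm f x v).summable_mul (sqInt_cform hm f x w))
    ((sqInt_cform hm f x v).summable_mul (sqInt_cform hm f x w'))]
  simp only [cform_add, mul_add]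

theorem cov_smul (f : E →ₗ[ℝ] D.Δ → ℝ) (a : ℝ) (v w : E) :
    D.cov μ f v (a • w) = a * D.cov μ f v w := by
  unfold cov
  simp only [cform_smul, mul_left_comm _ a, ev_mul_left, avg, smul_eq_mul, ← Finset.mul_sum]

theorem cov_self_nonneg (f : E →ₗ[ℝ] D.Δ → ℝ) (v : E) : 0 ≤ D.cov μ f v v :=
  D.avg_nonneg fun _ => tsum_nonneg fun _ =>
    smul_nonneg ENNReal.toReal_nonneg (mul_self_nonneg _)

/-- Zero variance makes the harmonic part equal to its mean on every letter, so by the cocycle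
property it is `n ⟨v, ζ⟩` on a word of length `n`, from any starting vertex. Testing on the identity
and on the generators of `Λ`, which act trivially on `Δ`, leaves `v = 0`. -/
theorem eq_zero_of_cov_self (hm : D.HasMoment μ) (hμ : IsNondegenerate μ) (f : E →ₗ[ℝ] D.Δ → ℝ)
    {v : E} (h : D.cov μ f v v = 0) : v = 0 := by
  have h1 : ∀ x, ∀ s ∈ μ.support, D.cform μ f x s v = 0 := fun x s hs => by
    refine ev_sq_eq_zero (sqInt_cform hm f x v) ?_ hs
    have := D.eq_zero_of_avg_eq_zero (fun x => tsum_nonneg fun s =>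
      smul_nonneg ENNReal.toReal_nonneg (mul_self_nonneg (D.cform μ f x s v))) h x
    simpa only [sq, ev] using this
  have h2 : ∀ γ : Γ, ∃ n : ℕ, 1 ≤ n ∧ ∀ x, D.form v (f v) x γ = n * ⟪v, D.drift μ⟫ := by
    intro γ
    have hγ : γ ∈ Subsemigroup.closure μ.support := by rw [hμ]; trivial
    induction hγ using Subsemigroup.closure_induction with
    | mem s hs => exact ⟨1, le_rfl, fun x => by simpa using sub_eq_zero.1 (h1 x s hs)⟩
    | mul a b _ _ ha hb =>
      obtain ⟨n, hn, ha⟩ := ha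
      obtain ⟨k, hk, hb⟩ := hb
      refine ⟨n + k, by omega, fun x => ?_⟩
      push_cast
      rw [add_mul, ← ha x, ← hb (D.act x a)]
      simp only [form, vec_mul, inner_add_right, act_act]
      ring
  -- The identity is a word of some length `n ≥ 1`, and the form vanishes on it.
  have h3 : ⟪v, D.drift μ⟫ = 0 := by
    obtain ⟨n, hn, h4⟩ := h2 1
    have h5 := h4 ⟨1, D.one_mem⟩
    have h6 : (n : ℝ) ≠ 0 := by positivity
    simpa [form, vec_one, act_one, h6] using h5
  refine InnerProductSpace.ext_inner_left_basis (𝕜 := ℝ) D.basis fun j => ?_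
  obtain ⟨n, -, h4⟩ := h2 (D.gen j)
  have h5 := h4 ⟨1, D.one_mem⟩
  rw [h3, mul_zero, form, act_coe, sub_self, sub_zero, vec_coe] at h5
  have h6 : D.conj ((⟨1, D.one_mem⟩ : D.Δ) : Γ) (D.gen j) = D.gen j :=
    Subtype.ext (by simp [conj])
  rw [h6, emb_gen] at h5
  rw [inner_zero_right, real_inner_comm, h5]

/-- Existence of the covariance operator. -/
theorem exists_covariance [FiniteDimensional ℝ E] (hm : D.HasMoment μ) (hμ : IsNondegenerate μ) :
    ∃ (f : E →ₗ[ℝ] D.Δ → ℝ) (Sig : E →ₗ[ℝ] E), D.IsPotential μ f ∧ D.IsCovariance μ Sig ∧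
      IsPosDef Sig ∧ ∀ v w, ⟪v, Sig w⟫ = D.cov μ f v w := by
  obtain ⟨f, hf⟩ := hm.exists_potential hμ
  let b := stdOrthonormalBasis ℝ E
  let Sig : E →ₗ[ℝ] E :=
    { toFun := fun w => ∑ i, D.cov μ f (b i) w • b i
      map_add' := fun w w' => by simp [cov_add hm, add_smul, Finset.sum_add_distrib]
      map_smul' := fun a w => by simp [cov_smul, mul_smul, Finset.smul_sum] }
  have hcov : ∀ v w, ⟪v, Sig w⟫ = D.cov μ f v w := by
    intro v w
    let c : E →ₗ[ℝ] ℝ :=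
      { toFun := fun v => D.cov μ f v w
        map_add' := fun v v' => by rw [cov_comm, cov_add hm, cov_comm, cov_comm f w v']
        map_smul' := fun a v => by rw [cov_comm, cov_smul, cov_comm]; rfl }
    have h1 : c v = ∑ i, ⟪b i, v⟫ * c (b i) := by
      conv_lhs => rw [← b.sum_repr' v]
      simp [map_sum]
    change ⟪v, ∑ i, c (b i) • b i⟫ = c v
    rw [h1, inner_sum]
    refine Finset.sum_congr rfl fun i _ => ?_
    rw [inner_smul_right, real_inner_comm, mul_comm]
  have hpart : ∀ v, (D.diagram μ).IsHarmonicPart (D.hat μ v)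
      fun e => D.form v (f v) e.1 e.2 := fun v =>
    hm.isHarmonicPart fun x => by rw [hf, inner_drift hm]
  refine ⟨f, Sig, hf, ⟨fun v => ⟨_, hpart v, fun u hu => hm.isHarmonicPart_unique hμ hu (hpart v)⟩,
    ?_⟩, ⟨?_, ?_⟩, hcov⟩
  · intro v w u u' hu hu'
    rw [hm.isHarmonicPart_unique hμ hu (hpart v), hm.isHarmonicPart_unique hμ hu' (hpart w), hcov,
      D.tsum_edges μ (fun x s => D.form v (f v) x s * D.form w (f w) x s) fun x =>
        (hm.sqInt_form v (f v) x).summable_mul (hm.sqInt_form w (f w) x),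
      D.tsum_edges μ (D.form v (f v)) fun x => (hm.sqInt_form v (f v) x).summable,
      D.tsum_edges μ (D.form w (f w)) fun x => (hm.sqInt_form w (f w) x).summable]
    simp only [hf v _, hf w _, avg_const]
    rw [← D.avg_const (⟪v, D.drift μ⟫ * ⟪w, D.drift μ⟫), ← avg_sub]
    unfold cov
    congr 1
    funext x
    -- Both harmonic parts have the same mean at every vertex, so the correction terms have an
    -- expectation independent of `x` and combine to the product of the means.
    have e1 : ∀ s, D.form v (f v) x s * D.form w (f w) x s =
        D.cform μ f x s v * D.cform μ f x s w + (⟪v, D.drift μ⟫ * D.form w (f w) x s +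
        (⟪w, D.drift μ⟫ * D.form v (f v) x s - ⟪v, D.drift μ⟫ * ⟪w, D.drift μ⟫)) := fun s => by
      unfold cform; ring
    have s1 := (sqInt_cform hm f x v).summable_mul (sqInt_cform hm f x w)
    have s2 : ∀ (a : ℝ) (v : E), Summable fun s => (μ s).toReal • (a * D.form v (f v) x s) :=
      fun a v => (SqInt.of_bounded (C := |a|) fun s => le_rfl).summable_mul
        (hm.sqInt_form v (f v) x)
    have s3 : Summable fun s => (μ s).toReal • (⟪v, D.drift μ⟫ * ⟪w, D.drift μ⟫) :=
      (sqInt_comp μ (fun _ : D.Δ => ⟪v, D.drift μ⟫ * ⟪w, D.drift μ⟫) fun _ => x).summable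
    have s4 := (s2 ⟪w, D.drift μ⟫ v).sub s3
    simp only [← smul_sub] at s4
    have s5 := (s2 ⟪v, D.drift μ⟫ w).add s4
    simp only [← smul_add] at s5
    simp only [e1]
    rw [ev_add s1 s5, ev_add (s2 _ w) s4, ev_sub (s2 _ v) s3, ev_mul_left, ev_mul_left, ev_const,
      hf v x, hf w x]
    ring
  · intro v w
    rw [real_inner_comm, hcov, hcov, cov_comm]
  · intro v hv
    rw [hcov]
    exact lt_of_le_of_ne (cov_self_nonneg f v) fun h => hv (eq_zero_of_cov_self hm hμ f h.symm)

end LatticeFrame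

/-! ### Behaviour of harmonic parts, covariance and drift under projections. -/

theorem IsNondegenerate.map {G H : Type*} [Group G] [Group H] {ν : PMF G} (h : IsNondegenerate ν)
    (φ : G →* H) (hφ : Function.Surjective φ) : IsNondegenerate (ν.map φ) := by
  have h1 : Subsemigroup.map (φ : G →ₙ* H) (Subsemigroup.closure ν.support) = ⊤ := by
    rw [h, ← MulHom.srange_eq_map, MulHom.srange_eq_top_iff_surjective]
    exact hφ
  rw [MulHom.map_mclosure] at h1
  unfold IsNondegenerate
  rw [PMF.support_map]
  exact h1

namespace LatticeFrame

/-- A projection of lattice frames, covering a surjective homomorphism of groups and a map of the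
sets of representatives with fibres of constant size. -/
structure Projection {Γ Γ' κ κ' E E' : Type*} [Group Γ] [Group Γ'] [Fintype κ] [Fintype κ']
    [DecidableEq κ] [DecidableEq κ'] [NormedAddCommGroup E] [InnerProductSpace ℝ E]
    [NormedAddCommGroup E'] [InnerProductSpace ℝ E'] (D : LatticeFrame Γ κ E)
    (D' : LatticeFrame Γ' κ' E') where
  hom : Γ →* Γ'
  hom_surjective : Function.Surjective hom
  base : D.Δ → D'.Δ
  base_surjective : Function.Surjective base
  incl : E' →ₗ[ℝ] E
  proj : E →ₗ[ℝ] E'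
  base_act : ∀ x γ, base (D.act x γ) = D'.act (base x) (hom γ)
  proj_vec : ∀ x γ, proj (D.vec x γ) = D'.vec (base x) (hom γ)
  inner_incl : ∀ v w, ⟪incl v, w⟫ = ⟪v, proj w⟫
  norm_proj_le : ∀ w, ‖proj w‖ ≤ ‖w‖
  avg_comp : ∀ f : D'.Δ → ℝ, D.avg (fun x => f (base x)) = D'.avg f

variable {Γ Γ' κ κ' E E' : Type*} [Group Γ] [Group Γ'] [Fintype κ] [Fintype κ']
  [DecidableEq κ] [DecidableEq κ'] [NormedAddCommGroup E] [InnerProductSpace ℝ E]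
  [NormedAddCommGroup E'] [InnerProductSpace ℝ E'] {D : LatticeFrame Γ κ E}
  {D' : LatticeFrame Γ' κ' E'}

/-- For a fixed increment `s` the coboundary already averages to zero, since `s` permutes `Δ`. This
removes the potentials from the mixed covariances. -/
theorem avg_form (v : E) (f : D.Δ → ℝ) (s : Γ) :
    D.avg (fun x => D.form v f x s) = D.avg fun x => ⟪v, D.vec x s⟫ := by
  unfold form
  rw [avg_sub, avg_sub, avg_act, sub_self, sub_zero]

/-- The sum of `vec x s` over `x` is the transfer of `s`, which lies in the range. -/
theorem avg_inner_vec_eq_zero {v : E} (hv : v ∈ (LinearMap.range D.normTransfer)ᗮ) (s : Γ) :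
    (D.avg fun x => ⟪v, D.vec x s⟫) = 0 := by
  have h : D.ofInt (D.transfer s) ∈ LinearMap.range D.normTransfer := by
    rw [range_normTransfer]
    exact Submodule.subset_span ⟨s, rfl⟩
  have h1 := Submodule.inner_left_of_mem_orthogonal h hv
  rw [ofInt_transfer, inner_sum] at h1
  rw [avg]
  exact smul_eq_zero_of_right _ h1

namespace Projection

variable (P : Projection D D') {ν : PMF Γ}

include P in
theorem hasMoment (hm : D.HasMoment ν) : D'.HasMoment (ν.map P.hom) := by
  intro y
  obtain ⟨x, rfl⟩ := P.base_surjective y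
  refine (hasSum_map ν P.hom (g := fun b => ‖D'.vec (P.base x) b‖ ^ 2) ?_).summable
  refine Summable.of_nonneg_of_le (fun s => by positivity) (fun s => ?_) (hm x)
  rw [← P.proj_vec]
  exact mul_le_mul_of_nonneg_left (pow_le_pow_left₀ (norm_nonneg _) (P.norm_proj_le _) 2)
    ENNReal.toReal_nonneg

theorem form_comp (v : E') (f : D'.Δ → ℝ) (x : D.Δ) (s : Γ) :
    D.form (P.incl v) (fun x => f (P.base x)) x s = D'.form v f (P.base x) (P.hom s) := by
  simp only [form, P.inner_incl, P.proj_vec, P.base_act]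

theorem ev_form_comp (hm : D.HasMoment ν) (v : E') (f : D'.Δ → ℝ) (x : D.Δ) :
    ev ν (D.form (P.incl v) (fun x => f (P.base x)) x) =
      ev (ν.map P.hom) (D'.form v f (P.base x)) := by
  have h := (hm.sqInt_form (P.incl v) (fun x => f (P.base x)) x).summable
  simp only [form_comp] at h
  rw [ev_map ν P.hom h]
  simp only [← form_comp]

/-- The pulled-back potential works upstairs: the mean at `x` is the mean downstairs at the image of
`x`, hence independent of `x`. -/
theorem isHarmonicPart_comp [FiniteDimensional ℝ E'] (hm : D.HasMoment ν)
    {f : E' →ₗ[ℝ] D'.Δ → ℝ} (hf : D'.IsPotential (ν.map P.hom) f) (v : E') :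
    (D.diagram ν).IsHarmonicPart (D.hat ν (P.incl v))
      fun e => D.form (P.incl v) (fun x => f v (P.base x)) e.1 e.2 := by
  have h1 : ∀ x, ev ν (D.form (P.incl v) (fun x => f v (P.base x)) x) =
      ⟪v, D'.drift (ν.map P.hom)⟫ := fun x => by rw [P.ev_form_comp hm, hf]
  refine hm.isHarmonicPart fun x => ?_
  rw [← hm.avg_ev_form _ fun x => f v (P.base x)]
  simp only [h1, avg_const]

/-- With pulled-back harmonic parts on the left, both sides are the same expectations: the law is
pushed forward along the homomorphism and the uniform law on `Δ` along the map of representatives.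
-/
theorem inner_covariance [FiniteDimensional ℝ E'] (hm : D.HasMoment ν) (hν : IsNondegenerate ν)
    {Sig : E →ₗ[ℝ] E} {Sig' : E' →ₗ[ℝ] E'} (hSig : D.IsCovariance ν Sig)
    (hSig' : D'.IsCovariance (ν.map P.hom) Sig') (v w : E') :
    ⟪P.incl v, Sig (P.incl w)⟫ = ⟪v, Sig' w⟫ := by
  have hm' := P.hasMoment hm
  obtain ⟨f, hf⟩ := hm'.exists_potential (hν.map P.hom P.hom_surjective)
  have hpart : ∀ v, (D'.diagram (ν.map P.hom)).IsHarmonicPart (D'.hat (ν.map P.hom) v)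
      fun e => D'.form v (f v) e.1 e.2 := fun v =>
    hm'.isHarmonicPart fun x => by rw [hf, inner_drift hm']
  rw [hSig.2 _ _ _ _ (P.isHarmonicPart_comp hm hf v) (P.isHarmonicPart_comp hm hf w),
    hSig'.2 _ _ _ _ (hpart v) (hpart w)]
  have e1 : ∀ v, ∑' e : D.Δ × Label ν,
      D.form (P.incl v) (fun x => f v (P.base x)) e.1 e.2 * (D.diagram ν).c e =
      ∑' e : D'.Δ × Label (ν.map P.hom),
        D'.form v (f v) e.1 e.2 * (D'.diagram (ν.map P.hom)).c e := fun v => by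
    rw [D.tsum_edges ν _ fun x => (hm.sqInt_form _ _ x).summable,
      D'.tsum_edges _ _ fun x => (hm'.sqInt_form _ _ x).summable, ← P.avg_comp]
    simp only [P.ev_form_comp hm]
  have s1 : ∀ x, Summable fun s => (ν s).toReal • (D.form (P.incl v) (fun x => f v (P.base x)) x s
      * D.form (P.incl w) (fun x => f w (P.base x)) x s) := fun x =>
    (hm.sqInt_form _ _ x).summable_mul (hm.sqInt_form _ _ x)
  rw [e1, e1, D.tsum_edges ν (fun x s => D.form (P.incl v) (fun x => f v (P.base x)) x s
      * D.form (P.incl w) (fun x => f w (P.base x)) x s) s1,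
    D'.tsum_edges (ν.map P.hom) (fun x s => D'.form v (f v) x s * D'.form w (f w) x s) fun x =>
      (hm'.sqInt_form _ _ x).summable_mul (hm'.sqInt_form _ _ x), ← P.avg_comp]
  congr 2
  funext x
  have s2 := s1 x
  simp only [form_comp] at s2
  rw [ev_map ν P.hom (g := fun s => D'.form v (f v) (P.base x) s * D'.form w (f w) (P.base x) s) s2]
  simp only [form_comp]

/-- The projected drift is a mean of transfers, up to the factor `1 / #Δ'`; so it is orthogonal to
every vector orthogonal to them. -/
theorem proj_drift_mem [FiniteDimensional ℝ E] [FiniteDimensional ℝ E'] (hm : D.HasMoment ν) :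
    P.proj (D.drift ν) ∈ LinearMap.range D'.normTransfer := by
  rw [← Submodule.orthogonal_orthogonal (LinearMap.range D'.normTransfer), Submodule.mem_orthogonal]
  intro v hv
  rw [← P.inner_incl, inner_drift hm, avg_ev ν (fun x s => ⟪P.incl v, D.vec x s⟫) fun x =>
    (hm.sqInt_inner _ x).summable]
  have h : ∀ s, (D.avg fun x => ⟪P.incl v, D.vec x s⟫) = 0 := fun s => by
    simp only [P.inner_incl, P.proj_vec]
    rw [P.avg_comp fun y => ⟪v, D'.vec y (P.hom s)⟫, avg_inner_vec_eq_zero hv]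
  simp only [h, ev_const]

variable {Γ'' κ'' E'' : Type*} [Group Γ''] [Fintype κ''] [DecidableEq κ''] [NormedAddCommGroup E'']
  [InnerProductSpace ℝ E''] {D'' : LatticeFrame Γ'' κ'' E''} (Q : Projection D D'')

/-- Exchange the average over `Δ` with the expectation. For each fixed increment, `hPQ` factors the
average of the product of the two harmonic parts, and by `avg_form` the factors are pairings of `v`
and `w` with transfers. If one vector is orthogonal to the transfers, its factor vanishes in both
terms of the covariance. -/
theorem inner_covariance_eq_zero [FiniteDimensional ℝ E'] [FiniteDimensional ℝ E'']
    (hPQ : ∀ (f : D'.Δ → ℝ) (g : D''.Δ → ℝ),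
      D.avg (fun x => f (P.base x) * g (Q.base x)) = D'.avg f * D''.avg g)
    (hm : D.HasMoment ν) (hν : IsNondegenerate ν) {Sig : E →ₗ[ℝ] E} (hSig : D.IsCovariance ν Sig)
    {v : E'} {w : E''}
    (h : v ∈ (LinearMap.range D'.normTransfer)ᗮ ∨ w ∈ (LinearMap.range D''.normTransfer)ᗮ) :
    ⟪P.incl v, Sig (Q.incl w)⟫ = 0 := by
  obtain ⟨f, hf⟩ := (P.hasMoment hm).exists_potential (hν.map P.hom P.hom_surjective)
  obtain ⟨g, hg⟩ := (Q.hasMoment hm).exists_potential (hν.map Q.hom Q.hom_surjective)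
  have s1 : ∀ x, Summable fun s => (ν s).toReal • (D.form (P.incl v) (fun x => f v (P.base x)) x s
      * D.form (Q.incl w) (fun x => g w (Q.base x)) x s) := fun x =>
    (hm.sqInt_form _ _ x).summable_mul (hm.sqInt_form _ _ x)
  rw [hSig.2 _ _ _ _ (P.isHarmonicPart_comp hm hf v) (Q.isHarmonicPart_comp hm hg w),
    D.tsum_edges ν (fun x s => D.form (P.incl v) (fun x => f v (P.base x)) x s
      * D.form (Q.incl w) (fun x => g w (Q.base x)) x s) s1,
    D.tsum_edges ν _ fun x => (hm.sqInt_form _ _ x).summable,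
    D.tsum_edges ν _ fun x => (hm.sqInt_form _ _ x).summable,
    avg_ev ν _ s1, avg_ev ν _ fun x => (hm.sqInt_form _ _ x).summable,
    avg_ev ν _ fun x => (hm.sqInt_form _ _ x).summable]
  have hA : ∀ s, (D.avg fun x => D.form (P.incl v) (fun x => f v (P.base x)) x s) =
      D'.avg fun y => ⟪v, D'.vec y (P.hom s)⟫ := fun s => by
    simp only [form_comp]
    rw [P.avg_comp fun y => D'.form v (f v) y (P.hom s), avg_form]
  have hB : ∀ s, (D.avg fun x => D.form (Q.incl w) (fun x => g w (Q.base x)) x s) =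
      D''.avg fun y => ⟪w, D''.vec y (Q.hom s)⟫ := fun s => by
    simp only [form_comp]
    rw [Q.avg_comp fun y => D''.form w (g w) y (Q.hom s), avg_form]
  have hAB : ∀ s, (D.avg fun x => D.form (P.incl v) (fun x => f v (P.base x)) x s *
      D.form (Q.incl w) (fun x => g w (Q.base x)) x s) =
      (D'.avg fun y => ⟪v, D'.vec y (P.hom s)⟫) * D''.avg fun y => ⟪w, D''.vec y (Q.hom s)⟫ :=
    fun s => by
    simp only [form_comp]
    rw [hPQ (fun y => D'.form v (f v) y (P.hom s)) fun y => D''.form w (g w) y (Q.hom s), avg_form,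
      avg_form]
  simp only [hA, hB, hAB]
  rcases h with h | h <;> simp [avg_inner_vec_eq_zero h, ev_const]

end Projection

/-! ### Products -/

variable (D D')

/-- The first component of a representative. -/
def baseFst (x : (D.prod D').Δ) : D.Δ := ⟨x.1.1, x.2.1⟩

/-- The second component of a representative. -/
def baseSnd (x : (D.prod D').Δ) : D'.Δ := ⟨x.1.2, x.2.2⟩

theorem ofInt_prod_fst (z : κ ⊕ κ' → ℤ) :
    ((D.prod D').ofInt z).fst = D.ofInt fun i => z (Sum.inl i) := by
  have h : ((D.prod D').ofInt z).fst =
      LinearMap.fst ℝ E E' (WithLp.linearEquiv 2 ℝ (E × E') ((D.prod D').ofInt z)) := rfl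
  rw [h, ofInt, Fintype.sum_sum_type]
  simp [LatticeFrame.prod, prodBasis, ofInt, Prod.fst_sum]

theorem ofInt_prod_snd (z : κ ⊕ κ' → ℤ) :
    ((D.prod D').ofInt z).snd = D'.ofInt fun i => z (Sum.inr i) := by
  have h : ((D.prod D').ofInt z).snd =
      LinearMap.snd ℝ E E' (WithLp.linearEquiv 2 ℝ (E × E') ((D.prod D').ofInt z)) := rfl
  rw [h, ofInt, Fintype.sum_sum_type]
  simp [LatticeFrame.prod, prodBasis, ofInt, Prod.snd_sum]

theorem act_cocycle_prod_fst (x : (D.prod D').Δ) (γ : Γ × Γ') :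
    D.baseFst D' ((D.prod D').act x γ) = D.act (D.baseFst D' x) γ.1 ∧
      ((D.prod D').vec x γ).fst = D.vec (D.baseFst D' x) γ.1 := by
  have h := congrArg Prod.fst ((D.prod D').cocycle_mul_act x γ)
  set l := (D.prod D').cocycle x γ with hl
  have h1 : (D.baseFst D' x : Γ) * γ.1 = (⟨l.1.1, l.2.1⟩ : D.Λ) *
      D.baseFst D' ((D.prod D').act x γ) := h.symm
  refine ⟨(D.act_eq_of_mul_eq h1).symm, ?_⟩
  rw [vec, vec, D.cocycle_eq_of_mul_eq h1, emb, ofInt_prod_fst, ← hl]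
  rfl

theorem act_cocycle_prod_snd (x : (D.prod D').Δ) (γ : Γ × Γ') :
    D.baseSnd D' ((D.prod D').act x γ) = D'.act (D.baseSnd D' x) γ.2 ∧
      ((D.prod D').vec x γ).snd = D'.vec (D.baseSnd D' x) γ.2 := by
  have h := congrArg Prod.snd ((D.prod D').cocycle_mul_act x γ)
  set l := (D.prod D').cocycle x γ with hl
  have h1 : (D.baseSnd D' x : Γ') * γ.2 = (⟨l.1.2, l.2.2⟩ : D'.Λ) *
      D.baseSnd D' ((D.prod D').act x γ) := h.symm
  refine ⟨(D'.act_eq_of_mul_eq h1).symm, ?_⟩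
  rw [vec, vec, D'.cocycle_eq_of_mul_eq h1, emb, ofInt_prod_snd, ← hl]
  rfl

/-- The two components of a uniform point of `Δ₁ × Δ₂` are independent; this is what makes the mixed
blocks computable, whatever the coupling `ν`. -/
theorem avg_prod (f : D.Δ → ℝ) (g : D'.Δ → ℝ) :
    (D.prod D').avg (fun x => f (D.baseFst D' x) * g (D.baseSnd D' x)) = D.avg f * D'.avg g := by
  let e : (D.prod D').Δ ≃ D.Δ × D'.Δ :=
    { toFun := fun x => (D.baseFst D' x, D.baseSnd D' x)
      invFun := fun y => ⟨(y.1, y.2), y.1.2, y.2.2⟩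
      left_inv := fun _ => rfl
      right_inv := fun _ => rfl }
  unfold avg
  have h : ∑ x, f (D.baseFst D' x) * g (D.baseSnd D' x) = ∑ y : D.Δ × D'.Δ, f y.1 * g y.2 :=
    e.sum_comp fun y => f y.1 * g y.2
  rw [Fintype.card_congr e, h, Fintype.card_prod,
    Fintype.sum_prod_type, ← Finset.sum_mul_sum]
  simp only [smul_eq_mul, Nat.cast_mul, one_div, mul_inv]
  ring

/-- The projection of a product to the first factor. -/
def projFst : Projection (D.prod D') D where
  hom := MonoidHom.fst Γ Γ'
  hom_surjective := Prod.fst_surjective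
  base := D.baseFst D'
  base_surjective y := ⟨⟨(y, 1), y.2, D'.one_mem⟩, rfl⟩
  incl := (WithLp.linearEquiv 2 ℝ (E × E')).symm.toLinearMap ∘ₗ LinearMap.inl ℝ E E'
  proj := LinearMap.fst ℝ E E' ∘ₗ (WithLp.linearEquiv 2 ℝ (E × E')).toLinearMap
  base_act x γ := (D.act_cocycle_prod_fst D' x γ).1
  proj_vec x γ := (D.act_cocycle_prod_fst D' x γ).2
  inner_incl v w := by simp [WithLp.prod_inner_apply]
  norm_proj_le w := WithLp.norm_fst_le _ w
  avg_comp f := by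
    have := D.avg_prod D' f fun _ => 1
    simpa only [mul_one, avg_const] using this

/-- The projection of a product to the second factor. -/
def projSnd : Projection (D.prod D') D' where
  hom := MonoidHom.snd Γ Γ'
  hom_surjective := Prod.snd_surjective
  base := D.baseSnd D'
  base_surjective y := ⟨⟨(1, y), D.one_mem, y.2⟩, rfl⟩
  incl := (WithLp.linearEquiv 2 ℝ (E × E')).symm.toLinearMap ∘ₗ LinearMap.inr ℝ E E'
  proj := LinearMap.snd ℝ E E' ∘ₗ (WithLp.linearEquiv 2 ℝ (E × E')).toLinearMap
  base_act x γ := (D.act_cocycle_prod_snd D' x γ).1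
  proj_vec x γ := (D.act_cocycle_prod_snd D' x γ).2
  inner_incl v w := by simp [WithLp.prod_inner_apply]
  norm_proj_le w := WithLp.norm_snd_le _ w
  avg_comp f := by
    have := D.avg_prod D' (fun _ => 1) f
    simpa only [one_mul, avg_const] using this

end LatticeFrame

/-! ### Block matrices -/

section Blocks

/-- The second part of the expansion of `u` lies in `Uᗮ` and, being `u` minus the first part, also
in `U`. -/
theorem repr_inr_eq_zero {E ι ι' : Type*} [NormedAddCommGroup E] [InnerProductSpace ℝ E] [Fintype ι]
    [Fintype ι'] {b : Module.Basis (ι ⊕ ι') ℝ E} {U : Submodule ℝ E} (hb : IsAdapted b U) {u : E}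
    (hu : u ∈ U) (i : ι') : b.repr u (Sum.inr i) = 0 := by
  have h1 := b.sum_repr u
  rw [Fintype.sum_sum_type] at h1
  set p := ∑ i, b.repr u (Sum.inl i) • b (Sum.inl i)
  set q := ∑ i, b.repr u (Sum.inr i) • b (Sum.inr i) with hq
  have hp : p ∈ U := Submodule.sum_mem _ fun i _ => Submodule.smul_mem _ _ (hb.1 i)
  have hq1 : q ∈ Uᗮ := Submodule.sum_mem _ fun i _ => Submodule.smul_mem _ _ (hb.2 i)
  have hq2 : q ∈ U := by
    rw [← add_sub_cancel_left p q, h1]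
    exact Submodule.sub_mem _ hu hp
  have hq0 : q = 0 := by
    have := Submodule.inner_right_of_mem_orthogonal hq2 hq1
    exact inner_self_eq_zero.1 this
  have h2 : b.repr q (Sum.inr i) = b.repr u (Sum.inr i) := by
    classical
    rw [hq]
    simp only [map_sum, map_smul, b.repr_self, Finsupp.finsetSum_apply, Finsupp.smul_apply,
      Finsupp.single_apply, Sum.inr.injEq, smul_eq_mul]
    simp
  rw [← h2, hq0]
  simp

/-- By nondegeneracy `h` and `h'` determine the diagonal components of `T`. The off-diagonal ones
take values in `U = Uᗮᗮ`, giving zero rows, and kill `U'ᗮ`, giving zero columns; symmetrically for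
the other corner. -/
theorem exists_toMatrix_eq_fromBlocks {E E' ι ι' κ κ' : Type*} [NormedAddCommGroup E]
    [InnerProductSpace ℝ E] [FiniteDimensional ℝ E] [NormedAddCommGroup E'] [InnerProductSpace ℝ E']
    [FiniteDimensional ℝ E'] [Fintype ι] [Fintype ι'] [Fintype κ] [Fintype κ'] [DecidableEq ι]
    [DecidableEq ι'] [DecidableEq κ] [DecidableEq κ']
    {b : Module.Basis (ι ⊕ ι') ℝ E} {b' : Module.Basis (κ ⊕ κ') ℝ E'}
    {U : Submodule ℝ E} {U' : Submodule ℝ E'} (hb : IsAdapted b U) (hb' : IsAdapted b' U')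
    (T : WithLp 2 (E × E') →ₗ[ℝ] WithLp 2 (E × E')) (S : E →ₗ[ℝ] E) (S' : E' →ₗ[ℝ] E')
    (h : ∀ v w : E, ⟪WithLp.toLp 2 (v, (0 : E')), T (WithLp.toLp 2 (w, 0))⟫ = ⟪v, S w⟫)
    (h' : ∀ v w : E', ⟪WithLp.toLp 2 ((0 : E), v), T (WithLp.toLp 2 (0, w))⟫ = ⟪v, S' w⟫)
    (hoff : ∀ (v : E) (w : E'), v ∈ Uᗮ ∨ w ∈ U'ᗮ →
      ⟪WithLp.toLp 2 (v, (0 : E')), T (WithLp.toLp 2 (0, w))⟫ = 0)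
    (hoff' : ∀ (v : E') (w : E), v ∈ U'ᗮ ∨ w ∈ Uᗮ →
      ⟪WithLp.toLp 2 ((0 : E), v), T (WithLp.toLp 2 (w, 0))⟫ = 0) :
    ∃ (A : Matrix ι κ ℝ) (A' : Matrix κ ι ℝ),
      LinearMap.toMatrix (prodBasis b b') (prodBasis b b') T =
        Matrix.fromBlocks (LinearMap.toMatrix b b S) (Matrix.fromBlocks A 0 0 0)
          (Matrix.fromBlocks A' 0 0 0) (LinearMap.toMatrix b' b' S') := by
  simp only [WithLp.prod_inner_apply, inner_zero_left, add_zero, zero_add] at h h' hoff hoff'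
  have e1 : ∀ w, (T (WithLp.toLp 2 (w, 0))).fst = S w := fun w => ext_inner_left ℝ fun v => h v w
  have e2 : ∀ w, (T (WithLp.toLp 2 (0, w))).snd = S' w := fun w => ext_inner_left ℝ fun v => h' v w
  have e3 : ∀ w, (T (WithLp.toLp 2 (0, w))).fst ∈ U := fun w => by
    rw [← Submodule.orthogonal_orthogonal U, Submodule.mem_orthogonal]
    exact fun v hv => hoff v w (Or.inl hv)
  have e4 : ∀ w ∈ U'ᗮ, (T (WithLp.toLp 2 (0, w))).fst = 0 := fun w hw =>
    ext_inner_left ℝ fun v => by rw [inner_zero_right]; exact hoff v w (Or.inr hw)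
  have e5 : ∀ w, (T (WithLp.toLp 2 (w, 0))).snd ∈ U' := fun w => by
    rw [← Submodule.orthogonal_orthogonal U', Submodule.mem_orthogonal]
    exact fun v hv => hoff' v w (Or.inl hv)
  have e6 : ∀ w ∈ Uᗮ, (T (WithLp.toLp 2 (w, 0))).snd = 0 := fun w hw =>
    ext_inner_left ℝ fun v => by rw [inner_zero_right]; exact hoff' v w (Or.inr hw)
  have b1 : ∀ j, prodBasis b b' (Sum.inl j) = WithLp.toLp 2 (b j, 0) := fun j => by
    simp [prodBasis]
  have b2 : ∀ j, prodBasis b b' (Sum.inr j) = WithLp.toLp 2 (0, b' j) := fun j => by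
    simp [prodBasis]
  have r1 : ∀ w i, (prodBasis b b').repr w (Sum.inl i) = b.repr w.fst i := fun w i => by
    simp [prodBasis]
  have r2 : ∀ w i, (prodBasis b b').repr w (Sum.inr i) = b'.repr w.snd i := fun w i => by
    simp [prodBasis]
  refine ⟨fun i j => b.repr (T (WithLp.toLp 2 (0, b' (Sum.inl j)))).fst (Sum.inl i),
    fun i j => b'.repr (T (WithLp.toLp 2 (b (Sum.inl j), 0))).snd (Sum.inl i), ?_⟩
  ext i j
  rw [LinearMap.toMatrix_apply]
  rcases i with i | i <;> rcases j with j | j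
  · rw [b1, r1, e1, Matrix.fromBlocks_apply₁₁, LinearMap.toMatrix_apply]
  · rw [b2, r1, Matrix.fromBlocks_apply₁₂]
    rcases i with i | i <;> rcases j with j | j
    · rfl
    · rw [e4 _ (hb'.2 j), map_zero]
      rfl
    · exact repr_inr_eq_zero hb (e3 _) i
    · exact repr_inr_eq_zero hb (e3 _) i
  · rw [b1, r2, Matrix.fromBlocks_apply₂₁]
    rcases i with i | i <;> rcases j with j | j
    · rfl
    · rw [e6 _ (hb.2 j), map_zero]
      rfl
    · exact repr_inr_eq_zero hb' (e5 _) i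
    · exact repr_inr_eq_zero hb' (e5 _) i
  · rw [b2, r2, e2, Matrix.fromBlocks_apply₂₂, LinearMap.toMatrix_apply]

end Blocks

/-! ### Auxiliary estimates -/

/-- Doeblin splitting: removing mass `δ` at each `γ i` leaves a positive measure of mass `1 - #ι δ`.
The lower bound `#ι δ` rather than `δ` covers repeated points `γ i`. -/
theorem norm_ev_sub_le {G ι F : Type*} [Fintype ι] [NormedAddCommGroup F] [NormedSpace ℝ F]
    [CompleteSpace F] (p : PMF G) (γ : ι → G) {δ C : ℝ} (hδ : 0 ≤ δ)
    (h : ∀ i, Fintype.card ι * δ ≤ (p (γ i)).toReal) {g : G → F} (hg : ∀ s, ‖g s‖ ≤ C) :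
    ‖ev p g - δ • ∑ i, g (γ i)‖ ≤ (1 - Fintype.card ι * δ) * C := by
  classical
  let r : G → ℝ := fun s => ∑ i, if s = γ i then δ else 0
  have hr : HasSum r (Fintype.card ι * δ) := by
    have := hasSum_sum fun i (_ : i ∈ Finset.univ) => hasSum_ite_eq (γ i) δ
    simpa using this
  have hrg : HasSum (fun s => r s • g s) (δ • ∑ i, g (γ i)) := by
    have := hasSum_sum fun i (_ : i ∈ Finset.univ) => hasSum_ite_eq (γ i) (δ • g (γ i))
    rw [← Finset.smul_sum] at this
    refine this.congr_fun ?_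
    intro s
    rw [Finset.sum_smul]
    refine Finset.sum_congr rfl fun i _ => ?_
    split_ifs with hi
    · rw [hi]
    · simp
  have hle : ∀ s, r s ≤ (p s).toReal := by
    intro s
    by_cases hs : ∃ i, s = γ i
    · obtain ⟨i, rfl⟩ := hs
      refine le_trans ?_ (h i)
      have : ∀ j ∈ Finset.univ, (if γ i = γ j then δ else 0) ≤ δ := fun j _ => by
        split_ifs <;> simp [hδ]
      simpa using Finset.sum_le_card_nsmul _ _ _ this
    · push Not at hs
      simp [r, hs]
  have h1 := (summable_of_norm_le p hg).hasSum.sub hrg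
  have h2 := ((hasSum_toReal p).sub hr).mul_right C
  rw [show ev p g = ∑' s, (p s).toReal • g s from rfl, ← h1.tsum_eq]
  refine tsum_of_norm_bounded h2 fun s => ?_
  rw [← sub_smul, norm_smul, Real.norm_of_nonneg (sub_nonneg.2 (hle s))]
  exact mul_le_mul_of_nonneg_left (hg s) (sub_nonneg.2 (hle s))

theorem tendsto_ev_of_dominated {G F : Type*} [NormedAddCommGroup F] [NormedSpace ℝ F]
    [CompleteSpace F] (p : PMF G) {g : ℕ → G → F} {g' : G → F} {C : ℝ}
    (hb : ∀ n s, ‖g n s‖ ≤ C) (hg : ∀ s, Tendsto (fun n => g n s) atTop (𝓝 (g' s))) :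
    Tendsto (fun n => ev p (g n)) atTop (𝓝 (ev p g')) := by
  refine tendsto_tsum_of_dominated_convergence
    ((hasSum_toReal p).summable.mul_right C) (fun s => (hg s).const_smul _)
    (Eventually.of_forall fun n s => ?_)
  rw [norm_smul, Real.norm_of_nonneg ENNReal.toReal_nonneg]
  exact mul_le_mul_of_nonneg_left (hb n s) ENNReal.toReal_nonneg

/-- Taylor for `|x| ≤ 1`, the triangle inequality beyond. The bound is global, so a second moment
suffices for domination. -/
theorem norm_exp_mul_I_sub_le (x : ℝ) :
    ‖Complex.exp (x * Complex.I) - 1 - x * Complex.I‖ ≤ 3 * x ^ 2 := by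
  have hn : ‖(x : ℂ) * Complex.I‖ = |x| := by simp
  rcases le_or_gt |x| 1 with h | h
  · have := Complex.norm_exp_sub_one_sub_id_le (x := x * Complex.I) (by rw [hn]; exact h)
    rw [hn, sq_abs] at this
    nlinarith [sq_nonneg x]
  · have h1 : ‖Complex.exp (x * Complex.I)‖ = 1 := Complex.norm_exp_ofReal_mul_I x
    have h2 := norm_sub_le (Complex.exp (x * Complex.I) - 1) (x * Complex.I)
    have h3 := norm_sub_le (Complex.exp (x * Complex.I)) 1
    rw [hn] at h2
    rw [h1, norm_one] at h3
    have h4 : x ^ 2 = |x| ^ 2 := (sq_abs x).symm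
    nlinarith

theorem tendsto_inv_sqrt : Tendsto (fun n : ℕ => (√(n : ℝ))⁻¹) atTop (𝓝 0) :=
  (Real.tendsto_sqrt_atTop.comp tendsto_natCast_atTop_atTop).inv_tendsto_atTop

/-- Third order Taylor at `w / √n`: the remainder times `n` is at most `|w|³ / √n`. -/
theorem tendsto_mul_exp_sub (w : ℝ) :
    Tendsto (fun n : ℕ => (n : ℂ) * (Complex.exp (((√(n : ℝ))⁻¹ * w : ℝ) * Complex.I) - 1 -
      ((√(n : ℝ))⁻¹ * w : ℝ) * Complex.I)) atTop (𝓝 (-(w ^ 2 / 2 : ℝ))) := by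
  rw [tendsto_iff_norm_sub_tendsto_zero]
  have h1 : Tendsto (fun n : ℕ => (√(n : ℝ))⁻¹ * |w| ^ 3) atTop (𝓝 0) := by
    simpa using tendsto_inv_sqrt.mul_const (|w| ^ 3)
  refine tendsto_of_tendsto_of_tendsto_of_le_of_le' tendsto_const_nhds h1
    (Eventually.of_forall fun n => norm_nonneg _) ?_
  have h2 : ∀ᶠ n : ℕ in atTop, |(√(n : ℝ))⁻¹ * w| ≤ 1 := by
    have := (tendsto_inv_sqrt.mul_const w).abs
    rw [zero_mul, abs_zero] at this
    exact this.eventually_le_const one_pos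
  filter_upwards [h2, eventually_gt_atTop 0] with n hn hpos
  set τ := (√(n : ℝ))⁻¹ with hτ
  have hn0 : (0 : ℝ) < n := by exact_mod_cast hpos
  have hτ2 : (n : ℝ) * τ ^ 2 = 1 := by
    rw [hτ, inv_pow, Real.sq_sqrt hn0.le, mul_inv_cancel₀ hn0.ne']
  have hτ0 : 0 ≤ τ := by positivity
  have h3 := Complex.exp_bound (x := (τ * w : ℝ) * Complex.I) (by simpa using hn) (n := 3) (by simp)
  rw [Finset.sum_range_succ, Finset.sum_range_succ, Finset.sum_range_one] at h3
  have h4 : (n : ℂ) * (Complex.exp ((τ * w : ℝ) * Complex.I) - 1 - (τ * w : ℝ) * Complex.I)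
      - (-(w ^ 2 / 2 : ℝ)) = n * (Complex.exp ((τ * w : ℝ) * Complex.I) -
        (((τ * w : ℝ) * Complex.I) ^ 0 / (Nat.factorial 0) +
        ((τ * w : ℝ) * Complex.I) ^ 1 / (Nat.factorial 1) +
        ((τ * w : ℝ) * Complex.I) ^ 2 / (Nat.factorial 2))) := by
    have e : (n : ℂ) * (τ : ℂ) ^ 2 = 1 := by exact_mod_cast hτ2
    have e2 : Complex.I ^ 2 = -1 := Complex.I_sq
    push_cast [Nat.factorial]
    linear_combination (-(w : ℂ) ^ 2 / 2) * e + (n : ℂ) * (τ : ℂ) ^ 2 * (w : ℂ) ^ 2 / 2 * e2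
  rw [h4, norm_mul, Complex.norm_natCast]
  have h5 : ‖((τ * w : ℝ) : ℂ) * Complex.I‖ = τ * |w| := by
    rw [norm_mul, Complex.norm_I, mul_one, Complex.norm_real, norm_mul, Real.norm_of_nonneg hτ0]
    rfl
  rw [h5] at h3
  have h6 : (τ * |w|) ^ 3 * (((3 : ℕ).succ : ℝ) * ((Nat.factorial 3 : ℝ) * (3 : ℕ))⁻¹) ≤
      (τ * |w|) ^ 3 * 1 := by
    refine mul_le_mul_of_nonneg_left ?_ (by positivity)
    norm_num [Nat.factorial]
  calc (n : ℝ) * _ ≤ n * ((τ * |w|) ^ 3 * 1) := mul_le_mul_of_nonneg_left (h3.trans h6) hn0.le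
    _ = (n * τ ^ 2) * (τ * |w| ^ 3) := by ring
    _ = τ * |w| ^ 3 := by rw [hτ2, one_mul]

/-- Second order expansion of the characteristic function of a centred square integrable
variable. -/
theorem tendsto_mul_ev_exp {G : Type*} (p : PMF G) {w : G → ℝ} (hw : SqInt p w)
    (h0 : ev p w = 0) :
    Tendsto (fun n : ℕ => (n : ℂ) * (ev p (fun s => Complex.exp (((√(n : ℝ))⁻¹ * w s : ℝ) *
      Complex.I)) - 1)) atTop (𝓝 (-(ev p fun s => w s ^ 2 : ℝ) / 2)) := by
  -- The quadratic bound at `w / √n`, multiplied by `n`, is `3 w²`, which is summable and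
  -- independent of `n`; the limit may be taken termwise.
  have hlim : Tendsto (fun n : ℕ => ∑' s, (p s).toReal • ((n : ℂ) *
      (Complex.exp (((√(n : ℝ))⁻¹ * w s : ℝ) * Complex.I) - 1 -
      ((√(n : ℝ))⁻¹ * w s : ℝ) * Complex.I))) atTop
      (𝓝 (∑' s, (p s).toReal • (-((w s ^ 2 / 2 : ℝ) : ℂ)))) := by
    refine tendsto_tsum_of_dominated_convergence (hw.mul_left 3)
      (fun s => (tendsto_mul_exp_sub (w s)).const_smul _) ?_
    filter_upwards [eventually_gt_atTop 0] with n hpos s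
    have hn0 : (0 : ℝ) < n := by exact_mod_cast hpos
    rw [norm_smul, Real.norm_of_nonneg ENNReal.toReal_nonneg, norm_mul, Complex.norm_natCast]
    have h1 := norm_exp_mul_I_sub_le ((√(n : ℝ))⁻¹ * w s)
    have hτ2 : (n : ℝ) * (√(n : ℝ))⁻¹ ^ 2 = 1 := by
      rw [inv_pow, Real.sq_sqrt hn0.le, mul_inv_cancel₀ hn0.ne']
    calc (p s).toReal * (n * _) ≤ (p s).toReal * (n * (3 * ((√(n : ℝ))⁻¹ * w s) ^ 2)) := by
          gcongr
      _ = 3 * ((p s).toReal * w s ^ 2) * (n * (√(n : ℝ))⁻¹ ^ 2) := by ring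
      _ = _ := by rw [hτ2, mul_one]
  have e1 : ∑' s, (p s).toReal • (-((w s ^ 2 / 2 : ℝ) : ℂ)) =
      -(ev p fun s => w s ^ 2 : ℝ) / 2 := by
    unfold ev
    rw [Complex.ofReal_tsum, ← tsum_neg, ← tsum_div_const]
    refine tsum_congr fun s => ?_
    simp
    ring
  rw [e1] at hlim
  refine hlim.congr fun n => ?_
  have s1 : Summable fun s => (p s).toReal •
      Complex.exp (((√(n : ℝ))⁻¹ * w s : ℝ) * Complex.I) :=
    summable_of_norm_le p (C := 1) fun s => (Complex.norm_exp_ofReal_mul_I _).le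
  have s2 : Summable fun s => (p s).toReal • (1 : ℂ) :=
    summable_of_norm_le p (C := 1) fun s => by simp
  have s3 : HasSum (fun s => (p s).toReal • ((w s : ℝ) : ℂ)) 0 := by
    have h := hw.summable.hasSum
    rw [show ∑' s, (p s).toReal • w s = 0 from h0] at h
    have h' := Complex.hasSum_ofReal.2 h
    simpa using h'
  have s4 : HasSum (fun s => (p s).toReal • ((((√(n : ℝ))⁻¹ * w s : ℝ) : ℂ) * Complex.I)) 0 := by
    have := (s3.mul_right Complex.I).mul_left (((√(n : ℝ))⁻¹ : ℝ) : ℂ)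
    simp only [zero_mul, mul_zero] at this
    refine this.congr_fun ?_
    intro s
    simp only [Complex.real_smul]
    push_cast
    ring
  have h5 := ((s1.hasSum.sub s2.hasSum).sub s4).mul_left (n : ℂ)
  have e2 : ∑' s, (p s).toReal • (1 : ℂ) = 1 := ev_const p 1
  rw [e2, sub_zero] at h5
  refine Eq.trans ?_ h5.tsum_eq
  refine tsum_congr fun s => ?_
  simp only [Complex.real_smul]
  ring

/-- Approximate eigenvectors of contractions. -/
theorem norm_pow_sub_le {V : Type*} [NormedAddCommGroup V] [NormedSpace ℂ V] (T : V →ₗ[ℂ] V)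
    (hT : ∀ v, ‖T v‖ ≤ ‖v‖) {a : ℂ} (ha : ‖a‖ ≤ 1) (h : V) (n : ℕ) :
    ‖(T ^ n) h - a ^ n • h‖ ≤ n * ‖T h - a • h‖ := by
  induction n with
  | zero => simp
  | succ n ih =>
    -- Telescoping: each step adds one defect `T h - a h`, which neither `T` nor `a ^ n` enlarges.
    have e : (T ^ (n + 1)) h - a ^ (n + 1) • h =
        T ((T ^ n) h - a ^ n • h) + a ^ n • (T h - a • h) := by
      rw [pow_succ', Module.End.mul_apply, map_sub, map_smul, smul_sub, smul_smul, ← pow_succ]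
      abel
    rw [e]
    refine (norm_add_le _ _).trans ?_
    have h1 : ‖a ^ n • (T h - a • h)‖ ≤ ‖T h - a • h‖ := by
      rw [norm_smul, norm_pow]
      exact mul_le_of_le_one_left (norm_nonneg _) (pow_le_one₀ (norm_nonneg _) ha)
    push_cast
    linarith [hT ((T ^ n) h - a ^ n • h)]

theorem norm_pow_le {V : Type*} [NormedAddCommGroup V] [NormedSpace ℂ V] (T : V →ₗ[ℂ] V) {r : ℝ}
    (hr : 0 ≤ r) (hT : ∀ v, ‖T v‖ ≤ r * ‖v‖) (n : ℕ) (v : V) : ‖(T ^ n) v‖ ≤ r ^ n * ‖v‖ := by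
  induction n with
  | zero => simp
  | succ n ih =>
    rw [pow_succ', Module.End.mul_apply, pow_succ', mul_assoc]
    exact (hT _).trans (mul_le_mul_of_nonneg_left ih hr)

theorem norm_pow_le_norm {V : Type*} [NormedAddCommGroup V] [NormedSpace ℂ V] (T : V →ₗ[ℂ] V)
    (hT : ∀ v, ‖T v‖ ≤ ‖v‖) (n : ℕ) (v : V) : ‖(T ^ n) v‖ ≤ ‖v‖ := by
  induction n with
  | zero => simp
  | succ n ih =>
    rw [pow_succ', Module.End.mul_apply]
    exact (hT _).trans ih

namespace LatticeFrame

/-! ### Twisted transfer operators -/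

variable {Γ : Type*} [Group Γ] {κ : Type*} [Fintype κ] [DecidableEq κ]
  {E : Type*} [NormedAddCommGroup E] [InnerProductSpace ℝ E] (D : LatticeFrame Γ κ E)

/-- The character `v` of the cocycle, with phase shift `a`. -/
def phase (v : E) (a : ℝ) (x : D.Δ) (γ : Γ) : ℂ :=
  Complex.exp ((⟪v, D.vec x γ⟫ - a : ℝ) * Complex.I)

theorem norm_phase (v : E) (a : ℝ) (x : D.Δ) (γ : Γ) : ‖D.phase v a x γ‖ = 1 :=
  Complex.norm_exp_ofReal_mul_I _

theorem phase_mul (v : E) (a b : ℝ) (x : D.Δ) (γ γ' : Γ) :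
    D.phase v (a + b) x (γ * γ') = D.phase v a x γ * D.phase v b (D.act x γ) γ' := by
  rw [phase, phase, phase, ← Complex.exp_add, vec_mul, inner_add_right]
  congr 1
  push_cast
  ring

theorem norm_phase_mul_le (v : E) (a : ℝ) (x : D.Δ) (F : D.Δ → ℂ) (γ : Γ) :
    ‖D.phase v a x γ * F (D.act x γ)‖ ≤ ‖F‖ := by
  rw [norm_mul, norm_phase, one_mul]
  exact norm_le_pi_norm F _

/-- The transfer operator of the walk on `Δ`, twisted by a character of the cocycle. -/
def twist (p : PMF Γ) (v : E) (a : ℝ) : (D.Δ → ℂ) →ₗ[ℂ] D.Δ → ℂ where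
  toFun F x := ev p fun s => D.phase v a x s * F (D.act x s)
  map_add' F H := by
    funext x
    rw [Pi.add_apply, ← ev_add (summable_of_norm_le p (D.norm_phase_mul_le v a x F))
      (summable_of_norm_le p (D.norm_phase_mul_le v a x H))]
    simp only [Pi.add_apply, mul_add]
  map_smul' c F := by
    funext x
    simp only [Pi.smul_apply, smul_eq_mul, RingHom.id_apply, ← ev_mul_left, mul_left_comm]

theorem twist_apply (p : PMF Γ) (v : E) (a : ℝ) (F : D.Δ → ℂ) (x : D.Δ) :
    D.twist p v a F x = ev p fun s => D.phase v a x s * F (D.act x s) := rfl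

theorem norm_twist_le (p : PMF Γ) (v : E) (a : ℝ) (F : D.Δ → ℂ) : ‖D.twist p v a F‖ ≤ ‖F‖ :=
  (pi_norm_le_iff_of_nonneg (norm_nonneg _)).2 fun x => norm_ev_le p (D.norm_phase_mul_le v a x F)

/-- Condition on the last step: by the cocycle identity the phase of a product is the product of
phases along the chain. -/
theorem twist_convPow (μ : PMF Γ) (v : E) (a : ℝ) (n : ℕ) (F : D.Δ → ℂ) :
    D.twist (convPow μ n) v (n * a) F = (D.twist μ v a ^ n) F := by
  induction n generalizing F with
  | zero =>
    funext x
    rw [twist_apply, convPow, ev_pure]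
    simp [phase, vec_one, act_one]
  | succ n ih =>
    rw [pow_succ, Module.End.mul_apply, ← ih]
    funext x
    rw [twist_apply, twist_apply, ev_convPow_succ μ n (D.norm_phase_mul_le v _ x F)]
    congr 1
    funext γ
    rw [twist_apply, ← ev_mul_left]
    congr 1
    funext s
    push_cast
    rw [add_mul, one_mul, phase_mul, act_act, mul_assoc]

variable {D} {μ : PMF Γ}

theorem norm_twist_pow_antitone (v : E) (a : ℝ) (F : D.Δ → ℂ) {k n : ℕ} (h : k ≤ n) :
    ‖(D.twist μ v a ^ n) F‖ ≤ ‖(D.twist μ v a ^ k) F‖ := by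
  rw [← Nat.sub_add_cancel h, pow_add, Module.End.mul_apply]
  exact norm_pow_le_norm _ (D.norm_twist_le μ v a) (n - k) _

/-! ### Mixing -/

theorem exists_le_convPow (hμ : IsNondegenerate μ) (hap : IsAperiodic μ) (K : Finset Γ) :
    ∃ N, 0 < N ∧ ∃ δ : ℝ, 0 < δ ∧ ∀ γ ∈ K, δ ≤ (convPow μ N γ).toReal := by
  obtain ⟨n₀, h⟩ := exists_forall_mem_support hμ hap K
  refine ⟨n₀ + 1, n₀.succ_pos, ?_⟩
  have hpos : ∀ γ ∈ K, 0 < (convPow μ (n₀ + 1) γ).toReal := fun γ hγ =>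
    ENNReal.toReal_pos (h _ n₀.le_succ γ hγ) (PMF.apply_ne_top _ _)
  rcases K.eq_empty_or_nonempty with rfl | hK
  · exact ⟨1, one_pos, by simp⟩
  · obtain ⟨γ, hγ, hmin⟩ := K.exists_min_image (fun γ => (convPow μ (n₀ + 1) γ).toReal) hK
    exact ⟨_, hpos γ hγ, hmin⟩

theorem sum_twist_zero (p : PMF Γ) (F : D.Δ → ℂ) : ∑ x, D.twist p 0 0 F x = ∑ x, F x := by
  have h : ∀ x, Summable fun s => (p s).toReal • (F (D.act x s)) := fun x =>
    summable_of_norm_le p (C := ‖F‖) fun s => norm_le_pi_norm F _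
  have h1 : ∀ x, D.twist p 0 0 F x = ev p fun s => F (D.act x s) := fun x => by
    simp [twist_apply, phase]
  simp only [h1]
  unfold ev
  rw [← Summable.tsum_finsetSum fun x _ => h x]
  simp only [← Finset.smul_sum, sum_act]
  exact ev_const p _

/-- Some power of the walk moves any `x` to any `y` with probability at least `δ`. Splitting off
mass `δ / #Δ` towards each `y` produces the sum of `F`, which is zero, and the remaining mass is `1
- δ`. -/
theorem exists_norm_twist_zero_le (hμ : IsNondegenerate μ) (hap : IsAperiodic μ) :
    ∃ N, ∃ r : ℝ, 0 ≤ r ∧ r < 1 ∧ ∀ F : D.Δ → ℂ, ∑ x, F x = 0 →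
      ‖D.twist (convPow μ N) 0 0 F‖ ≤ r * ‖F‖ := by
  classical
  obtain ⟨N, -, δ, hδ, hN⟩ := exists_le_convPow hμ hap
    (Finset.univ.image fun z : D.Δ × D.Δ => ((z.1 : Γ)⁻¹ * z.2))
  have hcard : (0 : ℝ) < Fintype.card D.Δ :=
    lt_of_le_of_ne (Nat.cast_nonneg _) (Ne.symm D.card_ne_zero)
  set δ' := δ / Fintype.card D.Δ with hδ'
  have hcd : (Fintype.card D.Δ : ℝ) * δ' = δ := by rw [hδ']; field_simp
  have hle : ∀ z : D.Δ × D.Δ, δ ≤ (convPow μ N ((z.1 : Γ)⁻¹ * z.2)).toReal := fun z =>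
    hN _ (Finset.mem_image_of_mem _ (Finset.mem_univ z))
  have hδ1 : δ ≤ 1 := by
    refine (hle (⟨1, D.one_mem⟩, ⟨1, D.one_mem⟩)).trans ?_
    exact ENNReal.toReal_le_of_le_ofReal zero_le_one (by simpa using PMF.coe_le_one _ _)
  refine ⟨N, 1 - δ, by linarith, by linarith, fun F hF => ?_⟩
  refine (pi_norm_le_iff_of_nonneg (mul_nonneg (by linarith) (norm_nonneg _))).2 fun x => ?_
  have h := norm_ev_sub_le (convPow μ N) (fun y : D.Δ => ((x : Γ)⁻¹ * y)) (δ := δ') (by positivity)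
    (fun y => by rw [hcd]; exact hle (x, y)) (D.norm_phase_mul_le 0 0 x F)
  have h1 : ∑ y : D.Δ, D.phase 0 0 x ((x : Γ)⁻¹ * y) * F (D.act x ((x : Γ)⁻¹ * y)) = 0 := by
    simp only [act_inv_mul]
    simpa [phase] using hF
  rwa [h1, smul_zero, sub_zero, hcd] at h

theorem exists_norm_twist_zero_pow_lt (hμ : IsNondegenerate μ) (hap : IsAperiodic μ)
    {F : D.Δ → ℂ} (hF : ∑ x, F x = 0) {ε : ℝ} (hε : 0 < ε) :
    ∃ k, ‖D.twist (convPow μ k) 0 0 F‖ < ε := by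
  obtain ⟨N, r, hr0, hr1, h⟩ := exists_norm_twist_zero_le (D := D) hμ hap
  have hpow : ∀ j, ‖D.twist (convPow μ (N * j)) 0 0 F‖ ≤ r ^ j * ‖F‖ ∧
      ∑ x, D.twist (convPow μ (N * j)) 0 0 F x = 0 := by
    intro j
    refine ⟨?_, by rw [sum_twist_zero, hF]⟩
    induction j with
    | zero => simpa using D.norm_twist_le _ 0 0 F
    | succ j ih =>
      have h0 : ∀ n : ℕ, (n : ℝ) * 0 = 0 := fun n => mul_zero _
      have e : D.twist (convPow μ (N * (j + 1))) 0 0 F =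
          D.twist (convPow μ N) 0 0 (D.twist (convPow μ (N * j)) 0 0 F) := by
        have e1 := D.twist_convPow μ 0 0 (N * (j + 1)) F
        have e2 := D.twist_convPow μ 0 0 (N * j) F
        have e3 := D.twist_convPow μ 0 0 N (D.twist (convPow μ (N * j)) 0 0 F)
        rw [h0] at e1 e2 e3
        rw [e1, e3, e2, ← Module.End.mul_apply, ← pow_add]
        congr 2
        ring
      rw [e, pow_succ', mul_assoc]
      exact (h _ (by rw [sum_twist_zero, hF])).trans (mul_le_mul_of_nonneg_left ih hr0)
  have hlim : Tendsto (fun j => r ^ j * ‖F‖) atTop (𝓝 0) := by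
    simpa using (tendsto_pow_atTop_nhds_zero_of_lt_one hr0 hr1).mul_const ‖F‖
  obtain ⟨j, hj⟩ := (hlim.eventually_lt_const hε).exists
  exact ⟨N * j, (hpow j).1.trans_lt hj⟩

/-! ### The central limit theorem -/

variable (D μ) in
/-- The transfer operator twisted by the centred character `v / √n`. -/
def scaledTwist (v : E) (n : ℕ) : (D.Δ → ℂ) →ₗ[ℂ] D.Δ → ℂ :=
  D.twist μ ((√(n : ℝ))⁻¹ • v) ((√(n : ℝ))⁻¹ * ⟪v, D.drift μ⟫)

theorem norm_scaledTwist_le (v : E) (n : ℕ) (F : D.Δ → ℂ) : ‖D.scaledTwist μ v n F‖ ≤ ‖F‖ :=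
  D.norm_twist_le _ _ _ F

theorem tendsto_scaledTwist_pow (v : E) (k : ℕ) (F : D.Δ → ℂ) :
    Tendsto (fun n => (D.scaledTwist μ v n ^ k) F) atTop (𝓝 (D.twist (convPow μ k) 0 0 F)) := by
  rw [tendsto_pi_nhds]
  intro x
  simp only [scaledTwist, ← twist_convPow, twist_apply]
  refine tendsto_ev_of_dominated _ (fun n s => D.norm_phase_mul_le _ _ x F s) fun s => ?_
  refine Tendsto.mul_const _ ?_
  unfold phase
  refine (Complex.continuous_exp.tendsto _).comp (Tendsto.mul_const _ ?_)
  refine (Complex.continuous_ofReal.tendsto _).comp ?_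
  simp only [inner_smul_left, inner_zero_left]
  refine Tendsto.sub ?_ ?_
  · simpa using tendsto_inv_sqrt.mul_const ⟪v, D.vec x s⟫
  · simpa using (tendsto_inv_sqrt.mul_const ⟪v, D.drift μ⟫).const_mul (k : ℝ)

/-- The corrected eigenfunction of the scaled transfer operator. -/
def approxEigen (f g : D.Δ → ℝ) (n : ℕ) (x : D.Δ) : ℂ :=
  Complex.exp (-((√(n : ℝ))⁻¹ * f x : ℝ) * Complex.I) * (1 - g x / (2 * n))

/-- The factor `exp (-i f / √n)` absorbs the coboundary, so that only centred harmonic increments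
appear under the expectation. -/
theorem scaledTwist_approxEigen (f : E →ₗ[ℝ] D.Δ → ℝ) (v : E) (g : D.Δ → ℝ) (n : ℕ) (x : D.Δ) :
    D.scaledTwist μ v n (approxEigen (f v) g n) x =
      Complex.exp (-((√(n : ℝ))⁻¹ * f v x : ℝ) * Complex.I) * ev μ fun s =>
        Complex.exp (((√(n : ℝ))⁻¹ * D.cform μ f x s v : ℝ) * Complex.I) *
          (1 - g (D.act x s) / (2 * n)) := by
  rw [scaledTwist, twist_apply, ← ev_mul_left]
  congr 1
  funext s
  rw [phase, approxEigen, ← mul_assoc, ← mul_assoc, ← Complex.exp_add, ← Complex.exp_add]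
  congr 2
  simp only [cform, form, inner_smul_left, conj_trivial]
  push_cast
  ring

theorem tendsto_approxEigen (f g : D.Δ → ℝ) :
    Tendsto (approxEigen f g) atTop (𝓝 fun _ => 1) := by
  rw [tendsto_pi_nhds]
  intro x
  unfold approxEigen
  have h1 : Tendsto (fun n : ℕ => Complex.exp (-((√(n : ℝ))⁻¹ * f x : ℝ) * Complex.I)) atTop
      (𝓝 1) := by
    have h := tendsto_inv_sqrt.mul_const (f x)
    rw [zero_mul] at h
    have h2 := (((Complex.continuous_ofReal.tendsto _).comp h).neg).mul_const Complex.I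
    have h3 := (Complex.continuous_exp.tendsto _).comp h2
    simpa [Function.comp_def] using h3
  have h2 : Tendsto (fun n : ℕ => (1 : ℂ) - g x / (2 * n)) atTop (𝓝 1) := by
    have h := tendsto_inv_atTop_nhds_zero_nat (𝕜 := ℂ)
    have h3 := (h.const_mul ((g x : ℂ) / 2)).const_sub 1
    rw [mul_zero, sub_zero] at h3
    refine h3.congr fun n => ?_
    rw [div_mul_eq_div_div, div_eq_mul_inv _ (n : ℂ)]
  simpa using h1.mul h2

/-- Order `1/√n` vanishes because the increments are centred at every vertex. At order `1/n` the
conditional variance depends on `x`; the correction `g`, a solution of the Poisson equation,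
replaces it by its average `σ`. -/
theorem tendsto_mul_scaledTwist_sub (hm : D.HasMoment μ) {f : E →ₗ[ℝ] D.Δ → ℝ}
    (hf : D.IsPotential μ f) (v : E) {g : D.Δ → ℝ}
    (hg : ∀ x, g x - D.markov μ g x = ev μ (fun s => D.cform μ f x s v ^ 2) - D.cov μ f v v) :
    Tendsto (fun n : ℕ => (n : ℂ) • (D.scaledTwist μ v n (approxEigen (f v) g n) -
      (1 - D.cov μ f v v / (2 * n) : ℂ) • approxEigen (f v) g n)) atTop (𝓝 0) := by
  rw [tendsto_pi_nhds]
  intro x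
  set σ := D.cov μ f v v
  let e : ℕ → Γ → ℂ := fun n s =>
    Complex.exp (((√(n : ℝ))⁻¹ * D.cform μ f x s v : ℝ) * Complex.I)
  have he : ∀ n s, ‖e n s‖ = 1 := fun n s => Complex.norm_exp_ofReal_mul_I _
  have h1 := tendsto_mul_ev_exp μ (sqInt_cform hm f x v) (ev_cform hm hf x v)
  have hgb : ∀ s, ‖((g (D.act x s) : ℝ) : ℂ)‖ ≤ ‖g‖ := fun s => by
    rw [Complex.norm_real]; exact norm_le_pi_norm g _
  have h2 : Tendsto (fun n => ev μ fun s => e n s * (g (D.act x s) : ℂ)) atTop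
      (𝓝 (ev μ fun s => 1 * (g (D.act x s) : ℂ))) := by
    refine tendsto_ev_of_dominated μ (C := ‖g‖) (fun n s => ?_) fun s => ?_
    · rw [norm_mul, he, one_mul]; exact hgb s
    · refine Tendsto.mul_const _ ?_
      have h := tendsto_inv_sqrt.mul_const (D.cform μ f x s v)
      rw [zero_mul] at h
      have h3 := (Complex.continuous_exp.tendsto _).comp
        (((Complex.continuous_ofReal.tendsto _).comp h).mul_const Complex.I)
      simpa [Function.comp_def, e] using h3
  have h3 : ev μ (fun s => (1 : ℂ) * (g (D.act x s) : ℂ)) = (D.markov μ g x : ℂ) := by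
    rw [markov_apply, ev, ev, Complex.ofReal_tsum]
    refine tsum_congr fun s => ?_
    simp
  rw [h3] at h2
  -- The cross term of `(1 - σ/(2n)) (1 - g/(2n))`, after multiplication by `n`.
  have h4 : Tendsto (fun n : ℕ => (σ : ℂ) * g x / 4 * (n : ℂ)⁻¹) atTop (𝓝 0) := by
    simpa using (tendsto_inv_atTop_nhds_zero_nat (𝕜 := ℂ)).const_mul ((σ : ℂ) * g x / 4)
  have h5 := ((((h1.sub (h2.const_mul (1 / 2 : ℂ))).add_const ((σ : ℂ) / 2 + g x / 2)).sub h4))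
  have h6 : (-((ev μ fun s => D.cform μ f x s v ^ 2 : ℝ) : ℂ) / 2 -
      1 / 2 * (D.markov μ g x : ℂ) + ((σ : ℂ) / 2 + g x / 2) - 0) = 0 := by
    have := congrArg (fun r : ℝ => (r : ℂ)) (hg x)
    push_cast at this
    linear_combination (1 / 2 : ℂ) * this
  rw [h6] at h5
  have h7 : Tendsto (fun n : ℕ => Complex.exp (-((√(n : ℝ))⁻¹ * f v x : ℝ) * Complex.I) *
      ((n : ℂ) * (ev μ (e n) - 1) - 1 / 2 * (ev μ fun s => e n s * (g (D.act x s) : ℂ)) +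
        ((σ : ℂ) / 2 + g x / 2) - (σ : ℂ) * g x / 4 * (n : ℂ)⁻¹)) atTop (𝓝 0) := by
    rw [tendsto_zero_iff_norm_tendsto_zero] at h5 ⊢
    refine h5.congr fun n => ?_
    rw [norm_mul]
    have : ‖Complex.exp (-((√(n : ℝ))⁻¹ * f v x : ℝ) * Complex.I)‖ = 1 := by
      rw [← Complex.ofReal_neg]
      exact Complex.norm_exp_ofReal_mul_I _
    rw [this, one_mul]
  refine h7.congr' ?_
  filter_upwards [eventually_gt_atTop 0] with n hn
  have hn' : (n : ℂ) ≠ 0 := Nat.cast_ne_zero.2 hn.ne'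
  simp only [Pi.smul_apply, Pi.sub_apply, smul_eq_mul]
  rw [scaledTwist_approxEigen]
  have h8 : (ev μ fun s => e n s * (1 - g (D.act x s) / (2 * n))) =
      ev μ (e n) - 1 / (2 * n) * ev μ fun s => e n s * (g (D.act x s) : ℂ) := by
    rw [← ev_mul_left, ← ev_sub (summable_of_norm_le μ fun s => (he n s).le)]
    · congr 1
      funext s
      ring
    · refine summable_of_norm_le μ (C := ‖(1 / (2 * n) : ℂ)‖ * ‖g‖) fun s => ?_
      rw [norm_mul, norm_mul, he, one_mul]
      exact mul_le_mul_of_nonneg_left (hgb s) (norm_nonneg _)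
  rw [h8, approxEigen]
  field_simp
  ring

/-- Replace `1` by the approximate eigenvector at a cost that contractions do not amplify. The
`n`-th power then differs from `lam n ^ n` times that vector by at most `n` times a defect `o(1/n)`.
-/
theorem tendsto_scaledTwist_one (hm : D.HasMoment μ) (hμ : IsNondegenerate μ)
    {f : E →ₗ[ℝ] D.Δ → ℝ} (hf : D.IsPotential μ f) (v : E) :
    Tendsto (fun n => (D.scaledTwist μ v n ^ n) fun _ => 1) atTop
      (𝓝 fun _ => Complex.exp (-(D.cov μ f v v / 2))) := by
  obtain ⟨L, hL⟩ := D.exists_poisson hμ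
  let b : D.Δ → ℝ := fun x => ev μ fun s => D.cform μ f x s v ^ 2
  have hb : D.avg b = D.cov μ f v v := by
    simp only [b, cov, sq]
  have hg : ∀ x, L b x - D.markov μ (L b) x =
      ev μ (fun s => D.cform μ f x s v ^ 2) - D.cov μ f v v := fun x => by rw [hL, hb]
  set σ := D.cov μ f v v
  have hσ : 0 ≤ σ := cov_self_nonneg f v
  set h := approxEigen (f v) (L b)
  set lam : ℕ → ℂ := fun n => 1 - σ / (2 * n) with hlam
  have h1 := tendsto_mul_scaledTwist_sub hm hf v hg
  have h2 := tendsto_approxEigen (f v) (L b)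
  have hlam1 : ∀ᶠ n in atTop, ‖lam n‖ ≤ 1 := by
    filter_upwards [eventually_gt_atTop 0, eventually_ge_atTop ⌈σ⌉₊] with n hn hn'
    have hn0 : (0 : ℝ) < n := by exact_mod_cast hn
    have hσn : σ ≤ n := (Nat.le_ceil σ).trans (by exact_mod_cast hn')
    have e : lam n = ((1 - σ / (2 * n) : ℝ) : ℂ) := by simp [hlam]
    rw [e, Complex.norm_real, Real.norm_eq_abs, abs_le]
    have : σ / (2 * n) ≤ 1 := by rw [div_le_one (by positivity)]; linarith
    have : 0 ≤ σ / (2 * n) := by positivity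
    constructor <;> linarith
  have h3 : Tendsto (fun n => lam n ^ n) atTop (𝓝 (Complex.exp (-(σ / 2)))) := by
    have := Complex.tendsto_one_add_div_pow_exp (-(σ / 2 : ℂ))
    refine this.congr fun n => ?_
    rw [hlam]
    congr 1
    rw [neg_div, ← sub_eq_add_neg, div_div]
  have h4 : Tendsto (fun n => (D.scaledTwist μ v n ^ n) (h n) - lam n ^ n • h n) atTop (𝓝 0) := by
    rw [tendsto_zero_iff_norm_tendsto_zero] at h1 ⊢
    refine tendsto_of_tendsto_of_tendsto_of_le_of_le' tendsto_const_nhds h1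
      (Eventually.of_forall fun n => norm_nonneg _) ?_
    filter_upwards [hlam1] with n hn
    rw [norm_smul, Complex.norm_natCast]
    exact norm_pow_sub_le _ (norm_scaledTwist_le v n) hn (h n) n
  have h5 : Tendsto (fun n => (D.scaledTwist μ v n ^ n) ((fun _ => 1) - h n)) atTop (𝓝 0) := by
    have h6 : Tendsto (fun n => ‖(fun _ => (1 : ℂ)) - h n‖) atTop (𝓝 0) := by
      have := (tendsto_const_nhds (x := fun _ : D.Δ => (1 : ℂ))).sub h2
      rw [sub_self, tendsto_zero_iff_norm_tendsto_zero] at this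
      exact this
    exact squeeze_zero_norm (fun n => norm_pow_le_norm _ (norm_scaledTwist_le v n) n _) h6
  have h7 := (h5.add h4).add (h3.smul h2)
  have e : Complex.exp (-(σ / 2)) • (fun _ : D.Δ => (1 : ℂ)) =
      fun _ => Complex.exp (-(σ / 2)) := by
    funext x
    simp
  rw [zero_add, zero_add, e] at h7
  refine h7.congr fun n => ?_
  rw [map_sub]
  abel

/-- Split off the average. For the rest, choose a fixed `k` for which the untwisted walk makes it
small. The `k`-th scaled power converges to that operator, and later powers only decrease the norm.
-/
theorem tendsto_scaledTwist (hm : D.HasMoment μ) (hμ : IsNondegenerate μ) (hap : IsAperiodic μ)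
    {f : E →ₗ[ℝ] D.Δ → ℝ} (hf : D.IsPotential μ f) (v : E) (F : D.Δ → ℂ) (x : D.Δ) :
    Tendsto (fun n => (D.scaledTwist μ v n ^ n) F x) atTop
      (𝓝 (D.avg F * Complex.exp (-(D.cov μ f v v / 2)))) := by
  set F₀ : D.Δ → ℂ := F - D.avg F • fun _ => 1 with hF₀
  have hsum : ∑ x, F₀ x = 0 := by
    have hc : (Fintype.card D.Δ : ℂ) ≠ 0 := by exact_mod_cast D.card_ne_zero
    simp only [hF₀, Pi.sub_apply, Pi.smul_apply, smul_eq_mul, mul_one, Finset.sum_sub_distrib,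
      Finset.sum_const, Finset.card_univ, nsmul_eq_mul, avg, Complex.real_smul]
    push_cast
    rw [← mul_assoc, mul_one_div_cancel hc, one_mul, sub_self]
  have h0 : Tendsto (fun n => (D.scaledTwist μ v n ^ n) F₀) atTop (𝓝 0) := by
    rw [Metric.tendsto_atTop]
    intro ε hε
    obtain ⟨k, hk⟩ := exists_norm_twist_zero_pow_lt hμ hap hsum hε
    have h1 := (tendsto_scaledTwist_pow (D := D) (μ := μ) v k F₀).norm.eventually_lt_const hk
    obtain ⟨n₀, hn₀⟩ := eventually_atTop.1 h1
    refine ⟨max n₀ k, fun n hn => ?_⟩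
    rw [dist_zero_right]
    exact (norm_twist_pow_antitone _ _ F₀ ((le_max_right _ _).trans hn)).trans_lt
      (hn₀ n ((le_max_left _ _).trans hn))
  have h1 := h0.add ((tendsto_scaledTwist_one hm hμ hf v).const_smul (D.avg F))
  have h2 := (tendsto_pi_nhds.1 h1) x
  rw [zero_add] at h2
  refine h2.congr fun n => ?_
  rw [← map_smul, ← map_add, hF₀, sub_add_cancel]

/-! ### The spectral bound -/

/-- From `|1 + e^{iθ}|² = 2 + 2 cos θ`, the bound `cos θ ≤ 1 - 2θ²/π²`, and `4 - 4t ≤ (2 - t)²`. -/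
theorem norm_one_add_exp_le {θ : ℝ} (hθ : |θ| ≤ Real.pi) :
    ‖1 + Complex.exp (θ * Complex.I)‖ ≤ 2 - θ ^ 2 / Real.pi ^ 2 := by
  have h1 := Real.cos_le_one_sub_mul_cos_sq hθ
  have hpi := Real.pi_pos
  have h2 : θ ^ 2 / Real.pi ^ 2 ≤ 1 := by
    rw [div_le_one (by positivity), ← sq_abs]
    exact pow_le_pow_left₀ (abs_nonneg _) hθ 2
  have h3 : ‖1 + Complex.exp (θ * Complex.I)‖ ^ 2 = 2 + 2 * Real.cos θ := by
    rw [← Complex.normSq_eq_norm_sq, Complex.exp_mul_I, ← Complex.ofReal_cos, ← Complex.ofReal_sin,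
      Complex.normSq_apply]
    simp only [Complex.add_re, Complex.add_im, Complex.one_re, Complex.one_im, Complex.mul_re,
      Complex.mul_im, Complex.ofReal_re, Complex.ofReal_im, Complex.I_re, Complex.I_im]
    linear_combination Real.sin_sq_add_cos_sq θ
  refine abs_le_of_sq_le_sq' ?_ (by linarith) |>.2
  rw [h3]
  have h4 : 2 / Real.pi ^ 2 * θ ^ 2 = 2 * (θ ^ 2 / Real.pi ^ 2) := by ring
  nlinarith [sq_nonneg (θ ^ 2 / Real.pi ^ 2)]

/-- Both `1` and `x⁻¹ e_j x` fix the vertex `x`, with displacements `0` and the `j`-th basis vector.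
Their phases differ by `e^{iθ}`, and the partial cancellation of these two contributions gives the
gain, uniformly in the phase shift `a`. -/
theorem exists_norm_twist_convPow_le (hμ : IsNondegenerate μ) (hap : IsAperiodic μ) :
    ∃ N, 0 < N ∧ ∃ c : ℝ, 0 < c ∧ ∀ (v : E) (a : ℝ) (j : κ) (F : D.Δ → ℂ),
      |⟪v, D.basis j⟫| ≤ Real.pi →
      ‖D.twist (convPow μ N) v a F‖ ≤ Real.exp (-(c * ⟪v, D.basis j⟫ ^ 2)) * ‖F‖ := by
  classical
  obtain ⟨N, hN0, δ, hδ, hN⟩ := exists_le_convPow hμ hap (insert 1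
    (Finset.univ.image fun z : D.Δ × κ => (D.conj (z.1 : Γ)⁻¹ (D.gen z.2) : Γ)))
  refine ⟨N, hN0, δ / 2 / Real.pi ^ 2, by positivity, fun v a j F hj => ?_⟩
  refine (pi_norm_le_iff_of_nonneg (by positivity)).2 fun x => ?_
  let l : D.Λ := D.conj (x : Γ)⁻¹ (D.gen j)
  have hvec : D.vec x l = D.basis j := by
    rw [vec_coe, conj_conj, mul_inv_cancel, ← emb_gen]
    congr 1
    exact Subtype.ext (by simp [conj])
  set θ := ⟪v, D.basis j⟫
  have h := norm_ev_sub_le (convPow μ N) (fun b : Bool => if b then (l : Γ) else 1) (δ := δ / 2)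
    (by positivity) (fun b => by
      rw [Fintype.card_bool, Nat.cast_ofNat, mul_div_cancel₀ δ two_ne_zero]
      cases b
      · exact hN _ (Finset.mem_insert_self _ _)
      · exact hN _ (Finset.mem_insert_of_mem (Finset.mem_image_of_mem _ (Finset.mem_univ (x, j)))))
    (D.norm_phase_mul_le v a x F)
  rw [Fintype.sum_bool, Fintype.card_bool] at h
  simp only [if_true, Bool.false_eq_true, if_false, act_coe, act_one] at h
  have e1 : D.phase v a x l * F x + D.phase v a x 1 * F x =
      D.phase v a x 1 * ((1 + Complex.exp (θ * Complex.I)) * F x) := by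
    have : D.phase v a x l = D.phase v a x 1 * Complex.exp (θ * Complex.I) := by
      rw [phase, phase, ← Complex.exp_add, hvec, vec_one, inner_zero_right]
      congr 1
      push_cast
      ring
    rw [this]
    ring
  rw [e1] at h
  have h2 : ‖(δ / 2) • (D.phase v a x 1 * ((1 + Complex.exp (θ * Complex.I)) * F x))‖ ≤
      δ / 2 * ((2 - θ ^ 2 / Real.pi ^ 2) * ‖F‖) := by
    rw [norm_smul, Real.norm_of_nonneg (by positivity), norm_mul, norm_phase, one_mul, norm_mul]
    have h3 := norm_one_add_exp_le hj
    have h4 := norm_le_pi_norm F x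
    exact mul_le_mul_of_nonneg_left (mul_le_mul h3 h4 (norm_nonneg _) ((norm_nonneg _).trans h3))
      (by positivity)
  have h3 : 1 - δ / 2 / Real.pi ^ 2 * θ ^ 2 ≤ Real.exp (-(δ / 2 / Real.pi ^ 2 * θ ^ 2)) := by
    linarith [Real.add_one_le_exp (-(δ / 2 / Real.pi ^ 2 * θ ^ 2))]
  rw [twist_apply]
  set A := ev (convPow μ N) fun s => D.phase v a x s * F (D.act x s)
  set B := (δ / 2) • (D.phase v a x 1 * ((1 + Complex.exp (θ * Complex.I)) * F x))
  have h4 : ‖A‖ ≤ ‖A - B‖ + ‖B‖ := by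
    simpa using norm_add_le (A - B) B
  have h5 : (1 - ((2 : ℕ) : ℝ) * (δ / 2)) * ‖F‖ + δ / 2 * ((2 - θ ^ 2 / Real.pi ^ 2) * ‖F‖) =
      (1 - δ / 2 / Real.pi ^ 2 * θ ^ 2) * ‖F‖ := by
    push_cast
    ring
  have h6 := mul_le_mul_of_nonneg_right h3 (norm_nonneg F)
  linarith

/-- Gaussian domination of the scaled transfer operators. -/
theorem exists_norm_scaledTwist_pow_le (hμ : IsNondegenerate μ) (hap : IsAperiodic μ) :
    ∃ n₀ : ℕ, ∃ c : ℝ, 0 < c ∧ ∀ n ≥ n₀, ∀ (v : E) (F : D.Δ → ℂ),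
      (∀ j, |⟪v, D.basis j⟫| ≤ Real.pi * √(n : ℝ)) →
      ‖(D.scaledTwist μ v n ^ n) F‖ ≤
        Real.exp (-(c * ∑ j, ⟪v, D.basis j⟫ ^ 2)) * ‖F‖ := by
  obtain ⟨N, hN, c, hc, h⟩ := exists_norm_twist_convPow_le (D := D) hμ hap
  -- The factor `1 / (2N)` comes from `⌊n/N⌋ ≥ n / (2N)` for `n ≥ N`. Dividing by `#κ + 1` pays for
  -- using only the largest coordinate, and stays legitimate for empty `κ`.
  refine ⟨N, c / (2 * N) / (Fintype.card κ + 1), by positivity, fun n hn v F hv => ?_⟩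
  have hn0 : (0 : ℝ) < n := by exact_mod_cast hN.trans_le hn
  have hN0 : (0 : ℝ) < N := by exact_mod_cast hN
  have hsq : 0 < √(n : ℝ) := Real.sqrt_pos.2 hn0
  have hτ2 : (n : ℝ) * (√(n : ℝ))⁻¹ ^ 2 = 1 := by
    rw [inv_pow, Real.sq_sqrt hn0.le, mul_inv_cancel₀ hn0.ne']
  rcases isEmpty_or_nonempty κ with hκ | hκ
  · simpa using norm_pow_le_norm _ (norm_scaledTwist_le v n) n F
  obtain ⟨j, -, hj⟩ := Finset.exists_max_image Finset.univ (fun j => ⟪v, D.basis j⟫ ^ 2)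
    Finset.univ_nonempty
  set w := (√(n : ℝ))⁻¹ • v
  have hw : ⟪w, D.basis j⟫ = (√(n : ℝ))⁻¹ * ⟪v, D.basis j⟫ := by
    simp [w, inner_smul_left]
  have hwpi : |⟪w, D.basis j⟫| ≤ Real.pi := by
    rw [hw, abs_mul, abs_of_pos (inv_pos.2 hsq), inv_mul_le_iff₀ hsq, mul_comm]
    exact hv j
  set a := (√(n : ℝ))⁻¹ * ⟪v, D.drift μ⟫
  have h1 : ∀ F, ‖(D.twist μ w a ^ N) F‖ ≤ Real.exp (-(c * ⟪w, D.basis j⟫ ^ 2)) * ‖F‖ := fun F => by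
    rw [← twist_convPow]
    exact h w _ j F hwpi
  have h2 := norm_pow_le (D.twist μ w a ^ N) (Real.exp_pos _).le h1 (n / N) F
  rw [← pow_mul] at h2
  refine (norm_twist_pow_antitone w a F (Nat.mul_div_le n N)).trans (h2.trans ?_)
  refine mul_le_mul_of_nonneg_right ?_ (norm_nonneg _)
  rw [← Real.exp_nat_mul, Real.exp_le_exp]
  have h3 : (n : ℝ) / (2 * N) ≤ (n / N : ℕ) := by
    rw [div_le_iff₀ (by positivity)]
    have h4 : n ≤ (n / N) * (2 * N) := by
      have h5 := Nat.div_add_mod n N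
      have h6 := Nat.mod_lt n hN
      have h7 : 1 ≤ n / N := (Nat.one_le_div_iff hN).2 hn
      nlinarith
    exact_mod_cast h4
  have h4 : ∑ i, ⟪v, D.basis i⟫ ^ 2 ≤ (Fintype.card κ + 1) * ⟪v, D.basis j⟫ ^ 2 := by
    have := Finset.sum_le_card_nsmul Finset.univ (fun i => ⟪v, D.basis i⟫ ^ 2) _
      fun i hi => hj i hi
    rw [nsmul_eq_mul, Finset.card_univ] at this
    nlinarith [sq_nonneg ⟪v, D.basis j⟫]
  have h5 : c / (2 * N) / (Fintype.card κ + 1) * ∑ i, ⟪v, D.basis i⟫ ^ 2 ≤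
      c / (2 * N) * ⟪v, D.basis j⟫ ^ 2 := by
    rw [div_mul_eq_mul_div, div_le_iff₀ (by positivity), mul_assoc]
    refine mul_le_mul_of_nonneg_left ?_ (by positivity)
    linarith
  have h6 : c / (2 * N) * ⟪v, D.basis j⟫ ^ 2 = (n : ℝ) / (2 * N) * (c * ⟪w, D.basis j⟫ ^ 2) := by
    rw [hw, mul_pow]
    linear_combination (-(c / (2 * N) * ⟪v, D.basis j⟫ ^ 2)) * hτ2
  have h7 := mul_le_mul_of_nonneg_right h3 (show 0 ≤ c * ⟪w, D.basis j⟫ ^ 2 by positivity)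
  linarith

end LatticeFrame

open MeasureTheory

/-! ### Step functions on `ℝ^κ` -/

section Step

variable {κ : Type*}

/-- The lattice point `⌊s y + a⌋`. -/
def cell (s : ℝ) (a y : κ → ℝ) (j : κ) : ℤ := ⌊s * y j + a j⌋

theorem measurable_cell (s : ℝ) (a : κ → ℝ) : Measurable (cell s a) :=
  measurable_pi_lambda _ fun j =>
    (show Measurable fun y : κ → ℝ => s * y j + a j by fun_prop).floor

/-- The centred rescaled lattice point. -/
def roundPt (s : ℝ) (a y : κ → ℝ) (j : κ) : ℝ := (cell s a y j - a j) / s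

theorem measurable_roundPt (s : ℝ) (a : κ → ℝ) : Measurable (roundPt s a) :=
  measurable_pi_lambda _ fun j => ((measurable_from_top.comp
    ((measurable_pi_apply j).comp (measurable_cell s a))).sub_const (a j)).div_const s

variable [Fintype κ]

/-- The points rounded to a given lattice point form a cube of side `1 / s`. Lattice sums thereby
become integrals of step functions, on one fixed measure space for all `n`. -/
theorem map_cell {s : ℝ} (hs : 0 < s) (a : κ → ℝ) :
    Measure.map (cell s a) volume = ENNReal.ofReal s⁻¹ ^ Fintype.card κ • Measure.count := by
  refine Measure.ext_of_singleton fun z => ?_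
  rw [Measure.map_apply (measurable_cell s a) (measurableSet_singleton z), Measure.smul_apply,
    Measure.count_singleton, smul_eq_mul, mul_one]
  have h : cell s a ⁻¹' {z} =
      Set.univ.pi fun j => Set.Ico ((z j - a j) / s) ((z j + 1 - a j) / s) := by
    ext y
    simp only [Set.mem_preimage, Set.mem_singleton_iff, funext_iff, cell, Int.floor_eq_iff,
      Set.mem_pi, Set.mem_univ, true_implies, Set.mem_Ico, div_le_iff₀ hs, lt_div_iff₀ hs]
    refine forall_congr' fun j => ?_
    rw [mul_comm s, sub_le_iff_le_add, lt_sub_iff_add_lt]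
  rw [h, volume_pi_pi]
  simp only [Real.volume_Ico]
  rw [← Finset.card_univ, ← Finset.prod_const]
  refine Finset.prod_congr rfl fun j _ => ?_
  congr 1
  field_simp
  ring

theorem lintegral_cell {s : ℝ} (hs : 0 < s) (a : κ → ℝ) (f : (κ → ℤ) → ℝ≥0∞) :
    ∫⁻ y, f (cell s a y) = ENNReal.ofReal s⁻¹ ^ Fintype.card κ * ∑' z, f z := by
  rw [← lintegral_map (measurable_of_countable f) (measurable_cell s a), map_cell hs,
    lintegral_smul_measure, lintegral_count, smul_eq_mul]

theorem integrable_cell {s : ℝ} (hs : 0 < s) (a : κ → ℝ) {f : (κ → ℤ) → ℝ} (hf : Summable f) :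
    Integrable fun y => f (cell s a y) := by
  refine ⟨((measurable_of_countable f).comp (measurable_cell s a)).aestronglyMeasurable, ?_⟩
  rw [HasFiniteIntegral, lintegral_cell hs a fun z => ‖f z‖ₑ]
  refine ENNReal.mul_lt_top (ENNReal.pow_lt_top ENNReal.ofReal_lt_top) ?_
  have h := hf.norm
  have := ENNReal.ofReal_tsum_of_nonneg (fun z => norm_nonneg (f z)) h
  simp only [ofReal_norm] at this
  rw [← this]
  exact ENNReal.ofReal_lt_top

theorem integral_cell {s : ℝ} (hs : 0 < s) (a : κ → ℝ) {f : (κ → ℤ) → ℝ} (hf : Summable f)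
    (h0 : ∀ z, 0 ≤ f z) :
    ∫ y, f (cell s a y) = s⁻¹ ^ Fintype.card κ * ∑' z, f z := by
  rw [integral_eq_lintegral_of_nonneg_ae (Eventually.of_forall fun y => h0 _)
    (integrable_cell hs a hf).aestronglyMeasurable, lintegral_cell hs a fun z => ENNReal.ofReal (f z),
    ← ENNReal.ofReal_tsum_of_nonneg h0 hf, ENNReal.toReal_mul, ENNReal.toReal_pow,
    ENNReal.toReal_ofReal (by positivity), ENNReal.toReal_ofReal (tsum_nonneg h0)]

theorem summable_of_integrable_cell {s : ℝ} (hs : 0 < s) (a : κ → ℝ) {f : (κ → ℤ) → ℝ}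
    (h0 : ∀ z, 0 ≤ f z) (hf : Integrable fun y => f (cell s a y)) : Summable f := by
  have h := hf.lintegral_lt_top
  rw [lintegral_cell hs a fun z => ENNReal.ofReal (f z)] at h
  have h1 : ∑' z, ENNReal.ofReal (f z) ≠ ⊤ := fun h2 => by
    rw [h2, ENNReal.mul_top (pow_ne_zero _ (by simpa using hs))] at h
    exact h.ne rfl
  simpa [ENNReal.toReal_ofReal (h0 _)] using ENNReal.summable_toReal h1

theorem norm_roundPt_sub_le {s : ℝ} (hs : 0 < s) (a y : κ → ℝ) : ‖roundPt s a y - y‖ ≤ s⁻¹ := by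
  refine (pi_norm_le_iff_of_nonneg (by positivity)).2 fun j => ?_
  have h1 := Int.floor_le (s * y j + a j)
  have h2 := Int.lt_floor_add_one (s * y j + a j)
  have e : (roundPt s a y - y) j = (⌊s * y j + a j⌋ - (s * y j + a j)) / s := by
    simp only [roundPt, cell, Pi.sub_apply]
    field_simp
    ring
  rw [e, Real.norm_eq_abs, abs_div, abs_of_pos hs, div_eq_mul_inv]
  refine mul_le_of_le_one_left (by positivity) ?_
  rw [abs_le]
  constructor <;> linarith

theorem tendsto_roundPt {s : ℕ → ℝ} (hs : Tendsto s atTop atTop) (a : ℕ → κ → ℝ) (y : κ → ℝ) :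
    Tendsto (fun n => roundPt (s n) (a n) y) atTop (𝓝 y) := by
  rw [tendsto_iff_norm_sub_tendsto_zero]
  refine tendsto_of_tendsto_of_tendsto_of_le_of_le' tendsto_const_nhds hs.inv_tendsto_atTop
    (Eventually.of_forall fun n => norm_nonneg _) ?_
  filter_upwards [hs.eventually_gt_atTop 0] with n hn
  exact norm_roundPt_sub_le hn _ _

end Step

/-! ### Scheffé's lemma -/

/-- Use `|f - g| = 2 (g - f)⁺ + (f - g)`: the positive part is dominated by `g`, and the other term
has integral tending to zero. -/
theorem tendsto_integral_abs_sub {α : Type*} [MeasurableSpace α] {m : Measure α} {f : ℕ → α → ℝ}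
    {g : α → ℝ} (hf0 : ∀ᶠ n in atTop, ∀ x, 0 ≤ f n x) (hf : ∀ᶠ n in atTop, Integrable (f n) m)
    (hg : Integrable g m) (hlim : ∀ x, Tendsto (fun n => f n x) atTop (𝓝 (g x)))
    (hint : Tendsto (fun n => ∫ x, f n x ∂m) atTop (𝓝 (∫ x, g x ∂m))) :
    Tendsto (fun n => ∫ x, |f n x - g x| ∂m) atTop (𝓝 0) := by
  have hg0 : ∀ x, 0 ≤ g x := fun x =>
    ge_of_tendsto (hlim x) (hf0.mono fun n hn => hn x)
  have h1 : Tendsto (fun n => ∫ x, max (g x - f n x) 0 ∂m) atTop (𝓝 (∫ x, (0 : ℝ) ∂m)) := by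
    refine tendsto_integral_filter_of_dominated_convergence g ?_ ?_ hg ?_
    · filter_upwards [hf] with n hn
      exact ((hg.sub hn).sup (integrable_zero _ _ _)).aestronglyMeasurable
    · filter_upwards [hf0] with n hn
      refine Eventually.of_forall fun x => ?_
      rw [Real.norm_of_nonneg (le_max_right _ _)]
      exact max_le (by linarith [hn x]) (hg0 x)
    · refine Eventually.of_forall fun x => ?_
      have := (((hlim x).const_sub (g x)).max (tendsto_const_nhds (x := (0 : ℝ))))
      simpa using this
  rw [integral_zero] at h1
  have h2 := (h1.const_mul 2).add (hint.sub_const (∫ x, g x ∂m))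
  rw [sub_self, mul_zero, add_zero] at h2
  refine h2.congr' ?_
  filter_upwards [hf] with n hn
  have h3 : Integrable (fun x => max (g x - f n x) 0) m := (hg.sub hn).sup (integrable_zero _ _ _)
  have h4 : Integrable (fun x => f n x - g x) m := hn.sub hg
  rw [← integral_const_mul, ← integral_sub hn hg, ← integral_add (h3.const_mul 2) h4]
  refine integral_congr_ae (Eventually.of_forall fun x => ?_)
  dsimp only
  rcases le_total (g x) (f n x) with h | h
  · rw [max_eq_right (by linarith), abs_of_nonneg (by linarith)]; ring
  · rw [max_eq_left (by linarith), abs_of_nonpos (by linarith)]; ring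

/-! ### Fourier inversion on the lattice -/

section Fourier

variable {κ : Type*} [Fintype κ]

/-- The character `u ↦ exp (i ⟨t, u⟩)` of `ℝ^κ`. -/
def chr (t u : κ → ℝ) : ℂ := Complex.exp ((∑ j, t j * u j : ℝ) * Complex.I)

theorem norm_chr (t u : κ → ℝ) : ‖chr t u‖ = 1 := Complex.norm_exp_ofReal_mul_I _

theorem chr_add (t u u' : κ → ℝ) : chr t (u + u') = chr t u * chr t u' := by
  rw [chr, chr, chr, ← Complex.exp_add]
  congr 1
  simp only [Pi.add_apply, mul_add, Finset.sum_add_distrib]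
  push_cast
  ring

theorem continuous_chr_left (u : κ → ℝ) : Continuous fun t => chr t u := by
  unfold chr; fun_prop

theorem continuous_chr_right (t : κ → ℝ) : Continuous fun u => chr t u := by
  unfold chr; fun_prop

/-- The cube `[-π s, π s]^κ`. -/
def cube (κ : Type*) (s : ℝ) : Set (κ → ℝ) :=
  Set.univ.pi fun _ => Set.Ioc (-(Real.pi * s)) (Real.pi * s)

theorem integral_exp_int {s : ℝ} (hs : 0 < s) (k : ℤ) :
    ∫ x in Set.Ioc (-(Real.pi * s)) (Real.pi * s), Complex.exp ((x * (k / s) : ℝ) * Complex.I) =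
      if k = 0 then ((2 * Real.pi * s : ℝ) : ℂ) else 0 := by
  have hpi : 0 < Real.pi * s := mul_pos Real.pi_pos hs
  rw [← intervalIntegral.integral_of_le (by linarith)]
  split_ifs with hk
  · subst hk
    simp
    ring
  · have hc : ((k : ℂ) / s * Complex.I) ≠ 0 := by
      have : (s : ℂ) ≠ 0 := by exact_mod_cast hs.ne'
      have : (k : ℂ) ≠ 0 := by exact_mod_cast hk
      simp [*]
    have e : ∀ x : ℝ, Complex.exp ((x * (k / s) : ℝ) * Complex.I) =
        Complex.exp ((k : ℂ) / s * Complex.I * x) := fun x => by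
      congr 1
      push_cast
      ring
    simp only [e]
    rw [integral_exp_mul_complex hc]
    have hs' : (s : ℂ) ≠ 0 := by exact_mod_cast hs.ne'
    have e2 : Complex.exp ((k : ℂ) / s * Complex.I * (Real.pi * s : ℝ)) =
        Complex.exp ((k : ℂ) / s * Complex.I * (-(Real.pi * s) : ℝ)) := by
      rw [Complex.exp_eq_exp_iff_exists_int]
      refine ⟨k, ?_⟩
      push_cast
      field_simp
      ring
    rw [e2, sub_self, zero_div]

theorem integral_chr_int {s : ℝ} (hs : 0 < s) (k : κ → ℤ) :
    ∫ t in cube κ s, chr t (fun j => k j / s) =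
      if k = 0 then ((2 * Real.pi * s : ℝ) : ℂ) ^ Fintype.card κ else 0 := by
  have e : ∀ t : κ → ℝ, chr t (fun j => k j / s) =
      ∏ j, Complex.exp ((t j * (k j / s) : ℝ) * Complex.I) := fun t => by
    rw [chr, Complex.ofReal_sum, Finset.sum_mul, Complex.exp_sum]
  simp only [e]
  rw [cube, volume_pi, Measure.restrict_pi_pi,
    integral_fintype_prod_eq_prod (fun j (x : ℝ) => Complex.exp ((x * (k j / s) : ℝ) * Complex.I))]
  simp only [integral_exp_int hs]
  split_ifs with hk
  · simp [hk]
  · obtain ⟨j, hj⟩ := Function.ne_iff.1 hk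
    exact Finset.prod_eq_zero (Finset.mem_univ j) (if_neg hj)

theorem volume_cube_lt_top (s : ℝ) : volume (cube κ s) < ⊤ := by
  rw [cube, volume_pi_pi]
  exact ENNReal.prod_lt_top fun j _ => by simp

/-- Orthogonality of characters on a full period; the shift `w` cancels in the product, and absolute
summability allows integration term by term. -/
theorem integral_tsum_mul_chr {s : ℝ} (hs : 0 < s) {b : (κ → ℤ) → ℂ} (hb : Summable b)
    (w : κ → ℝ) (k : κ → ℤ) :
    ∫ t in cube κ s, (∑' z, b z * chr t fun j => z j / s - w j) *
      chr t (fun j => -(k j / s - w j)) = ((2 * Real.pi * s : ℝ) : ℂ) ^ Fintype.card κ * b k := by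
  have hfin : IsFiniteMeasure (volume.restrict (cube κ s)) :=
    ⟨by rw [Measure.restrict_apply_univ]; exact volume_cube_lt_top s⟩
  have e : ∀ t, (∑' z, b z * chr t fun j => z j / s - w j) * chr t (fun j => -(k j / s - w j)) =
      ∑' z, b z * chr t fun j => (z - k) j / s := fun t => by
    rw [← tsum_mul_right]
    refine tsum_congr fun z => ?_
    rw [mul_assoc, ← chr_add]
    congr 2
    funext j
    simp only [Pi.add_apply, Pi.sub_apply]
    push_cast
    ring
  simp only [e]
  have hcont : ∀ z : κ → ℤ, Continuous fun t => b z * chr t fun j => (z - k) j / s := fun z =>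
    continuous_const.mul (continuous_chr_left _)
  have hint : ∀ z : κ → ℤ, Integrable (fun t => b z * chr t fun j => (z - k) j / s)
      (volume.restrict (cube κ s)) := fun z =>
    Integrable.of_bound (hcont z).aestronglyMeasurable ‖b z‖
      (Eventually.of_forall fun t => by rw [norm_mul, norm_chr, mul_one])
  have h := hasSum_integral_of_summable_integral_norm hint (by
    simp only [norm_mul, norm_chr, mul_one, integral_const, smul_eq_mul]
    exact hb.norm.mul_left _)
  rw [← h.tsum_eq]
  simp only [integral_const_mul, integral_chr_int hs]
  rw [tsum_eq_single k]
  · simp [mul_comm]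
  · intro z hz
    rw [if_neg (sub_ne_zero.2 hz), mul_zero]

end Fourier

/-! ### Gaussian functions on `ℝ^κ` -/

section GaussianFunction

variable {κ : Type*} [Fintype κ]

/-- The function `exp (- a ‖L y‖²)`. -/
def gauss (a : ℝ) (L : (κ → ℝ) →ₗ[ℝ] κ → ℝ) (y : κ → ℝ) : ℝ := Real.exp (-a * ∑ j, L y j ^ 2)

theorem gauss_pos (a : ℝ) (L : (κ → ℝ) →ₗ[ℝ] κ → ℝ) (y : κ → ℝ) : 0 < gauss a L y := Real.exp_pos _

theorem continuous_gauss (a : ℝ) (L : (κ → ℝ) →ₗ[ℝ] κ → ℝ) : Continuous (gauss a L) := by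
  have := L.continuous_of_finiteDimensional
  unfold gauss
  fun_prop

theorem integral_comp_linear (L : (κ → ℝ) →ₗ[ℝ] κ → ℝ) (hL : LinearMap.det L ≠ 0)
    {f : (κ → ℝ) → ℂ} (hf : Continuous f) :
    ∫ y, f (L y) = (|(LinearMap.det L)⁻¹| : ℝ) * ∫ u, f u := by
  have h := Real.map_linearMap_volume_pi_eq_smul_volume_pi hL
  have hc := L.continuous_of_finiteDimensional
  rw [← integral_map hc.aemeasurable hf.aestronglyMeasurable, h, integral_smul_measure,
    ENNReal.toReal_ofReal (abs_nonneg _), Complex.real_smul]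

theorem integrable_gauss_id {a : ℝ} (ha : 0 < a) :
    Integrable (gauss a (LinearMap.id : (κ → ℝ) →ₗ[ℝ] κ → ℝ)) := by
  have h := GaussianFourier.integrable_cexp_neg_sum_mul_add (ι := κ) (b := fun _ => (a : ℂ))
    (fun _ => by simpa using ha) (fun _ => 0)
  refine h.norm.congr (Eventually.of_forall fun y => ?_)
  simp only [zero_mul, Finset.sum_const_zero, add_zero, Complex.norm_exp, gauss, LinearMap.id_apply]
  congr 1
  rw [Finset.mul_sum, Complex.neg_re, Complex.re_sum, ← Finset.sum_neg_distrib]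
  refine Finset.sum_congr rfl fun j _ => ?_
  rw [← Complex.ofReal_pow, ← Complex.ofReal_mul, Complex.ofReal_re, neg_mul]

theorem integrable_gauss {a : ℝ} (ha : 0 < a) (L : (κ → ℝ) →ₗ[ℝ] κ → ℝ)
    (hL : LinearMap.det L ≠ 0) : Integrable (gauss a L) := by
  have h := Real.map_linearMap_volume_pi_eq_smul_volume_pi hL
  have hc := L.continuous_of_finiteDimensional
  have h1 : Integrable (gauss a (LinearMap.id : (κ → ℝ) →ₗ[ℝ] κ → ℝ)) (Measure.map L volume) := by
    rw [h]
    exact (integrable_gauss_id ha).smul_measure ENNReal.ofReal_ne_top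
  exact h1.comp_aemeasurable hc.aemeasurable

theorem integral_gauss_pos {a : ℝ} (ha : 0 < a) (L : (κ → ℝ) →ₗ[ℝ] κ → ℝ)
    (hL : LinearMap.det L ≠ 0) : 0 < ∫ y, gauss a L y := by
  refine (integral_pos_iff_support_of_nonneg (fun y => (gauss_pos a L y).le)
    (integrable_gauss ha L hL)).2 ?_
  have : Function.support (gauss a L) = Set.univ := by
    ext y
    simp [(gauss_pos a L y).ne']
  rw [this]
  exact Measure.measure_univ_pos.2 (NeZero.ne _)

theorem integral_gauss_mul_chr_id (y : κ → ℝ) :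
    ∫ t : κ → ℝ, (gauss (1 / 2) LinearMap.id t : ℂ) * chr t (-y) =
      ((√(2 * Real.pi) ^ Fintype.card κ : ℝ) : ℂ) * gauss (1 / 2) LinearMap.id y := by
  have h := GaussianFourier.integral_cexp_neg_sum_mul_add (ι := κ) (b := fun _ => (1 / 2 : ℂ))
    (fun _ => by norm_num) (fun j => -(y j) * Complex.I)
  have e1 : ∀ t : κ → ℝ, (gauss (1 / 2) LinearMap.id t : ℂ) * chr t (-y) =
      Complex.exp (-∑ j, (1 / 2 : ℂ) * (t j : ℂ) ^ 2 + ∑ j, -(y j) * Complex.I * t j) := fun t => by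
    rw [gauss, chr, Complex.ofReal_exp, ← Complex.exp_add]
    congr 1
    simp only [LinearMap.id_apply, Pi.neg_apply]
    push_cast
    rw [Finset.mul_sum, Finset.sum_mul, ← Finset.sum_neg_distrib]
    congr 1
    · exact Finset.sum_congr rfl fun j _ => by ring
    · exact Finset.sum_congr rfl fun j _ => by ring
  have e2 : ((Real.pi : ℂ) / (1 / 2)) ^ (1 / 2 : ℂ) = ((√(2 * Real.pi) : ℝ) : ℂ) := by
    rw [Real.sqrt_eq_rpow, Complex.ofReal_cpow (by positivity)]
    congr 1
    · push_cast; ring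
    · push_cast; rfl
  simp only [e1]
  rw [h, Finset.prod_mul_distrib, e2, Finset.prod_const, Finset.card_univ, ← Complex.exp_sum, gauss]
  push_cast
  congr 2
  rw [Finset.mul_sum]
  refine Finset.sum_congr rfl fun j _ => ?_
  rw [mul_pow, Complex.I_sq]
  simp only [id_eq]
  ring

variable {C L : (κ → ℝ) →ₗ[ℝ] κ → ℝ} (hCL : ∀ t y, ∑ j, C t j * L y j = ∑ j, t j * y j)

include hCL in
-- The hypothesis says that `Cᵀ L = 1`.
theorem det_mul_det_eq_one : LinearMap.det C * LinearMap.det L = 1 := by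
  classical
  have h : (LinearMap.toMatrix' C).transpose * LinearMap.toMatrix' L = 1 := by
    ext i j
    rw [Matrix.mul_apply]
    have := hCL (Pi.single i 1) (Pi.single j 1)
    simp only [Matrix.transpose_apply, LinearMap.toMatrix'_apply, Matrix.one_apply]
    simpa [Pi.single_apply, eq_comm] using this
  have h1 := congrArg Matrix.det h
  rwa [Matrix.det_mul, Matrix.det_transpose, LinearMap.det_toMatrix', LinearMap.det_toMatrix',
    Matrix.det_one] at h1

include hCL in
theorem det_right_ne_zero : LinearMap.det L ≠ 0 :=
  right_ne_zero_of_mul_eq_one (det_mul_det_eq_one hCL)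

include hCL in
theorem det_left_ne_zero : LinearMap.det C ≠ 0 :=
  left_ne_zero_of_mul_eq_one (det_mul_det_eq_one hCL)

include hCL in
-- The substitution `u = C t` turns the phase `⟨t, y⟩` into `⟨u, L y⟩` and reduces to the standard
-- Gaussian. The same transform at `y = 0` evaluates the normalizing integral, and the determinants
-- are inverse to each other.
theorem integral_gauss_mul_chr (y : κ → ℝ) :
    ∫ t, (gauss (1 / 2) C t : ℂ) * chr t (-y) =
      ((2 * Real.pi) ^ Fintype.card κ : ℝ) * (gauss (1 / 2) L y / ∫ u, gauss (1 / 2) L u : ℝ) := by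
  have hC := det_left_ne_zero hCL
  have hL := det_right_ne_zero hCL
  set K : ℝ := √(2 * Real.pi) ^ Fintype.card κ with hK
  have hK2 : K * K = (2 * Real.pi) ^ Fintype.card κ := by
    rw [hK, ← mul_pow, Real.mul_self_sqrt (by positivity)]
  have hK0 : 0 < K := by positivity
  have e1 : ∀ t, (gauss (1 / 2) C t : ℂ) * chr t (-y) =
      (fun u => (gauss (1 / 2) LinearMap.id u : ℂ) * chr u (-(L y))) (C t) := fun t => by
    simp only [gauss, chr, LinearMap.id_apply, Pi.neg_apply, mul_neg, Finset.sum_neg_distrib, hCL]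
  have hZ : ((∫ u, gauss (1 / 2) L u : ℝ) : ℂ) = ((|(LinearMap.det L)⁻¹| * K : ℝ) : ℂ) := by
    have h0 := integral_gauss_mul_chr_id (0 : κ → ℝ)
    have hchr : ∀ t : κ → ℝ, chr t (-0) = 1 := fun t => by simp [chr]
    simp only [hchr, mul_one] at h0
    rw [← integral_complex_ofReal]
    have e2 : ∀ u, (gauss (1 / 2) L u : ℂ) =
      (fun u => (gauss (1 / 2) LinearMap.id u : ℂ)) (L u) := fun u => rfl
    simp only [e2]
    rw [integral_comp_linear L hL (f := fun u => (gauss (1 / 2) LinearMap.id u : ℂ))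
      (Complex.continuous_ofReal.comp (continuous_gauss _ _)), h0]
    simp [gauss, hK]
  simp only [e1]
  rw [integral_comp_linear C hC (f := fun u => (gauss (1 / 2) LinearMap.id u : ℂ) * chr u (-(L y)))
    ((Complex.continuous_ofReal.comp (continuous_gauss _ _)).mul (continuous_chr_left _)),
    integral_gauss_mul_chr_id, Complex.ofReal_div, hZ, ← hK]
  have e3 : gauss (1 / 2) LinearMap.id (L y) = gauss (1 / 2) L y := rfl
  have hdet : |(LinearMap.det C)⁻¹| = |LinearMap.det L| := by
    rw [inv_eq_of_mul_eq_one_right (det_mul_det_eq_one hCL)]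
  have hL' : |LinearMap.det L| ≠ 0 := abs_ne_zero.2 hL
  rw [e3, hdet, abs_inv, ← hK2]
  norm_cast
  field_simp

/-! ### Riemann sums -/

/-- Rounding displaces by at most `1`, and `(a + d)² ≥ a²/2 - d²`: halving the exponent makes room
for the displacement, up to a constant. -/
theorem exists_gauss_roundPt_le (L : (κ → ℝ) →ₗ[ℝ] κ → ℝ) :
    ∃ M : ℝ, ∀ s ≥ (1 : ℝ), ∀ a y, gauss (1 / 2) L (roundPt s a y) ≤ M * gauss (1 / 4) L y := by
  have hc : Continuous fun d : κ → ℝ => ∑ j, L d j ^ 2 := by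
    have := L.continuous_of_finiteDimensional
    fun_prop
  obtain ⟨B, hB⟩ := (isCompact_closedBall (0 : κ → ℝ) 1).exists_bound_of_continuousOn hc.continuousOn
  refine ⟨Real.exp (B / 2), fun s hs a y => ?_⟩
  have hd := norm_roundPt_sub_le (zero_lt_one.trans_le hs) a y
  set d := roundPt s a y - y with hdef
  have h1 : ∑ j, L d j ^ 2 ≤ B :=
    (le_abs_self _).trans (hB d (mem_closedBall_zero_iff.2 (hd.trans (inv_le_one_of_one_le₀ hs))))
  have h2 : roundPt s a y = y + d := by rw [hdef]; abel
  rw [gauss, gauss, ← Real.exp_add, Real.exp_le_exp, h2]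
  have h3 : ∀ j ∈ Finset.univ, L y j ^ 2 / 2 - L d j ^ 2 ≤ L (y + d) j ^ 2 := fun j _ => by
    rw [map_add, Pi.add_apply]
    nlinarith [sq_nonneg (L y j + 2 * L d j)]
  have h4 := Finset.sum_le_sum h3
  rw [Finset.sum_sub_distrib, ← Finset.sum_div] at h4
  linarith

theorem integrable_gauss_roundPt {L : (κ → ℝ) →ₗ[ℝ] κ → ℝ} (hL : LinearMap.det L ≠ 0) {s : ℝ}
    (hs : 1 ≤ s) (a : κ → ℝ) : Integrable fun y => gauss (1 / 2) L (roundPt s a y) := by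
  obtain ⟨M, hM⟩ := exists_gauss_roundPt_le L
  refine ((integrable_gauss (a := 1 / 4) (by norm_num) L hL).const_mul M).mono'
    ((continuous_gauss _ _).measurable.comp (measurable_roundPt s a)).aestronglyMeasurable
    (Eventually.of_forall fun y => ?_)
  rw [Real.norm_of_nonneg (gauss_pos _ _ _).le]
  exact hM s hs a y

theorem tendsto_integral_abs_gauss_roundPt_sub {L : (κ → ℝ) →ₗ[ℝ] κ → ℝ}
    (hL : LinearMap.det L ≠ 0) {s : ℕ → ℝ} (hs : Tendsto s atTop atTop) (a : ℕ → κ → ℝ) :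
    Tendsto (fun n => ∫ y, |gauss (1 / 2) L (roundPt (s n) (a n) y) - gauss (1 / 2) L y|) atTop
      (𝓝 0) := by
  obtain ⟨M, hM⟩ := exists_gauss_roundPt_le L
  rw [← integral_zero (κ → ℝ) ℝ (μ := volume)]
  refine tendsto_integral_filter_of_dominated_convergence
    (fun y => M * gauss (1 / 4) L y + gauss (1 / 2) L y) ?_ ?_
    (((integrable_gauss (by norm_num) L hL).const_mul M).add
      (integrable_gauss (by norm_num) L hL)) ?_
  · exact Eventually.of_forall fun n => (((continuous_gauss _ _).measurable.comp
      (measurable_roundPt _ _)).sub (continuous_gauss _ _).measurable).norm.aestronglyMeasurable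
  · filter_upwards [hs.eventually_ge_atTop 1] with n hn
    refine Eventually.of_forall fun y => ?_
    rw [Real.norm_eq_abs, abs_abs]
    refine (abs_sub _ _).trans ?_
    rw [abs_of_pos (gauss_pos _ _ _), abs_of_pos (gauss_pos _ _ _)]
    exact add_le_add_left (hM _ hn _ _) _
  · refine Eventually.of_forall fun y => ?_
    have := (((continuous_gauss (1 / 2) L).tendsto y).comp (tendsto_roundPt hs a y)).sub_const
      (gauss (1 / 2) L y)
    simpa using this.abs

/-- The point `(z - a) / s`. -/
def scalePt (s : ℝ) (a : κ → ℝ) (z : κ → ℤ) (j : κ) : ℝ := (z j - a j) / s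

/-- The discrete Gaussian on `ℤ^κ`. -/
def discreteGauss (L : (κ → ℝ) →ₗ[ℝ] κ → ℝ) (s : ℝ) (a : κ → ℝ) (z : κ → ℤ) : ℝ :=
  gauss (1 / 2) L (scalePt s a z) / ∑' w, gauss (1 / 2) L (scalePt s 0 w)

theorem tendsto_riemann_sum {L : (κ → ℝ) →ₗ[ℝ] κ → ℝ} (hL : LinearMap.det L ≠ 0) {s : ℕ → ℝ}
    (hs : Tendsto s atTop atTop) :
    Tendsto (fun n => (s n)⁻¹ ^ Fintype.card κ * ∑' w, gauss (1 / 2) L (scalePt (s n) 0 w)) atTop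
      (𝓝 (∫ y, gauss (1 / 2) L y)) := by
  have h1 := tendsto_integral_abs_gauss_roundPt_sub hL hs fun _ => 0
  rw [tendsto_iff_norm_sub_tendsto_zero]
  refine tendsto_of_tendsto_of_tendsto_of_le_of_le' tendsto_const_nhds h1
    (Eventually.of_forall fun n => norm_nonneg _) ?_
  filter_upwards [hs.eventually_ge_atTop 1] with n hn
  have hs0 : 0 < s n := by linarith
  have hint := integrable_gauss_roundPt hL hn 0
  have hsum : Summable fun w : κ → ℤ => gauss (1 / 2) L (scalePt (s n) 0 w) :=
    summable_of_integrable_cell hs0 0 (fun w => (gauss_pos _ _ _).le) hint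
  rw [← integral_cell hs0 0 hsum fun w => (gauss_pos _ _ _).le]
  have e : ∫ y, gauss (1 / 2) L (scalePt (s n) 0 (cell (s n) 0 y)) =
    ∫ y, gauss (1 / 2) L (roundPt (s n) 0 y) := rfl
  rw [e, ← integral_sub hint (integrable_gauss (by norm_num) L hL)]
  exact norm_integral_le_integral_norm _

theorem discreteGauss_cell (L : (κ → ℝ) →ₗ[ℝ] κ → ℝ) (s : ℝ) (a y : κ → ℝ) :
    s ^ Fintype.card κ * discreteGauss L s a (cell s a y) = gauss (1 / 2) L (roundPt s a y) /
      (s⁻¹ ^ Fintype.card κ * ∑' w, gauss (1 / 2) L (scalePt s 0 w)) := by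
  have e : gauss (1 / 2) L (scalePt s a (cell s a y)) = gauss (1 / 2) L (roundPt s a y) := rfl
  rw [discreteGauss, e, inv_pow, div_mul_eq_div_div, div_inv_eq_mul]
  ring

/-- The discrete Gaussian is normalized by the sum over the unshifted lattice, so it need not have
mass one and Scheffé's lemma is not used. The error is split instead into that of rounding and that
of the normalizing Riemann sum. -/
theorem tendsto_integral_abs_discreteGauss_sub {L : (κ → ℝ) →ₗ[ℝ] κ → ℝ}
    (hL : LinearMap.det L ≠ 0) {s : ℕ → ℝ} (hs : Tendsto s atTop atTop) (a : ℕ → κ → ℝ) :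
    Tendsto (fun n => ∫ y, |s n ^ Fintype.card κ * discreteGauss L (s n) (a n) (cell (s n) (a n) y) -
      gauss (1 / 2) L y / ∫ u, gauss (1 / 2) L u|) atTop (𝓝 0) := by
  set Z := ∫ u, gauss (1 / 2) L u
  have hZ : 0 < Z := integral_gauss_pos (by norm_num) L hL
  set I : ℕ → ℝ := fun n => (s n)⁻¹ ^ Fintype.card κ * ∑' w, gauss (1 / 2) L (scalePt (s n) 0 w)
  have hI : Tendsto I atTop (𝓝 Z) := tendsto_riemann_sum hL hs
  have h1 := (tendsto_integral_abs_gauss_roundPt_sub hL hs a).mul (hI.inv₀ hZ.ne')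
  have h2 := (((hI.inv₀ hZ.ne').sub_const Z⁻¹).abs).const_mul Z
  rw [sub_self, abs_zero, mul_zero] at h2
  have h3 := h1.add h2
  rw [zero_mul, zero_add] at h3
  refine tendsto_of_tendsto_of_tendsto_of_le_of_le' tendsto_const_nhds h3
    (Eventually.of_forall fun n => integral_nonneg fun y => abs_nonneg _) ?_
  filter_upwards [hs.eventually_ge_atTop 1, hI.eventually (lt_mem_nhds hZ)] with n hn hIn
  have hs0 : 0 < s n := by linarith
  have hg := integrable_gauss (a := 1 / 2) (by norm_num) L hL
  have hr := integrable_gauss_roundPt hL hn (a n)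
  have e : Z * |(I n)⁻¹ - Z⁻¹| = ∫ y, gauss (1 / 2) L y * |(I n)⁻¹ - Z⁻¹| :=
    (integral_mul_const _ _).symm
  have i1 : Integrable fun y =>
      |gauss (1 / 2) L (roundPt (s n) (a n) y) - gauss (1 / 2) L y| * (I n)⁻¹ :=
    (hr.sub hg).abs.mul_const _
  have i2 : Integrable fun y => gauss (1 / 2) L y * |(I n)⁻¹ - Z⁻¹| := hg.mul_const _
  rw [e, ← integral_mul_const, ← integral_add i1 i2]
  refine integral_mono_of_nonneg (Eventually.of_forall fun y => abs_nonneg _) (i1.add i2)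
    (Eventually.of_forall fun y => ?_)
  dsimp only
  rw [discreteGauss_cell L]
  set p := gauss (1 / 2) L (roundPt (s n) (a n) y)
  have hq := gauss_pos (1 / 2) L y
  set q := gauss (1 / 2) L y
  change |p / I n - q / Z| ≤ |p - q| * (I n)⁻¹ + q * |(I n)⁻¹ - Z⁻¹|
  have e3 : p / I n - q / Z = (p - q) * (I n)⁻¹ + q * ((I n)⁻¹ - Z⁻¹) := by
    rw [div_eq_mul_inv, div_eq_mul_inv]; ring
  rw [e3]
  refine (abs_add_le _ _).trans ?_
  rw [abs_mul, abs_mul, abs_of_pos hq, abs_of_pos (inv_pos.2 hIn)]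

/-- A local limit theorem at every point implies convergence in total variation. -/
theorem tendsto_tsum_abs_sub_discreteGauss {L : (κ → ℝ) →ₗ[ℝ] κ → ℝ}
    (hL : LinearMap.det L ≠ 0) {s : ℕ → ℝ} (hs : Tendsto s atTop atTop) (a : ℕ → κ → ℝ)
    {b : ℕ → (κ → ℤ) → ℝ} (hb0 : ∀ n z, 0 ≤ b n z) (hb : ∀ n, Summable (b n)) {q : ℝ} (hq : 0 ≤ q)
    (hsum : Tendsto (fun n => ∑' z, b n z) atTop (𝓝 q))
    (hlim : ∀ y, Tendsto (fun n => s n ^ Fintype.card κ * b n (cell (s n) (a n) y)) atTop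
      (𝓝 (q * (gauss (1 / 2) L y / ∫ u, gauss (1 / 2) L u)))) :
    Tendsto (fun n => ∑' z, ENNReal.ofReal |b n z - q * discreteGauss L (s n) (a n) z|) atTop
      (𝓝 0) := by
  set Z := ∫ u, gauss (1 / 2) L u
  have hZ : 0 < Z := integral_gauss_pos (by norm_num) L hL
  have hg := integrable_gauss (a := 1 / 2) (by norm_num) L hL
  have hgq : Integrable fun y => q * (gauss (1 / 2) L y / Z) := (hg.div_const Z).const_mul q
  have i1 : ∀ᶠ n in atTop, Integrable fun y => s n ^ Fintype.card κ * b n (cell (s n) (a n) y) := by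
    filter_upwards [hs.eventually_ge_atTop 1] with n hn
    exact (integrable_cell (by linarith) (a n) (hb n)).const_mul _
  have h1 := tendsto_integral_abs_sub (m := volume)
    (f := fun n y => s n ^ Fintype.card κ * b n (cell (s n) (a n) y))
    (g := fun y => q * (gauss (1 / 2) L y / Z)) (by
      filter_upwards [hs.eventually_ge_atTop 1] with n hn y
      have : 0 ≤ s n := by linarith
      exact mul_nonneg (pow_nonneg this _) (hb0 n _)) i1 hgq hlim (by
      have e : ∫ y, q * (gauss (1 / 2) L y / Z) = q := by
        rw [integral_const_mul, integral_div, div_self hZ.ne', mul_one]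
      rw [e]
      refine hsum.congr' ?_
      filter_upwards [hs.eventually_ge_atTop 1] with n hn
      have hs0 : 0 < s n := by linarith
      rw [integral_const_mul, integral_cell hs0 (a n) (hb n) (hb0 n), ← mul_assoc, ← mul_pow,
        mul_inv_cancel₀ hs0.ne', one_pow, one_mul])
  have h2 := (tendsto_integral_abs_discreteGauss_sub hL hs a).const_mul q
  have h3 := h1.add h2
  rw [mul_zero, add_zero] at h3
  have h4 := (ENNReal.continuous_ofReal.tendsto 0).comp h3
  rw [ENNReal.ofReal_zero] at h4
  refine tendsto_of_tendsto_of_tendsto_of_le_of_le' tendsto_const_nhds h4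
    (Eventually.of_forall fun n => zero_le) ?_
  filter_upwards [hs.eventually_ge_atTop 1, i1] with n hn hi1
  have hs0 : 0 < s n := by linarith
  have hsd : 0 < s n ^ Fintype.card κ := pow_pos hs0 _
  have i2 : Integrable fun y =>
      s n ^ Fintype.card κ * discreteGauss L (s n) (a n) (cell (s n) (a n) y) := by
    simp only [discreteGauss_cell L]
    exact (integrable_gauss_roundPt hL hn (a n)).div_const _
  have j1 : Integrable fun y => |s n ^ Fintype.card κ * b n (cell (s n) (a n) y) -
      q * (gauss (1 / 2) L y / Z)| := (hi1.sub hgq).abs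
  have j2 : Integrable fun y => q * |s n ^ Fintype.card κ *
      discreteGauss L (s n) (a n) (cell (s n) (a n) y) - gauss (1 / 2) L y / Z| :=
    ((i2.sub (hg.div_const Z)).abs).const_mul q
  have j3 : Integrable fun y => |s n ^ Fintype.card κ * b n (cell (s n) (a n) y) -
      q * (gauss (1 / 2) L y / Z)| + q * |s n ^ Fintype.card κ *
        discreteGauss L (s n) (a n) (cell (s n) (a n) y) - gauss (1 / 2) L y / Z| := j1.add j2
  -- The cell volume cancels the density factor, so the lattice `ℓ¹` distance is the `L¹` distance
  -- of the two step functions.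
  have e1 : ∑' z, ENNReal.ofReal |b n z - q * discreteGauss L (s n) (a n) z| =
      ∫⁻ y, ENNReal.ofReal (s n ^ Fintype.card κ * |b n (cell (s n) (a n) y) -
        q * discreteGauss L (s n) (a n) (cell (s n) (a n) y)|) := by
    rw [lintegral_cell hs0 (a n) fun z => ENNReal.ofReal (s n ^ Fintype.card κ *
      |b n z - q * discreteGauss L (s n) (a n) z|)]
    simp only [ENNReal.ofReal_mul hsd.le]
    rw [ENNReal.tsum_mul_left, ← mul_assoc, ENNReal.ofReal_pow hs0.le, ← mul_pow,
      ← ENNReal.ofReal_mul (by positivity), inv_mul_cancel₀ hs0.ne', ENNReal.ofReal_one, one_pow,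
      one_mul]
  rw [e1]
  change _ ≤ ENNReal.ofReal ((∫ y, |s n ^ Fintype.card κ * b n (cell (s n) (a n) y) -
    q * (gauss (1 / 2) L y / Z)|) + q * ∫ y, |s n ^ Fintype.card κ *
      discreteGauss L (s n) (a n) (cell (s n) (a n) y) - gauss (1 / 2) L y / Z|)
  rw [← integral_const_mul, ← integral_add j1 j2, ofReal_integral_eq_lintegral_ofReal j3
    (Eventually.of_forall fun y => add_nonneg (abs_nonneg _) (mul_nonneg hq (abs_nonneg _)))]
  refine lintegral_mono fun y => ENNReal.ofReal_le_ofReal ?_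
  set u := b n (cell (s n) (a n) y)
  set w := discreteGauss L (s n) (a n) (cell (s n) (a n) y)
  set g := gauss (1 / 2) L y / Z
  set S := s n ^ Fintype.card κ
  have e2 : S * |u - q * w| = |S * u - q * g - q * (S * w - g)| := by
    rw [← abs_of_pos hsd, ← abs_mul, abs_of_pos hsd]
    congr 1
    ring
  rw [e2]
  refine (abs_sub _ _).trans ?_
  rw [abs_mul q, abs_of_nonneg hq]

end GaussianFunction

/-! ### From characteristic functions to total variation -/

section LocalLimit

variable {κ : Type*}

theorem roundPt_smul {s : ℝ} (hs : s ≠ 0) (w y : κ → ℝ) (j : κ) :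
    cell s (fun j => s * w j) y j / s - w j = roundPt s (fun j => s * w j) y j := by
  rw [roundPt, sub_div, mul_div_cancel_left₀ _ hs]

variable [Fintype κ]

theorem continuous_tsum_mul_chr {b : (κ → ℤ) → ℂ} (hb : Summable b) (u : (κ → ℤ) → κ → ℝ) :
    Continuous fun t => ∑' z, b z * chr t (u z) :=
  continuous_tsum (fun z => continuous_const.mul (continuous_chr_left _)) hb.norm fun z t => by
    rw [norm_mul, norm_chr, mul_one]

/-- Convergence and Gaussian domination of the characteristic functions imply the local limit
theorem. -/
theorem tendsto_mul_cell {C L : (κ → ℝ) →ₗ[ℝ] κ → ℝ}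
    (hCL : ∀ t y, ∑ j, C t j * L y j = ∑ j, t j * y j) {s : ℕ → ℝ} (hs : Tendsto s atTop atTop)
    (w : ℕ → κ → ℝ) {b : ℕ → (κ → ℤ) → ℝ} (hb : ∀ n, Summable (b n)) {q c : ℝ} (hc : 0 < c)
    (hφ : ∀ t, Tendsto (fun n => ∑' z, (b n z : ℂ) * chr t fun j => z j / s n - w n j) atTop
      (𝓝 (q * gauss (1 / 2) C t)))
    (hdom : ∀ᶠ n in atTop, ∀ t ∈ cube κ (s n),
      ‖∑' z, (b n z : ℂ) * chr t fun j => z j / s n - w n j‖ ≤ gauss c LinearMap.id t)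
    (y : κ → ℝ) :
    Tendsto (fun n => s n ^ Fintype.card κ * b n (cell (s n) (fun j => s n * w n j) y)) atTop
      (𝓝 (q * (gauss (1 / 2) L y / ∫ u, gauss (1 / 2) L u))) := by
  set φ : ℕ → (κ → ℝ) → ℂ := fun n t => ∑' z, (b n z : ℂ) * chr t fun j => z j / s n - w n j
  have hbC : ∀ n, Summable fun z => (b n z : ℂ) := fun n => 
    Complex.summable_ofReal.2 (hb n)
  set r : ℕ → κ → ℝ := fun n => roundPt (s n) (fun j => s n * w n j) y
  have hmeas : ∀ s : ℝ, MeasurableSet (cube κ s) := fun s =>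
    MeasurableSet.univ_pi fun _ => measurableSet_Ioc
  -- Inversion integrals over growing cubes are extended by zero to the whole space, where one
  -- Gaussian dominates them all.
  have key : Tendsto (fun n => ∫ t, (cube κ (s n)).indicator (fun t => φ n t * chr t (-(r n))) t)
      atTop (𝓝 (∫ t, (q * gauss (1 / 2) C t) * chr t (-y))) := by
    refine tendsto_integral_filter_of_dominated_convergence (gauss c LinearMap.id) ?_ ?_
      (integrable_gauss_id hc) ?_
    · exact Eventually.of_forall fun n =>
        (((continuous_tsum_mul_chr (hbC n) _).mul
          (continuous_chr_left _)).aestronglyMeasurable.indicator (hmeas _))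
    · filter_upwards [hdom] with n hn
      refine Eventually.of_forall fun t => ?_
      by_cases ht : t ∈ cube κ (s n)
      · rw [Set.indicator_of_mem ht, norm_mul, norm_chr, mul_one]
        exact hn t ht
      · rw [Set.indicator_of_notMem ht, norm_zero]
        exact (gauss_pos _ _ _).le
    · refine Eventually.of_forall fun t => ?_
      have h1 : Tendsto (fun n => chr t (-(r n))) atTop (𝓝 (chr t (-y))) :=
        (((continuous_chr_right t).comp continuous_neg).tendsto y).comp (tendsto_roundPt hs _ y)
      refine ((hφ t).mul h1).congr' ?_
      filter_upwards [hs.eventually_gt_atTop ‖t‖] with n hn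
      rw [Set.indicator_of_mem]
      intro j _
      have h2 := abs_lt.1 ((norm_le_pi_norm t j).trans_lt hn)
      have h3 : s n ≤ Real.pi * s n := by
        nlinarith [Real.pi_gt_three, norm_nonneg t]
      exact ⟨by linarith, by linarith⟩
  have e1 : ∫ t, (q * gauss (1 / 2) C t : ℂ) * chr t (-y) =
      ((2 * Real.pi) ^ Fintype.card κ : ℝ) *
        (q * (gauss (1 / 2) L y / ∫ u, gauss (1 / 2) L u) : ℝ) := by
    simp only [mul_assoc]
    rw [integral_const_mul, integral_gauss_mul_chr hCL]
    push_cast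
    ring
  have hp : (2 * Real.pi) ^ Fintype.card κ ≠ 0 := by positivity
  rw [e1, ← Complex.ofReal_mul] at key
  have h4 := ((Complex.continuous_re.tendsto _).comp key).const_mul (((2 * Real.pi) ^ Fintype.card κ)⁻¹)
  rw [Complex.ofReal_re, inv_mul_cancel_left₀ hp] at h4
  refine h4.congr' ?_
  filter_upwards [hs.eventually_gt_atTop 0] with n hn
  have h5 := integral_tsum_mul_chr hn (hbC n) (w n) (cell (s n) (fun j => s n * w n j) y)
  simp only [roundPt_smul hn.ne'] at h5
  rw [Function.comp_apply, integral_indicator (hmeas _)]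
  have h6 : ∫ t in cube κ (s n), φ n t * chr t (-(r n)) =
    ((2 * Real.pi * s n : ℝ) : ℂ) ^ Fintype.card κ *
      (b n (cell (s n) (fun j => s n * w n j) y) : ℂ) := h5
  rw [h6, ← Complex.ofReal_pow, ← Complex.ofReal_mul, Complex.ofReal_re,
    mul_pow _ (s n), mul_assoc,
    inv_mul_cancel_left₀ hp]

theorem tendsto_tsum_of_tendsto_chr {C L : (κ → ℝ) →ₗ[ℝ] κ → ℝ}
    (hCL : ∀ t y, ∑ j, C t j * L y j = ∑ j, t j * y j) {s : ℕ → ℝ} (hs : Tendsto s atTop atTop)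
    (w : ℕ → κ → ℝ) {b : ℕ → (κ → ℤ) → ℝ} (hb0 : ∀ n z, 0 ≤ b n z) (hb : ∀ n, Summable (b n))
    {q c : ℝ} (hq : 0 ≤ q) (hc : 0 < c)
    (hφ : ∀ t, Tendsto (fun n => ∑' z, (b n z : ℂ) * chr t fun j => z j / s n - w n j) atTop
      (𝓝 (q * gauss (1 / 2) C t)))
    (hdom : ∀ᶠ n in atTop, ∀ t ∈ cube κ (s n),
      ‖∑' z, (b n z : ℂ) * chr t fun j => z j / s n - w n j‖ ≤ gauss c LinearMap.id t) :
    Tendsto (fun n => ∑' z, ENNReal.ofReal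
      |b n z - q * discreteGauss L (s n) (fun j => s n * w n j) z|) atTop (𝓝 0) := by
  refine tendsto_tsum_abs_sub_discreteGauss (det_right_ne_zero hCL) hs _ hb0 hb hq ?_
    (tendsto_mul_cell hCL hs w hb hc hφ hdom)
  -- At frequency `0` the characteristic functions are the total masses, whose convergence is what
  -- Scheffé's lemma needs.
  have h := (Complex.continuous_re.tendsto _).comp (hφ 0)
  simp only [chr, gauss, map_zero, Pi.zero_apply, zero_mul, Finset.sum_const_zero,
    Complex.ofReal_zero, Complex.exp_zero, mul_one, ne_eq, OfNat.ofNat_ne_zero, not_false_eq_true,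
    zero_pow, mul_zero, Real.exp_zero, Complex.ofReal_one, Complex.ofReal_re] at h
  refine h.congr fun n => ?_
  rw [Function.comp_apply, ← Complex.ofReal_tsum, Complex.ofReal_re]

end LocalLimit

/-! ### Gaussian densities in coordinates -/

section PosDef

variable {κ : Type*} [Fintype κ] {E : Type*} [NormedAddCommGroup E] [InnerProductSpace ℝ E]
  [FiniteDimensional ℝ E] {Sig : E →ₗ[ℝ] E}

theorem IsPosDef.isUnit (h : IsPosDef Sig) : IsUnit Sig := by
  rw [LinearMap.isUnit_iff_ker_eq_bot, LinearMap.ker_eq_bot']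
  intro v hv
  by_contra hne
  have := h.2 v hne
  rw [hv, inner_zero_right] at this
  exact lt_irrefl _ this

theorem IsPosDef.apply_inverse (h : IsPosDef Sig) (v : E) : Sig (Ring.inverse Sig v) = v := by
  rw [← Module.End.mul_apply, Ring.mul_inverse_cancel _ h.isUnit, Module.End.one_apply]

theorem IsPosDef.exists_eigenbasis (h : IsPosDef Sig) (b : Module.Basis κ ℝ E) :
    ∃ (e : OrthonormalBasis κ ℝ E) (a : κ → ℝ), (∀ i, 0 < a i) ∧ ∀ i, Sig (e i) = a i • e i := by
  have hn : Module.finrank ℝ E = Fintype.card κ := Module.finrank_eq_card_basis b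
  let σ : κ ≃ Fin (Fintype.card κ) := Fintype.equivFin κ
  have he : ∀ i, Sig ((h.1.eigenvectorBasis hn).reindex σ.symm i) =
      h.1.eigenvalues hn (σ i) • (h.1.eigenvectorBasis hn).reindex σ.symm i := fun i => by
    rw [OrthonormalBasis.reindex_apply, Equiv.symm_symm]
    exact h.1.apply_eigenvectorBasis hn (σ i)
  refine ⟨(h.1.eigenvectorBasis hn).reindex σ.symm, fun i => h.1.eigenvalues hn (σ i), fun i => ?_, he⟩
  have h1 := h.2 _ (((h.1.eigenvectorBasis hn).reindex σ.symm).orthonormal.ne_zero i)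
  rw [he, inner_smul_right, real_inner_self_eq_norm_sq, OrthonormalBasis.norm_eq_one, one_pow,
    mul_one] at h1
  exact h1

theorem IsPosDef.det_pos (h : IsPosDef Sig) : 0 < LinearMap.det Sig := by
  classical
  obtain ⟨e, a, ha, he⟩ := h.exists_eigenbasis (stdOrthonormalBasis ℝ E).toBasis
  have : LinearMap.toMatrix e.toBasis e.toBasis Sig = Matrix.diagonal a := by
    ext i j
    rw [LinearMap.toMatrix_apply, OrthonormalBasis.coe_toBasis, he, map_smul, Finsupp.smul_apply,
      ← e.coe_toBasis, Module.Basis.repr_self, Matrix.diagonal_apply, Finsupp.single_apply]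
    by_cases hij : i = j
    · simp [hij]
    · simp [hij, Ne.symm hij]
  rw [← LinearMap.det_toMatrix e.toBasis, this, Matrix.det_diagonal]
  exact Finset.prod_pos fun i _ => ha i

/-- A positive definite operator and its inverse, written as sums of squares in coordinates. -/
theorem IsPosDef.exists_coordinates (h : IsPosDef Sig) (b : Module.Basis κ ℝ E) :
    ∃ (T : (κ → ℝ) → E) (C L : (κ → ℝ) →ₗ[ℝ] κ → ℝ),
      (∀ t (y : κ → ℝ), ⟪T t, ∑ j, y j • b j⟫ = ∑ j, t j * y j) ∧
      (∀ t y, ∑ j, C t j * L y j = ∑ j, t j * y j) ∧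
      (∀ t, ∑ j, C t j ^ 2 = ⟪T t, Sig (T t)⟫) ∧
      ∀ y, ∑ j, L y j ^ 2 = ⟪∑ j, y j • b j, Ring.inverse Sig (∑ j, y j • b j)⟫ := by
  obtain ⟨e, a, ha, he⟩ := h.exists_eigenbasis b
  -- `T t` is the vector whose inner products with the basis `b` are the `t j`. In an eigenbasis,
  -- `C` and `L` below are the square roots of `Sig` and of its inverse, which makes them
  -- contragredient.
  let T : (κ → ℝ) → E := fun t => ∑ i, (∑ j, t j * b.repr (e i) j) • e i
  have hTe : ∀ t i, ⟪T t, e i⟫ = ∑ j, t j * b.repr (e i) j := fun t i => by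
    exact e.orthonormal.inner_left_fintype _ i
  let C : (κ → ℝ) →ₗ[ℝ] κ → ℝ :=
    { toFun := fun t i => √(a i) * ∑ j, t j * b.repr (e i) j
      map_add' := fun t t' => by
        funext i
        simp only [Pi.add_apply, add_mul, Finset.sum_add_distrib, mul_add]
      map_smul' := fun x t => by
        funext i
        simp only [Pi.smul_apply, smul_eq_mul, RingHom.id_apply, mul_assoc]
        rw [← Finset.mul_sum, mul_left_comm] }
  let L : (κ → ℝ) →ₗ[ℝ] κ → ℝ :=
    { toFun := fun y i => (√(a i))⁻¹ * ⟪∑ j, y j • b j, e i⟫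
      map_add' := fun t t' => by
        funext i
        simp only [Pi.add_apply, add_smul, Finset.sum_add_distrib, inner_add_left, mul_add]
      map_smul' := fun x t => by
        funext i
        simp only [Pi.smul_apply, smul_eq_mul, RingHom.id_apply, mul_smul, ← Finset.smul_sum,
          real_inner_smul_left, mul_left_comm x] }
  have hT : ∀ t (y : κ → ℝ), ⟪T t, ∑ j, y j • b j⟫ = ∑ j, t j * y j := by
    intro t y
    have h1 : ∀ v, ⟪T t, v⟫ = ∑ j, t j * b.repr v j := by
      intro v
      have h2 : innerₗ E (T t) = ∑ j, t j • b.coord j :=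
        e.toBasis.ext fun i => by
          rw [e.coe_toBasis, innerₗ_apply_apply, hTe, LinearMap.sum_apply]
          rfl
      rw [← innerₗ_apply_apply, h2, LinearMap.sum_apply]
      rfl
    rw [h1, b.repr_sum_self]
  refine ⟨T, C, L, hT, fun t y => ?_, fun t => ?_, fun y => ?_⟩
  · refine Eq.trans ?_ (hT t y)
    rw [← e.sum_inner_mul_inner]
    refine Finset.sum_congr rfl fun i _ => ?_
    have := (Real.sqrt_pos.2 (ha i)).ne'
    rw [real_inner_comm _ (e i)]
    change (√(a i) * _) * ((√(a i))⁻¹ * _) = _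
    rw [← hTe]
    rw [mul_mul_mul_comm, mul_inv_cancel₀ this, one_mul]
  · rw [← e.sum_inner_mul_inner]
    refine Finset.sum_congr rfl fun i _ => ?_
    rw [← h.1, he, real_inner_smul_left, real_inner_comm, real_inner_comm (T t)]
    change (√(a i) * _) ^ 2 = _
    rw [← hTe]
    rw [mul_pow, Real.sq_sqrt (ha i).le]
    ring
  · rw [← e.sum_inner_mul_inner]
    refine Finset.sum_congr rfl fun i _ => ?_
    have h2 : ⟪e i, Ring.inverse Sig (∑ j, y j • b j)⟫ = (a i)⁻¹ * ⟪∑ j, y j • b j, e i⟫ := by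
      rw [eq_inv_mul_iff_mul_eq₀ (ha i).ne', ← real_inner_smul_left, ← he, h.1, h.apply_inverse,
        real_inner_comm]
    rw [h2]
    change ((√(a i))⁻¹ * _) ^ 2 = _
    rw [mul_pow, inv_pow, Real.sq_sqrt (ha i).le]
    ring

/-- The value of `K` is irrelevant: it cancels in the normalized discrete Gaussian, provided it is
nonzero. -/
theorem gaussDensity_smul (h : IsPosDef Sig) {a : ℝ} (ha : 0 < a) :
    ∃ K : ℝ, K ≠ 0 ∧ ∀ v, gaussDensity (a • Sig) v =
      K * Real.exp (-(1 / 2) * (a⁻¹ * ⟪v, Ring.inverse Sig v⟫)) := by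
  refine ⟨1 / ((2 * Real.pi) ^ ((Module.finrank ℝ E : ℝ) / 2) * √(LinearMap.det (a • Sig))), ?_,
    fun v => ?_⟩
  · have : 0 < LinearMap.det (a • Sig) := by
      rw [LinearMap.det_smul]
      exact mul_pos (pow_pos ha _) h.det_pos
    positivity
  · have : Ring.inverse (a • Sig) = a⁻¹ • Ring.inverse Sig := by
      have hu : IsUnit (a • Sig) :=
        (isUnit_smul_iff (Units.mk0 a ha.ne') Sig).2 h.isUnit
      rw [← mul_one (Ring.inverse (a • Sig)), Ring.inverse_mul_eq_iff_eq_mul _ _ _ hu, smul_mul_smul_comm,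
        mul_inv_cancel₀ ha.ne', Ring.mul_inverse_cancel _ h.isUnit, one_smul]
    rw [gaussDensity, this, LinearMap.smul_apply, inner_smul_right]

end PosDef

namespace LatticeFrame

/-! ### The local limit theorem -/

variable {Γ : Type*} [Group Γ] {κ : Type*} [Fintype κ] [DecidableEq κ]
  {E : Type*} [NormedAddCommGroup E] [InnerProductSpace ℝ E] (D : LatticeFrame Γ κ E) {μ : PMF Γ}

/-- The element `z x` of `Γ`, for `z ∈ ℤ^κ = Λ` and `x ∈ Δ`. -/
def pt (x : D.Δ) (z : κ → ℤ) : Γ := (D.coord.symm z).toMul * x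

theorem lat_pt (x : D.Δ) (z : κ → ℤ) : D.lat (D.pt x z) = (D.coord.symm z).toMul := D.lat_mul_coe _ _

theorem rep_pt (x : D.Δ) (z : κ → ℤ) : D.rep (D.pt x z) = x := D.rep_mul_coe _ _

theorem Phi_pt (x : D.Δ) (z : κ → ℤ) : D.Phi (D.pt x z) = D.ofInt z := by
  rw [Phi, lat_pt, emb, ofMul_toMul, AddEquiv.apply_symm_apply]

/-- The decomposition `Γ = ℤ^κ × Δ`. -/
def ptEquiv : D.Δ × (κ → ℤ) ≃ Γ where
  toFun p := D.pt p.1 p.2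
  invFun γ := (D.rep γ, D.coord (Additive.ofMul (D.lat γ)))
  left_inv p := by
    dsimp only
    rw [rep_pt, lat_pt, ofMul_toMul, AddEquiv.apply_symm_apply]
  right_inv γ := by
    change ((D.coord.symm (D.coord (Additive.ofMul (D.lat γ)))).toMul : Γ) * D.rep γ = γ
    rw [AddEquiv.symm_apply_apply, toMul_ofMul, lat_mul_rep]

theorem pt_injective (x : D.Δ) : Function.Injective (D.pt x) := fun _ _ h =>
  (Prod.ext_iff.1 (D.ptEquiv.injective (a₁ := (x, _)) (a₂ := (x, _)) h)).2

theorem vec_one_left (γ : Γ) : D.vec ⟨1, D.one_mem⟩ γ = D.Phi γ := by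
  rw [vec, cocycle, Phi, one_mul]

theorem act_one_left (γ : Γ) : D.act ⟨1, D.one_mem⟩ γ = D.rep γ := by
  rw [act, one_mul]

theorem tvDist_eq (f g : Γ → ℝ) :
    tvDist f g = (∑ x, ∑' z, ENNReal.ofReal |f (D.pt x z) - g (D.pt x z)|) / 2 := by
  rw [tvDist, ← D.ptEquiv.tsum_eq, ENNReal.tsum_prod', tsum_fintype]
  rfl

/-- The powers of the twisted transfer operators compute the characteristic functions. -/
theorem scaledTwist_pow_single (T : E) (t : κ → ℝ) [DecidableEq D.Δ]
    (hT : ∀ y : κ → ℝ, ⟪T, ∑ j, y j • D.basis j⟫ =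
    ∑ j, t j * y j) (n : ℕ) (x : D.Δ) :
    (D.scaledTwist μ T n ^ n) (Pi.single x 1) ⟨1, D.one_mem⟩ =
      ∑' z, ((convPow μ n (D.pt x z)).toReal : ℂ) *
        chr t fun j => z j / √(n : ℝ) - √(n : ℝ) * D.basis.repr (D.drift μ) j := by
  have hs : (n : ℝ) * (√(n : ℝ))⁻¹ = √(n : ℝ) := by rw [← div_eq_mul_inv, Real.div_sqrt]
  have hζ : ⟪T, D.drift μ⟫ = ∑ j, t j * D.basis.repr (D.drift μ) j := by
    rw [← hT, D.basis.sum_repr]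
  -- Starting at the representative `1`, the indicator of `x` restricts the sum over `Γ` to the
  -- fibre `Λ x`.
  rw [scaledTwist, ← twist_convPow, twist_apply, ev, ← (D.pt_injective x).tsum_eq]
  · refine tsum_congr fun z => ?_
    rw [act_one_left, rep_pt, Pi.single_eq_same, mul_one, Complex.real_smul, phase, chr, vec_one_left,
      Phi_pt, ofInt, real_inner_smul_left, hT, hζ, ← mul_assoc, hs]
    congr 4
    simp only [mul_sub, Finset.sum_sub_distrib, Finset.mul_sum]
    congr 1
    · exact Finset.sum_congr rfl fun j _ => by rw [div_eq_inv_mul]; ring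
    · exact Finset.sum_congr rfl fun j _ => by ring
  · intro γ hγ
    have h : D.rep γ = x := by
      by_contra hne
      refine hγ ?_
      simp only [act_one_left, Pi.single_eq_of_ne hne, mul_zero, smul_zero]
    subst h
    exact ⟨D.coord (Additive.ofMul (D.lat γ)), D.ptEquiv.apply_symm_apply γ⟩

theorem gaussDensity_ofInt_sub [FiniteDimensional ℝ E] {Sig : E →ₗ[ℝ] E} (hSig : IsPosDef Sig)
    {L : (κ → ℝ) →ₗ[ℝ] κ → ℝ} (hL : ∀ y : κ → ℝ, ∑ j, L y j ^ 2 =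
      ⟪∑ j, y j • D.basis j, Ring.inverse Sig (∑ j, y j • D.basis j)⟫) {n : ℕ} (hn : n ≠ 0) :
    ∃ K : ℝ, K ≠ 0 ∧ ∀ (z : κ → ℤ) (ζ : E), gaussDensity ((n : ℝ) • Sig) (D.ofInt z - (n : ℝ) • ζ) =
      K * gauss (1 / 2) L (scalePt √(n : ℝ) (fun j => √(n : ℝ) * (√(n : ℝ) * D.basis.repr ζ j)) z) := by
  have hn0 : (0 : ℝ) < n := by exact_mod_cast Nat.pos_of_ne_zero hn
  obtain ⟨K, hK, h⟩ := gaussDensity_smul hSig hn0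
  refine ⟨K, hK, fun z ζ => ?_⟩
  set y : κ → ℝ := scalePt √(n : ℝ) (fun j => √(n : ℝ) * (√(n : ℝ) * D.basis.repr ζ j)) z with hy
  have hs : √(n : ℝ) ≠ 0 := (Real.sqrt_pos.2 hn0).ne'
  have hv : D.ofInt z - (n : ℝ) • ζ = √(n : ℝ) • ∑ j, y j • D.basis j := by
    conv_lhs => rw [← D.basis.sum_repr ζ]
    rw [ofInt, Finset.smul_sum, Finset.smul_sum, ← Finset.sum_sub_distrib]
    refine Finset.sum_congr rfl fun j _ => ?_
    rw [smul_smul, smul_smul, ← sub_smul, hy, scalePt, mul_div_cancel₀ _ hs, ← mul_assoc,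
      Real.mul_self_sqrt hn0.le]
  rw [h, hv, map_smul, real_inner_smul_left, real_inner_smul_right, ← hL, gauss, ← mul_assoc √(n : ℝ),
    Real.mul_self_sqrt hn0.le, inv_mul_cancel_left₀ hn0.ne']

/-- `K` does not depend on the shift, so the same constant occurs in the normalizing sum, where the
shift is zero, and cancels. -/
theorem gaussian_pt [FiniteDimensional ℝ E] {Sig : E →ₗ[ℝ] E} (hSig : IsPosDef Sig)
    {L : (κ → ℝ) →ₗ[ℝ] κ → ℝ} (hL : ∀ y : κ → ℝ, ∑ j, L y j ^ 2 =
      ⟪∑ j, y j • D.basis j, Ring.inverse Sig (∑ j, y j • D.basis j)⟫) {n : ℕ} (hn : n ≠ 0) (ζ : E)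
    (x : D.Δ) (z : κ → ℤ) :
    D.gaussian n Sig ζ (D.pt x z) = 1 / Fintype.card D.Δ *
      discreteGauss L √(n : ℝ) (fun j => √(n : ℝ) * (√(n : ℝ) * D.basis.repr ζ j)) z := by
  obtain ⟨K, hK, h⟩ := D.gaussDensity_ofInt_sub hSig hL hn
  have h0 : ∀ z, gaussDensity ((n : ℝ) • Sig) (D.ofInt z) = K * gauss (1 / 2) L (scalePt √(n : ℝ) 0 z) :=
    fun z => by
      have := h z 0
      simp only [smul_zero, sub_zero, map_zero, Finsupp.zero_apply, mul_zero] at this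
      exact this
  let σ : D.Λ ≃ (κ → ℤ) := Additive.ofMul.trans D.coord.toEquiv
  have e : ∑' l, gaussDensity ((n : ℝ) • Sig) (D.emb l) =
      K * ∑' w, gauss (1 / 2) L (scalePt √(n : ℝ) 0 w) := by
    rw [← tsum_mul_left, ← σ.tsum_eq]
    exact tsum_congr fun l => h0 _
  rw [gaussian, Phi_pt, h, e, discreteGauss, mul_assoc, one_div_mul_eq_div (K * _),
    mul_div_mul_left _ _ hK]

/-- Each fibre `Λ x` carries asymptotic mass `1 / #Δ`. The lattice theorem is applied fibre by
fibre, and there are only finitely many fibres. -/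
theorem tendsto_tvDist [FiniteDimensional ℝ E] (hm : D.HasMoment μ) (hμ : IsNondegenerate μ)
    (hap : IsAperiodic μ) {f : E →ₗ[ℝ] D.Δ → ℝ} (hf : D.IsPotential μ f) {Sig : E →ₗ[ℝ] E}
    (hSig : IsPosDef Sig) (hcov : ∀ v w, ⟪v, Sig w⟫ = D.cov μ f v w) :
    Tendsto (fun n : ℕ => tvDist (fun γ => (convPow μ n γ).toReal) (D.gaussian n Sig (D.drift μ)))
      atTop (𝓝 0) := by
  classical
  obtain ⟨T, C, L, hT, hCL, hC, hL⟩ := hSig.exists_coordinates D.basis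
  have hs : Tendsto (fun n : ℕ => √(n : ℝ)) atTop atTop :=
    Real.tendsto_sqrt_atTop.comp tendsto_natCast_atTop_atTop
  obtain ⟨n₀, c, hc, hdom⟩ := exists_norm_scaledTwist_pow_le (D := D) hμ hap
  have hTb : ∀ t j, ⟪T t, D.basis j⟫ = t j := fun t j => by
    simpa [Pi.single_apply] using hT t (Pi.single j 1)
  have key : ∀ x : D.Δ, Tendsto (fun n : ℕ => ∑' z, ENNReal.ofReal
      |(convPow μ n (D.pt x z)).toReal - D.gaussian n Sig (D.drift μ) (D.pt x z)|) atTop (𝓝 0) := by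
    intro x
    have h := tendsto_tsum_of_tendsto_chr hCL hs (fun n j => √(n : ℝ) * D.basis.repr (D.drift μ) j)
      (b := fun n z => (convPow μ n (D.pt x z)).toReal) (q := 1 / Fintype.card D.Δ) (c := c)
      (fun n z => ENNReal.toReal_nonneg)
      (fun n => (hasSum_toReal (convPow μ n)).summable.comp_injective (D.pt_injective x))
      (by positivity) hc (fun t => ?_) ?_
    · refine h.congr' ?_
      filter_upwards [eventually_ne_atTop 0] with n hn
      simp only [D.gaussian_pt hSig hL hn]
    · have h1 := tendsto_scaledTwist hm hμ hap hf (T t) (Pi.single x 1) ⟨1, D.one_mem⟩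
      simp only [D.scaledTwist_pow_single (T t) t (hT t)] at h1
      have e1 : D.avg (Pi.single x (1 : ℂ)) * Complex.exp (-(D.cov μ f (T t) (T t) / 2)) =
          ((1 / Fintype.card D.Δ : ℝ) : ℂ) * (gauss (1 / 2) C t : ℂ) := by
        rw [avg, Finset.sum_pi_single', if_pos (Finset.mem_univ x), gauss, hC, hcov,
          Complex.real_smul, mul_one, Complex.ofReal_exp]
        congr 2
        push_cast
        ring
      rwa [e1] at h1
    · filter_upwards [eventually_ge_atTop n₀] with n hn t ht
      have h1 := hdom n hn (T t) (Pi.single x 1) fun j => by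
        rw [hTb]
        exact abs_le.2 ⟨(ht j trivial).1.le, (ht j trivial).2⟩
      rw [← D.scaledTwist_pow_single (T t) t (hT t)]
      refine (norm_le_pi_norm _ _).trans (h1.trans ?_)
      simp only [hTb]
      rw [gauss, neg_mul]
      refine mul_le_of_le_one_right (Real.exp_pos _).le ?_
      refine (pi_norm_le_iff_of_nonneg zero_le_one).2 fun y => ?_
      by_cases hy : y = x
      · rw [hy, Pi.single_eq_same, norm_one]
      · rw [Pi.single_eq_of_ne hy, norm_zero]
        exact zero_le_one
  simp only [D.tvDist_eq]
  have h := ENNReal.Tendsto.div_const (tendsto_finsetSum Finset.univ fun x _ => key x)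
    (b := 2) (Or.inr two_ne_zero)
  simpa using h

end LatticeFrame

end VirtAb

end

/-! ### The structure theorem. -/

theorem mainTheorem5 {Γ₁ Γ₂ : Type*} [Group Γ₁] [Group Γ₂] {m₁ m₂ : ℕ}
    (hm₁ : 1 ≤ m₁) (hm₂ : 1 ≤ m₂) {E₁ E₂ : Type*}
    [NormedAddCommGroup E₁] [InnerProductSpace ℝ E₁] [FiniteDimensional ℝ E₁]
    [NormedAddCommGroup E₂] [InnerProductSpace ℝ E₂] [FiniteDimensional ℝ E₂]
    (D₁ : VirtAb.LatticeFrame Γ₁ (Fin m₁) E₁) (D₂ : VirtAb.LatticeFrame Γ₂ (Fin m₂) E₂)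
    (ν : PMF (Γ₁ × Γ₂)) (hν_gen : VirtAb.IsNondegenerate ν) (hν_aper : VirtAb.IsAperiodic ν)
    (hν_mom : VirtAb.HasFiniteSecondMoment ν) :
    ∃ (Sν : WithLp 2 (E₁ × E₂) →ₗ[ℝ] WithLp 2 (E₁ × E₂)) (S₁ : E₁ →ₗ[ℝ] E₁) (S₂ : E₂ →ₗ[ℝ] E₂),
      -- the covariances of `ν` and of its marginals
      (D₁.prod D₂).IsCovariance ν Sν ∧ VirtAb.IsPosDef Sν ∧
      D₁.IsCovariance (ν.map Prod.fst) S₁ ∧ D₂.IsCovariance (ν.map Prod.snd) S₂ ∧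
      -- the Gaussian approximation
      Tendsto (fun n : ℕ => VirtAb.tvDist (fun γ => (VirtAb.convPow ν n γ).toReal)
        ((D₁.prod D₂).gaussian n Sν ((D₁.prod D₂).drift ν))) atTop (𝓝 0) ∧
      -- the drift
      (Summable fun e => ((D₁.prod D₂).diagram ν).c e • (D₁.prod D₂).edgeVec e) ∧
      ((D₁.prod D₂).drift ν).fst ∈ LinearMap.range D₁.normTransfer ∧
      ((D₁.prod D₂).drift ν).snd ∈ LinearMap.range D₂.normTransfer ∧
      -- the block form of the covariance in adapted bases
      (∀ (k₁ l₁ k₂ l₂ : ℕ) (b₁ : Module.Basis (Fin k₁ ⊕ Fin l₁) ℝ E₁)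
        (b₂ : Module.Basis (Fin k₂ ⊕ Fin l₂) ℝ E₂),
        VirtAb.IsAdapted b₁ (LinearMap.range D₁.normTransfer) →
        VirtAb.IsAdapted b₂ (LinearMap.range D₂.normTransfer) →
        ∃ (A : Matrix (Fin k₁) (Fin k₂) ℝ) (A' : Matrix (Fin k₂) (Fin k₁) ℝ),
          LinearMap.toMatrix (VirtAb.prodBasis b₁ b₂) (VirtAb.prodBasis b₁ b₂) Sν =
            Matrix.fromBlocks
              (LinearMap.toMatrix b₁ b₁ S₁) (Matrix.fromBlocks A 0 0 0)
              (Matrix.fromBlocks A' 0 0 0) (LinearMap.toMatrix b₂ b₂ S₂)) ∧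
      -- the normalized transfers
      (∀ l : D₁.Λ, D₁.normTransfer (D₁.emb l) =
        (D₁.Λ.index : ℝ)⁻¹ • D₁.ofInt (D₁.transfer l)) ∧
      (∀ l : D₂.Λ, D₂.normTransfer (D₂.emb l) =
        (D₂.Λ.index : ℝ)⁻¹ • D₂.ofInt (D₂.transfer l)) ∧
      LinearMap.range D₁.normTransfer =
        Submodule.span ℝ (Set.range fun γ => D₁.ofInt (D₁.transfer γ)) ∧
      LinearMap.range D₂.normTransfer =
        Submodule.span ℝ (Set.range fun γ => D₂.ofInt (D₂.transfer γ)) ∧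
      ((∀ γ v w, inner ℝ (D₁.Ad γ v) (D₁.Ad γ w) = inner ℝ v w) → ∀ v, D₁.normTransfer v =
        (Submodule.span ℝ (Set.range fun γ => D₁.ofInt (D₁.transfer γ))).starProjection v) ∧
      ((∀ γ v w, inner ℝ (D₂.Ad γ v) (D₂.Ad γ w) = inner ℝ v w) → ∀ v, D₂.normTransfer v =
        (Submodule.span ℝ (Set.range fun γ => D₂.ofInt (D₂.transfer γ))).starProjection v) := by
  have hm := (D₁.prod D₂).hasMoment hν_mom
  let P := D₁.projFst D₂
  let Q := D₁.projSnd D₂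
  obtain ⟨f, Sν, hf, hSν, hpos, hcov⟩ := VirtAb.LatticeFrame.exists_covariance hm hν_gen
  obtain ⟨-, S₁, -, hS₁, -, -⟩ := VirtAb.LatticeFrame.exists_covariance (P.hasMoment hm)
    (hν_gen.map P.hom P.hom_surjective)
  obtain ⟨-, S₂, -, hS₂, -, -⟩ := VirtAb.LatticeFrame.exists_covariance (Q.hasMoment hm)
    (hν_gen.map Q.hom Q.hom_surjective)
  refine ⟨Sν, S₁, S₂, hSν, hpos, hS₁, hS₂,
    (D₁.prod D₂).tendsto_tvDist hm hν_gen hν_aper hf hpos hcov,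
    (VirtAb.LatticeFrame.drift_hasSum hm).summable, P.proj_drift_mem hm, Q.proj_drift_mem hm, ?_,
    D₁.normTransfer_emb, D₂.normTransfer_emb, D₁.range_normTransfer, D₂.range_normTransfer,
    D₁.normTransfer_eq_starProjection, D₂.normTransfer_eq_starProjection⟩
  intro k₁ l₁ k₂ l₂ b₁ b₂ hb₁ hb₂
  exact VirtAb.exists_toMatrix_eq_fromBlocks hb₁ hb₂ Sν S₁ S₂
    (P.inner_covariance hm hν_gen hSν hS₁) (Q.inner_covariance hm hν_gen hSν hS₂)
    -- The two mixed corners are the same statement with the roles of the two projections exchanged.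
    (fun v w h => P.inner_covariance_eq_zero Q (D₁.avg_prod D₂) hm hν_gen hSν h)
    (fun v w h => Q.inner_covariance_eq_zero P
      (fun f g => by
        simp only [mul_comm (f _), mul_comm (D₂.avg f)]
        exact D₁.avg_prod D₂ g f) hm hν_gen hSν h)
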